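/- Write $\lg=\log_2$. Let $n\ge 2$, let $x_0,\dots,x_{n-1}\in\mathbb C$ be distinct knots and $y_0,\dots,y_{n-1}\in\mathbb C$ values with $|x_i|\le 2^{\tau_1}$ and $|y_i|\le 2^{\tau_2}$ for all $i$, where $\tau_1,\tau_2\ge 0$ are real numbers. Let $\Delta_i(x)=\min_{j\ne i}|x_i-x_j|$, let $A(X)=\sum_{j=0}^{n-1}a_jX^j$ be the interpolating polynomial ($A(x_i)=y_i$ for all $i$), let $\ell\ge 0$ be an integer, and put $$\lambda=\ell+68\,n(\tau_1+3)\lg n+4n\tau_2-6\lg\prod_i\Delta_i(x)+50n+60\lg^3 n+20 .$$ Cost is measured in bit operations of programs that consist of finitely many (mutually recursive) first-order functions on binary trees with integer leaves: tree operations, sign tests and calls cost $1$, additions, subtractions, shifts and bit lengths of integers cost linearly many operations in the bit sizes involved, and multiplication is not a primitive. Let $\mu:\mathbb N\to\mathbb R$ be a bound for the bit complexity of integer multiplication, that is, some program multiplies any two integers of at most $m$ bits in at most $\mu(m)$ bit operations for every $m\ge1$; as usual, assume $\mu(a)+\mu(b)\le\mu(a+b)$ for $a,b\ge 1$. 1.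 There is an absolute constant $C$ such that for every such $\mu$ there is one program with the following property for all data as above. Let $p\ge\lambda$ be an integer (for instance $p=\lceil\lambda\rceil$). Given $\ell$, $p$ and approximations $\tilde x_i,\tilde y_i\in 2^{-p}\mathbb Z[\mathrm i]$ with $|x_i-\tilde x_i|\le 2^{-\lambda}$ and $|y_i-\tilde y_i|\le2^{-\lambda}$ for all $i$, the program computes $\tilde a_0,\dots,\tilde a_{n-1}\in2^{-p}\mathbb Z[\mathrm i]$ with $\max_j|a_j-\tilde a_j|\le2^{-\ell}$ in at most $C\,n\lg^2 n\,\mu(p)$ bit operations. In particular, with $p=\lceil\lambda\rceil$ the cost is $O_B(n\lg^2 n\,\mu(\lambda))$. 2. $\lambda\le\ell+O\big(n(\tau_1+1)\lg n+n\tau_2+\max\{0,-\lg\prod_i\Delta_i(x)\}+\lg^3 n\big)$ with an absolute constant. 3. If $\mu(m)=\widetilde O(m)$, that is $\mu(m)\le K\,m\,(1+\lg m)^k$ for some constants $K,k$ and all $m\ge 1$, then $n\lg^2n\,\mu(\lceil\lambda\rceil)=\widetilde O(S)$, that is, it is at most $C\,S\,(1+\lg S)^{k'}$ with constants $C,k'$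 that depend only on $\mu$, where $S=n\ell+n^2(\tau_1+1)+n^2\tau_2+n\max\{0,-\lg\prod_i\Delta_i(x)\}$. -/

import Mathlib

/-! ### A uniform machine model with bit costs

Programs are finite tables of (mutually recursive, call-by-value) first-order functions acting on
binary trees whose leaves are integers.  Building or inspecting a tree node, testing a sign and
calling a function cost one unit; sums, differences, shifts and bit lengths of integers cost a
number of units linear in the bit sizes involved.  Multiplication of integers is *not* a primitive:
it has to be programmed, and its running time is the quantity `μ` below. -/

/-- Data: binary trees with integer leaves. -/
inductive Val : Type
  | int (z : ℤ) : Val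
  | pair (a b : Val) : Val

/-- Expressions, evaluated with respect to one argument (a tree). -/
inductive Code : Type
  /-- the argument itself -/
  | arg : Code
  /-- an integer constant -/
  | const (z : ℤ) : Code
  | pair (c d : Code) : Code
  | fst (c : Code) : Code
  | snd (c : Code) : Code
  /-- evaluate `c` to `a`, then `d` with the argument `v` replaced by `(a, v)` -/
  | letIn (c d : Code) : Code
  | add (c d : Code) : Code
  | sub (c d : Code) : Code
  /-- multiplication by a power of two -/
  | shl (c d : Code) : Code
  /-- floor division by a power of two -/
  | shr (c d : Code) : Code
  /-- bit length of the absolute value -/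
  | size (c : Code) : Code
  /-- if the integer `c` is negative then `d` else `e` -/
  | ifNeg (c d e : Code) : Code
  /-- if the value of `c` is a leaf then `d` else `e` -/
  | ifLeaf (c d e : Code) : Code
  /-- call function number `f` of the program on the value of `c` -/
  | call (f : ℕ) (c : Code) : Code

/-- A program is a finite table of function bodies. -/
abbrev Program : Type := List Code

/-- Bit length of `|z|`. -/
def bitLen (z : ℤ) : ℕ := Nat.size z.natAbs

/-- `Run P c v w t`: in the program `P`, the expression `c` with argument `v` evaluates to `w`
in `t` bit operations. -/
inductive Run (P : Program) : Code → Val → Val → ℕ → Prop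
  | arg (v : Val) : Run P .arg v v 1
  | const (z : ℤ) (v : Val) : Run P (.const z) v (.int z) (bitLen z + 1)
  | pair {c d : Code} {v a b : Val} {s t : ℕ} :
      Run P c v a s → Run P d v b t → Run P (.pair c d) v (.pair a b) (s + t + 1)
  | fst {c : Code} {v a b : Val} {s : ℕ} :
      Run P c v (.pair a b) s → Run P (.fst c) v a (s + 1)
  | snd {c : Code} {v a b : Val} {s : ℕ} :
      Run P c v (.pair a b) s → Run P (.snd c) v b (s + 1)
  | letIn {c d : Code} {v a b : Val} {s t : ℕ} :
      Run P c v a s → Run P d (.pair a v) b t → Run P (.letIn c d) v b (s + t + 1)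
  | add {c d : Code} {v : Val} {x y : ℤ} {s t : ℕ} :
      Run P c v (.int x) s → Run P d v (.int y) t →
      Run P (.add c d) v (.int (x + y)) (s + t + bitLen x + bitLen y + 1)
  | sub {c d : Code} {v : Val} {x y : ℤ} {s t : ℕ} :
      Run P c v (.int x) s → Run P d v (.int y) t →
      Run P (.sub c d) v (.int (x - y)) (s + t + bitLen x + bitLen y + 1)
  | shl {c d : Code} {v : Val} {x : ℤ} {k s t : ℕ} :
      Run P c v (.int x) s → Run P d v (.int k) t →
      Run P (.shl c d) v (.int (x * 2 ^ k)) (s + t + bitLen x + k + 1)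
  | shr {c d : Code} {v : Val} {x : ℤ} {k s t : ℕ} :
      Run P c v (.int x) s → Run P d v (.int k) t →
      Run P (.shr c d) v (.int (x / 2 ^ k)) (s + t + bitLen x + bitLen k + 1)
  | size {c : Code} {v : Val} {x : ℤ} {s : ℕ} :
      Run P c v (.int x) s → Run P (.size c) v (.int (bitLen x)) (s + bitLen x + 1)
  | ifNeg_neg {c d e : Code} {v w : Val} {x : ℤ} {s t : ℕ} :
      Run P c v (.int x) s → x < 0 → Run P d v w t → Run P (.ifNeg c d e) v w (s + t + 1)
  | ifNeg_nonneg {c d e : Code} {v w : Val} {x : ℤ} {s t : ℕ} :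
      Run P c v (.int x) s → 0 ≤ x → Run P e v w t → Run P (.ifNeg c d e) v w (s + t + 1)
  | ifLeaf_int {c d e : Code} {v w : Val} {x : ℤ} {s t : ℕ} :
      Run P c v (.int x) s → Run P d v w t → Run P (.ifLeaf c d e) v w (s + t + 1)
  | ifLeaf_pair {c d e : Code} {v w a b : Val} {s t : ℕ} :
      Run P c v (.pair a b) s → Run P e v w t → Run P (.ifLeaf c d e) v w (s + t + 1)
  | call {f : ℕ} {c body : Code} {v a w : Val} {s t : ℕ} :
      Run P c v a s → P[f]? = some body → Run P body a w t →
      Run P (.call f c) v w (s + t + 1)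

/-- Function number `f` of the program `P` maps the input `v` to the output `w` in `t` bit
operations. -/
def Program.Computes (P : Program) (f : ℕ) (v w : Val) (t : ℕ) : Prop :=
  ∃ body : Code, P[f]? = some body ∧ Run P body v w t

/-- Some program multiplies any two integers of at most `m` bits in at most `μ m` bit
operations, for every `m ≥ 1`. -/
def MultipliesInTime (μ : ℕ → ℝ) : Prop :=
  ∃ (M : Program) (f : ℕ), ∀ m : ℕ, 1 ≤ m → ∀ a b : ℤ, bitLen a ≤ m → bitLen b ≤ m →
    ∃ t : ℕ, M.Computes f (.pair (.int a) (.int b)) (.int (a * b)) t ∧ (t : ℝ) ≤ μ m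

/-- The usual growth convention on multiplication times: `μ a + μ b ≤ μ (a + b)`. -/
def Superadditive (μ : ℕ → ℝ) : Prop :=
  ∀ a b : ℕ, 1 ≤ a → 1 ≤ b → μ a + μ b ≤ μ (a + b)

/-- `μ m = Õ(m)`. -/
def SoftLinear (μ : ℕ → ℝ) : Prop :=
  ∃ (K : ℝ) (k : ℕ), ∀ m : ℕ, 1 ≤ m → μ m ≤ K * m * (1 + Real.logb 2 m) ^ k

/-- Lists as trees: the empty list is the leaf `0`, and `pair` is the list constructor. -/
def Val.ofList : List Val → Val
  | [] => .int 0
  | a :: l => .pair a (Val.ofList l)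

/-- A Gaussian integer as the pair of its real and imaginary parts. -/
def Val.ofGauss (z : GaussianInt) : Val := .pair (.int z.re) (.int z.im)

/-- The complex number `z / 2 ^ p`, with `p` binary digits after the point. -/
noncomputable def dyadic (p : ℕ) (z : GaussianInt) : ℂ := GaussianInt.toComplex z / 2 ^ p

/-- The input of the interpolation program: the target precision `ℓ`, the number `p` of binary
digits after the point, and the list of pairs (knot, value), as multiples of `2 ^ (-p)`. -/
def interpInput {n : ℕ} (ℓ p : ℕ) (X Y : Fin n → GaussianInt) : Val :=
  .pair (.int ℓ) (.pair (.int p)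
    (Val.ofList (List.ofFn fun i => .pair (Val.ofGauss (X i)) (Val.ofGauss (Y i)))))

/-! ### The interpolation problem -/

/-- The local separation `Δ_i(x) = min_{j ≠ i} |x_i - x_j|`. -/
noncomputable def localSep {n : ℕ} (x : Fin n → ℂ) (i : Fin n) : ℝ :=
  ⨅ j : {j : Fin n // j ≠ i}, ‖x i - x j‖

/-- `lg ∏_i Δ_i(x)`. -/
noncomputable def lgProdSep {n : ℕ} (x : Fin n → ℂ) : ℝ :=
  Real.logb 2 (∏ i, localSep x i)

/-- The input precision `λ`. -/
noncomputable def interpPrecision {n : ℕ} (ℓ : ℕ) (τ₁ τ₂ : ℝ) (x : Fin n → ℂ) : ℝ :=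
  ℓ + 68 * n * (τ₁ + 3) * Real.logb 2 n + 4 * n * τ₂ - 6 * lgProdSep x + 50 * n
    + 60 * Real.logb 2 n ^ 3 + 20

/-- An instance: `n ≥ 2` distinct knots `|x_i| ≤ 2 ^ τ₁` and values `|y_i| ≤ 2 ^ τ₂`. -/
structure IsInterpInstance {n : ℕ} (τ₁ τ₂ : ℝ) (x y : Fin n → ℂ) : Prop where
  two_le : 2 ≤ n
  tau₁_nonneg : 0 ≤ τ₁
  tau₂_nonneg : 0 ≤ τ₂
  distinct : Function.Injective x
  norm_knot_le : ∀ i, ‖x i‖ ≤ (2 : ℝ) ^ τ₁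
  norm_value_le : ∀ i, ‖y i‖ ≤ (2 : ℝ) ^ τ₂

/-- `b` approximates `a` to precision `r`: `|a - b| ≤ 2 ^ (-r)`. -/
def IsApprox (r : ℝ) (a b : ℂ) : Prop := ‖a - b‖ ≤ (2 : ℝ) ^ (-r)

/-! ### Bit lengths -/

/-! Write P = ∏(X - x_i). Lagrange's formula gives A = ∑ (y_i / P'(x_i)) P / (X - x_i), so the task
is to find the denominators P'(x_i), to divide, and to sum up along a product tree.

The denominators come from power sums, without division with remainder. With D = ∏(1 - x_i X) and G
= -∑_i ∏_{j≠i}(1 - x_j X), the series G · (-1/D) = ∑ 1/(1 - x_i X) generates the power sums ∑ x_i^k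
(`lsum_rfac_mul`); the negative reciprocal is found by Newton's iteration (`newton_step`,
`negInv_spec`). Read in reverse order, power sums with weights w_i behave well under products: the
middle coefficients of q times the reversed sums are the reversed sums with weights w_i q(x_i)
(`coeff_mul_powerSums`). If q is the product of the X - x_j over one child of a tree node, the knots
of that child get weight 0, and the sums of the other child remain. Starting from weights 1 at the
root, the leaf i receives exactly the weight P'(x_i). The way back up combines A = A₁P₂ + A₂P₁
(`solve_spec`).

Cost. Polynomials with 2^d coefficients are multiplied by a Fourier transform modulo 2^N + 1, in
which 2 is a root of unity, N being a power of two between 8p and 16p (`mulMod_spec`). Numbers of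
O(p) bits are multiplied in pieces of p bits, because superadditivity does not bound μ(32p) by a
multiple of μ(p). A product then costs O(2^d (d + 1) μ(p)), and the bit length M of n levels of a
tree cost O(2^M (M + 1)² μ(p)). Superadditivity also makes the cost of Newton's iteration for
integer reciprocals a geometric sum (`recip_spec`).

Precision. Errors are measured in the ℓ¹ norm of truncated power series, which is submultiplicative
(`nrm_mul`). For R = 2^τ₁, a product over 2^d knots has norm at most (4R)^(2^d) and error at most ε
(32R)^(2^d). Newton's iteration loses a factor 5θ² in each of M doublings, where θ = (4R)^(2^M);
this is the source of the term n(τ₁ + 3) lg n in λ. Dividing by P'(x_i) is controlled by |P'(x_i)| ≥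
∏Δ_j / (2R) (`prod_localSep_le`), which enters squared. The precision λ exceeds ℓ plus the sum of
these losses (`target`).

Programs are verified by weakest preconditions that track value and cost together; recursive
functions are treated by induction, one specification per function. The remaining two claims are
elementary estimates of λ. -/

theorem bitLen_le_iff {z : ℤ} {s : ℕ} : bitLen z ≤ s ↔ |z| < 2 ^ s := by
  rw [bitLen, Nat.size_le, Int.abs_eq_natAbs]
  exact_mod_cast Iff.rfl

theorem bitLen_le_of_abs_le {z : ℤ} {s : ℕ} (h : |z| ≤ 2 ^ s) : bitLen z ≤ s + 1 := by
  rw [bitLen_le_iff, pow_succ]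
  have : (0 : ℤ) < 2 ^ s := by positivity
  linarith

theorem abs_le_of_bitLen_le {z : ℤ} {s : ℕ} (h : bitLen z ≤ s) : |z| ≤ 2 ^ s :=
  (bitLen_le_iff.1 h).le

theorem lt_bitLen_iff {z : ℤ} {s : ℕ} : s < bitLen z ↔ 2 ^ s ≤ |z| := by
  rw [← not_le, bitLen_le_iff, not_lt]

theorem bitLen_natCast_le (k : ℕ) : bitLen (k : ℤ) ≤ k := by
  rw [bitLen_le_iff, abs_of_nonneg (by positivity)]
  exact_mod_cast k.lt_two_pow_self

theorem bitLen_zero : bitLen 0 = 0 := by simp [bitLen]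
theorem bitLen_one : bitLen 1 = 1 := by simp [bitLen]
theorem bitLen_neg_one : bitLen (-1) = 1 := by simp [bitLen]

/-! ### Weakest preconditions -/

/-- Function `f` of `P` maps `v` to `w` in at most `B` bit operations. -/
def Within (P : Program) (f : ℕ) (v w : Val) (B : ℕ) : Prop :=
  ∃ t, P.Computes f v w t ∧ t ≤ B

theorem Within.mono {P : Program} {f : ℕ} {v w : Val} {B B' : ℕ} (h : Within P f v w B)
    (hB : B ≤ B') : Within P f v w B' := by
  obtain ⟨t, h, ht⟩ := h
  exact ⟨t, h, ht.trans hB⟩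

/-- `v` is an integer that satisfies `Q`. -/
def OnInt (v : Val) (Q : ℤ → Prop) : Prop :=
  match v with
  | .int z => Q z
  | .pair _ _ => False

/-- `v` is a natural number that satisfies `Q`. -/
def OnNat (v : Val) (Q : ℕ → Prop) : Prop := OnInt v fun z => ∃ k : ℕ, (k : ℤ) = z ∧ Q k

/-- `v` is a pair that satisfies `Q`. -/
def OnPair (v : Val) (Q : Val → Val → Prop) : Prop :=
  match v with
  | .int _ => False
  | .pair a b => Q a b

/-- Case distinction on the shape of a value. -/
def OnShape (v : Val) (Q R : Prop) : Prop :=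
  match v with
  | .int _ => Q
  | .pair _ _ => R

/-- A sufficient condition for `c` to evaluate at `v` to some value `w` in some time `t` that
satisfy `Q w t`. -/
def wp (P : Program) : Code → Val → (Val → ℕ → Prop) → Prop
  | .arg, v, Q => Q v 1
  | .const z, _, Q => Q (.int z) (bitLen z + 1)
  | .pair c d, v, Q => wp P c v fun a s => wp P d v fun b t => Q (.pair a b) (s + t + 1)
  | .fst c, v, Q => wp P c v fun a s => OnPair a fun x _ => Q x (s + 1)
  | .snd c, v, Q => wp P c v fun a s => OnPair a fun _ y => Q y (s + 1)
  | .letIn c d, v, Q => wp P c v fun a s => wp P d (.pair a v) fun b t => Q b (s + t + 1)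
  | .add c d, v, Q => wp P c v fun a s => wp P d v fun b t => OnInt a fun x => OnInt b fun y =>
      Q (.int (x + y)) (s + t + bitLen x + bitLen y + 1)
  | .sub c d, v, Q => wp P c v fun a s => wp P d v fun b t => OnInt a fun x => OnInt b fun y =>
      Q (.int (x - y)) (s + t + bitLen x + bitLen y + 1)
  | .shl c d, v, Q => wp P c v fun a s => wp P d v fun b t => OnInt a fun x => OnNat b fun k =>
      Q (.int (x * 2 ^ k)) (s + t + bitLen x + k + 1)
  | .shr c d, v, Q => wp P c v fun a s => wp P d v fun b t => OnInt a fun x => OnNat b fun k =>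
      Q (.int (x / 2 ^ k)) (s + t + bitLen x + bitLen k + 1)
  | .size c, v, Q => wp P c v fun a s => OnInt a fun x => Q (.int (bitLen x)) (s + bitLen x + 1)
  | .ifNeg c d e, v, Q => wp P c v fun a s => OnInt a fun x =>
      if x < 0 then wp P d v fun w t => Q w (s + t + 1) else wp P e v fun w t => Q w (s + t + 1)
  | .ifLeaf c d e, v, Q => wp P c v fun a s =>
      OnShape a (wp P d v fun w t => Q w (s + t + 1)) (wp P e v fun w t => Q w (s + t + 1))
  | .call f c, v, Q => wp P c v fun a s =>
      ∃ w B, Within P f a w B ∧ ∀ t ≤ B, Q w (s + t + 1)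

/-- Structural induction on the expression suffices although programs are recursive: at a call, `wp`
demands `Within` for the called function, so recursion is left to the induction in each
specification. Since only a bound for the running time of the callee is known, `wp` asks for the
postcondition at every time up to that bound. -/
theorem wp_sound {P : Program} {c : Code} {v : Val} {Q : Val → ℕ → Prop} (h : wp P c v Q) :
    ∃ w t, Run P c v w t ∧ Q w t := by
  induction c generalizing v Q with
  | arg => exact ⟨_, _, .arg v, h⟩
  | const z => exact ⟨_, _, .const z v, h⟩
  | pair c d hc hd =>
    obtain ⟨a, s, ha, h⟩ := hc h
    obtain ⟨b, t, hb, h⟩ := hd h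
    exact ⟨_, _, .pair ha hb, h⟩
  | fst c hc =>
    obtain ⟨a, s, ha, h⟩ := hc h
    cases a with
    | int z => exact h.elim
    | pair a b => exact ⟨_, _, .fst ha, h⟩
  | snd c hc =>
    obtain ⟨a, s, ha, h⟩ := hc h
    cases a with
    | int z => exact h.elim
    | pair a b => exact ⟨_, _, .snd ha, h⟩
  | letIn c d hc hd =>
    obtain ⟨a, s, ha, h⟩ := hc h
    obtain ⟨b, t, hb, h⟩ := hd h
    exact ⟨_, _, .letIn ha hb, h⟩
  | add c d hc hd =>
    obtain ⟨a, s, ha, h⟩ := hc h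
    obtain ⟨b, t, hb, h⟩ := hd h
    cases a with
    | pair a b => exact h.elim
    | int x =>
      cases b with
      | pair a b => exact h.elim
      | int y => exact ⟨_, _, .add ha hb, h⟩
  | sub c d hc hd =>
    obtain ⟨a, s, ha, h⟩ := hc h
    obtain ⟨b, t, hb, h⟩ := hd h
    cases a with
    | pair a b => exact h.elim
    | int x =>
      cases b with
      | pair a b => exact h.elim
      | int y => exact ⟨_, _, .sub ha hb, h⟩
  | shl c d hc hd =>
    obtain ⟨a, s, ha, h⟩ := hc h
    obtain ⟨b, t, hb, h⟩ := hd h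
    cases a with
    | pair a b => exact h.elim
    | int x =>
      cases b with
      | pair a b => exact h.elim
      | int y =>
        obtain ⟨k, rfl, h⟩ := h
        exact ⟨_, _, .shl ha hb, h⟩
  | shr c d hc hd =>
    obtain ⟨a, s, ha, h⟩ := hc h
    obtain ⟨b, t, hb, h⟩ := hd h
    cases a with
    | pair a b => exact h.elim
    | int x =>
      cases b with
      | pair a b => exact h.elim
      | int y =>
        obtain ⟨k, rfl, h⟩ := h
        exact ⟨_, _, .shr ha hb, h⟩
  | size c hc =>
    obtain ⟨a, s, ha, h⟩ := hc h
    cases a with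
    | int z => exact ⟨_, _, .size ha, h⟩
    | pair a b => exact h.elim
  | ifNeg c d e hc hd he =>
    obtain ⟨a, s, ha, h⟩ := hc h
    cases a with
    | pair a b => exact h.elim
    | int z =>
      change if z < 0 then _ else _ at h
      split_ifs at h with hz
      · obtain ⟨w, t, hw, h⟩ := hd h
        exact ⟨_, _, .ifNeg_neg ha hz hw, h⟩
      · obtain ⟨w, t, hw, h⟩ := he h
        exact ⟨_, _, .ifNeg_nonneg ha (not_lt.1 hz) hw, h⟩
  | ifLeaf c d e hc hd he =>
    obtain ⟨a, s, ha, h⟩ := hc h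
    cases a with
    | int z =>
      obtain ⟨w, t, hw, h⟩ := hd h
      exact ⟨_, _, .ifLeaf_int ha hw, h⟩
    | pair a b =>
      obtain ⟨w, t, hw, h⟩ := he h
      exact ⟨_, _, .ifLeaf_pair ha hw, h⟩
  | call f c hc =>
    obtain ⟨a, s, ha, w, B, ⟨t, ⟨body, hb, hr⟩, ht⟩, h⟩ := hc h
    exact ⟨_, _, .call ha hb hr, h t ht⟩

theorem within_of_wp {P : Program} {f : ℕ} {body : Code} {v w : Val} {B : ℕ}
    (hf : P[f]? = some body) (h : wp P body v fun w' t => w' = w ∧ t ≤ B) : Within P f v w B := by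
  obtain ⟨w', t, hr, rfl, ht⟩ := wp_sound h
  exact ⟨t, ⟨body, hf, hr⟩, ht⟩

theorem wp_fst (P : Program) (v : Val) (Q : Val → ℕ → Prop) (c : Code) :
    wp P (.fst c) v Q = wp P c v fun a s => OnPair a fun x _ => Q x (s + 1) := rfl

theorem wp_snd (P : Program) (v : Val) (Q : Val → ℕ → Prop) (c : Code) :
    wp P (.snd c) v Q = wp P c v fun a s => OnPair a fun _ y => Q y (s + 1) := rfl

theorem onNat_natCast (k : ℕ) (Q : ℕ → Prop) : OnNat (.int k) Q = Q k := by
  simp [OnNat, OnInt]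

/-! ### Access to tuples -/

/-- The argument without its first `i` components. -/
def Code.drop : ℕ → Code
  | 0 => .arg
  | i + 1 => .snd (Code.drop i)

/-- Component number `i` of the argument. -/
def Code.nth (i : ℕ) : Code := .fst (Code.drop i)

/-- The value without its first `i` components, for `Code.drop`. -/
def OnDrop : ℕ → Val → (Val → Prop) → Prop
  | 0, v, Q => Q v
  | i + 1, v, Q => OnPair v fun _ w => OnDrop i w Q

/-- `Code.drop` applies its last projection at the end, `OnDrop` unfolds from the first component;
this exchanges the two orders. -/
theorem onDrop_succ (i : ℕ) (v : Val) (Q : Val → Prop) :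
    OnDrop (i + 1) v Q = OnDrop i v fun w => OnPair w fun _ y => Q y := by
  induction i generalizing v Q with
  | zero => rfl
  | succ i ih =>
    cases v with
    | int z => rfl
    | pair a b => exact ih b Q

theorem wp_drop (P : Program) (i : ℕ) (v : Val) (Q : Val → ℕ → Prop) :
    wp P (Code.drop i) v Q = OnDrop i v fun w => Q w (i + 1) := by
  induction i generalizing Q with
  | zero => rfl
  | succ i ih => rw [Code.drop, wp_snd, ih, onDrop_succ]

theorem wp_nth (P : Program) (i : ℕ) (v : Val) (Q : Val → ℕ → Prop) :
    wp P (Code.nth i) v Q = OnDrop i v fun w => OnPair w fun a _ => Q a (i + 2) := by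
  rw [Code.nth, wp_fst, wp_drop]

/-- All evaluation rules, as one rewriting rule. -/
theorem wp_rules (P : Program) :
    (∀ v Q, wp P .arg v Q = Q v 1) ∧
    (∀ z v Q, wp P (.const z) v Q = Q (.int z) (bitLen z + 1)) ∧
    (∀ c d v Q, wp P (.pair c d) v Q =
      wp P c v fun a s => wp P d v fun b t => Q (.pair a b) (s + t + 1)) ∧
    (∀ c v Q, wp P (.fst c) v Q = wp P c v fun a s => OnPair a fun x _ => Q x (s + 1)) ∧
    (∀ c v Q, wp P (.snd c) v Q = wp P c v fun a s => OnPair a fun _ y => Q y (s + 1)) ∧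
    (∀ c d v Q, wp P (.letIn c d) v Q =
      wp P c v fun a s => wp P d (.pair a v) fun b t => Q b (s + t + 1)) ∧
    (∀ c d v Q, wp P (.add c d) v Q =
      wp P c v fun a s => wp P d v fun b t => OnInt a fun x => OnInt b fun y =>
        Q (.int (x + y)) (s + t + bitLen x + bitLen y + 1)) ∧
    (∀ c d v Q, wp P (.sub c d) v Q =
      wp P c v fun a s => wp P d v fun b t => OnInt a fun x => OnInt b fun y =>
        Q (.int (x - y)) (s + t + bitLen x + bitLen y + 1)) ∧
    (∀ c d v Q, wp P (.shl c d) v Q =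
      wp P c v fun a s => wp P d v fun b t => OnInt a fun x => OnNat b fun k =>
        Q (.int (x * 2 ^ k)) (s + t + bitLen x + k + 1)) ∧
    (∀ c d v Q, wp P (.shr c d) v Q =
      wp P c v fun a s => wp P d v fun b t => OnInt a fun x => OnNat b fun k =>
        Q (.int (x / 2 ^ k)) (s + t + bitLen x + bitLen k + 1)) ∧
    (∀ c v Q, wp P (.size c) v Q =
      wp P c v fun a s => OnInt a fun x => Q (.int (bitLen x)) (s + bitLen x + 1)) ∧
    (∀ c d e v Q, wp P (.ifNeg c d e) v Q = wp P c v fun a s => OnInt a fun x =>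
      if x < 0 then wp P d v fun w t => Q w (s + t + 1)
      else wp P e v fun w t => Q w (s + t + 1)) ∧
    (∀ c d e v Q, wp P (.ifLeaf c d e) v Q = wp P c v fun a s =>
      OnShape a (wp P d v fun w t => Q w (s + t + 1)) (wp P e v fun w t => Q w (s + t + 1))) ∧
    (∀ f c v Q, wp P (.call f c) v Q = wp P c v fun a s =>
      ∃ w B, Within P f a w B ∧ ∀ t ≤ B, Q w (s + t + 1)) ∧
    (∀ i v Q, wp P (Code.drop i) v Q = OnDrop i v fun w => Q w (i + 1)) ∧
    (∀ i v Q, wp P (Code.nth i) v Q = OnDrop i v fun w => OnPair w fun a _ => Q a (i + 2)) :=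
  ⟨fun _ _ => rfl, fun _ _ _ => rfl, fun _ _ _ _ => rfl, fun _ _ _ => rfl, fun _ _ _ => rfl,
    fun _ _ _ _ => rfl, fun _ _ _ _ => rfl, fun _ _ _ _ => rfl, fun _ _ _ _ => rfl,
    fun _ _ _ _ => rfl, fun _ _ _ => rfl, fun _ _ _ _ _ => rfl, fun _ _ _ _ _ => rfl,
    fun _ _ _ _ => rfl, wp_drop P, wp_nth P⟩

/-- Values of known shape. -/
theorem shape_rules :
    (∀ (z : ℤ) Q, OnInt (.int z) Q = Q z) ∧
    (∀ (k : ℕ) Q, OnNat (.int k) Q = Q k) ∧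
    (∀ a b Q, OnPair (.pair a b) Q = Q a b) ∧
    (∀ (z : ℤ) Q R, OnShape (.int z) Q R = Q) ∧
    (∀ a b Q R, OnShape (.pair a b) Q R = R) ∧
    (∀ v Q, OnDrop 0 v Q = Q v) ∧
    (∀ i a v Q, OnDrop (i + 1) (.pair a v) Q = OnDrop i v Q) :=
  ⟨fun _ _ => rfl, onNat_natCast, fun _ _ _ => rfl, fun _ _ _ => rfl, fun _ _ _ _ => rfl,
    fun _ _ => rfl, fun _ _ _ _ => rfl⟩

/-! ### The program

`b` is the number of the first function and `f` the number of the given multiplication. -/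

namespace Interp

open Code

/-- Product of `a` and `b`, with `a` cut into pieces of `s` bits; argument `(s, a, b)`. -/
def mulPieces (b f : ℕ) : Code :=
  .ifNeg (.sub (nth 0) (.size (nth 1)))
    (.letIn (.shr (nth 1) (nth 0))
      (.add (.shl (.call b (.pair (nth 1) (.pair (nth 0) (drop 3)))) (nth 1))
        (.call f (.pair (.sub (nth 2) (.shl (nth 0) (nth 1))) (drop 3)))))
    (.call f (.pair (nth 1) (drop 2)))

/-- Product of `a` and `b`, both cut into pieces of `s` bits; argument `(s, a, b)`. -/
def mulBoth (b : ℕ) : Code :=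
  .ifNeg (.sub (nth 0) (.size (drop 2)))
    (.letIn (.shr (drop 2) (nth 0))
      (.add (.shl (.call (b + 1) (.pair (nth 1) (.pair (nth 2) (nth 0)))) (nth 1))
        (.call b (.pair (nth 1) (.pair (nth 2) (.sub (drop 3) (.shl (nth 0) (nth 1))))))))
    (.call b .arg)

/-- One reduction step modulo `2 ^ N + 1`; argument `(N, x)`. -/
def reduceOnce : Code :=
  .letIn (.shr (.add (drop 1) (.shl (.const 1) (.sub (nth 0) (.const 1)))) (nth 0))
    (.sub (.sub (drop 2) (.shl (nth 0) (nth 1))) (nth 0))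

/-- Reduction modulo `2 ^ N + 1`; argument `(N, x)`. -/
def reduce (b : ℕ) : Code := .call (b + 2) (.pair (nth 0) (.call (b + 2) .arg))

/-- Coefficientwise `((x ± y 2 ^ e) 2 ^ e₂ mod (2 ^ N + 1)) / 2 ^ e₃`; argument
`(x, y, N, e, e₂, e₃, sign)`. -/
def linear (b : ℕ) : Code :=
  .ifLeaf (nth 0)
    (.shr (.call (b + 3) (.pair (nth 2) (.shl (.ifNeg (drop 6)
      (.sub (nth 0) (.shl (nth 1) (nth 3)))
      (.add (nth 0) (.shl (nth 1) (nth 3)))) (nth 4)))) (nth 5))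
    (.pair (.call (b + 4) (.pair (.fst (nth 0)) (.pair (.fst (nth 1)) (drop 2))))
      (.call (b + 4) (.pair (.snd (nth 0)) (.pair (.snd (nth 1)) (drop 2)))))

/-- A call of `linear`. -/
def callLinear (b : ℕ) (x y N e e₂ e₃ σ : Code) : Code :=
  .call (b + 4) (.pair x (.pair y (.pair N (.pair e (.pair e₂ (.pair e₃ σ))))))

/-- `2 ^ d` times the product of two polynomials with `2 ^ d` coefficients, modulo
`X ^ (2 ^ d) - 2 ^ e` and `2 ^ N + 1`; argument `(x, y, e, N, s)`. -/
def mulMod (b : ℕ) : Code :=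
  .ifLeaf (nth 0)
    (.call (b + 3) (.pair (nth 3) (.call (b + 1) (.pair (drop 4) (.pair (nth 0) (nth 1))))))
    (.letIn (.shr (nth 2) (.const 1))
      (.letIn
        (.call (b + 5) (.pair
          (callLinear b (.fst (nth 1)) (.snd (nth 1)) (nth 4) (nth 0) (.const 0) (.const 0)
            (.const 0))
          (.pair
            (callLinear b (.fst (nth 2)) (.snd (nth 2)) (nth 4) (nth 0) (.const 0) (.const 0)
              (.const 0))
            (.pair (nth 0) (drop 4)))))
        (.letIn
          (.call (b + 5) (.pair
            (callLinear b (.fst (nth 2)) (.snd (nth 2)) (nth 5) (nth 1) (.const 0) (.const 0)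
              (.const (-1)))
            (.pair
              (callLinear b (.fst (nth 3)) (.snd (nth 3)) (nth 5) (nth 1) (.const 0) (.const 0)
                (.const (-1)))
              (.pair (.add (nth 1) (nth 5)) (drop 5)))))
          (.pair
            (callLinear b (nth 1) (nth 0) (nth 6) (.const 0) (.const 0) (.const 0) (.const 0))
            (callLinear b (nth 0) (nth 1) (nth 6) (.const 0) (.sub (nth 6) (nth 2)) (.const 0)
              (.const (-1)))))))

/-- `2 ^ (d + 1)` times the product of two polynomials with `2 ^ d` coefficients; argument
`(x, y, N, s)`. -/
def mulPoly (b : ℕ) : Code :=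
  .letIn (.call (b + 5) (.pair (nth 0) (.pair (nth 1) (.pair (.const 0) (drop 2)))))
    (.letIn (.call (b + 5) (.pair (nth 1) (.pair (nth 2) (.pair (nth 3) (drop 3)))))
      (.pair
        (callLinear b (nth 1) (nth 0) (nth 4) (.const 0) (.const 0) (.const 0) (.const 0))
        (callLinear b (nth 1) (nth 0) (nth 4) (.const 0) (.const 0) (.const 0) (.const (-1)))))

/-- The depth of a perfect tree. -/
def depth (b : ℕ) : Code :=
  .ifLeaf .arg (.const 0) (.add (.const 1) (.call (b + 7) (.fst .arg)))

/-- A call of `mulPoly`. -/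
def callMulPoly (b : ℕ) (x y ctx : Code) : Code := .call (b + 6) (.pair x (.pair y ctx))

/-- Rounded product of complex polynomials; argument `(x, y, N, p)`. -/
def mulComplex (b : ℕ) : Code :=
  .letIn (.add (.add (drop 3) (.const 1)) (.call (b + 7) (.fst (nth 0))))
    (.pair
      (callLinear b
        (callMulPoly b (.fst (nth 1)) (.fst (nth 2)) (drop 3))
        (callMulPoly b (.snd (nth 1)) (.snd (nth 2)) (drop 3))
        (nth 3) (.const 0) (.const 0) (nth 0) (.const (-1)))
      (callLinear b
        (callMulPoly b (.fst (nth 1)) (.snd (nth 2)) (drop 3))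
        (callMulPoly b (.snd (nth 1)) (.fst (nth 2)) (drop 3))
        (nth 3) (.const 0) (.const 0) (nth 0) (.const 0)))

/-- A call of `mulComplex`. -/
def callMulComplex (b : ℕ) (x y ctx : Code) : Code := .call (b + 8) (.pair x (.pair y ctx))

/-- The negative reciprocal of a power series with constant coefficient `1`; argument
`(x, N, p)`. -/
def negInv (b : ℕ) : Code :=
  .ifLeaf (.fst (nth 0))
    (.pair (.sub (.const 0) (.shl (.const 1) (drop 2))) (.const 0))
    (.letIn (.call (b + 9)
        (.pair (.pair (.fst (.fst (nth 0))) (.fst (.snd (nth 0)))) (drop 1)))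
      (.letIn (callMulComplex b (nth 1) (callMulComplex b (nth 0) (nth 0) (drop 2)) (drop 2))
        (.pair (.pair (.fst (nth 1)) (.snd (.fst (.fst (nth 0)))))
          (.pair (.snd (nth 1)) (.snd (.fst (.snd (nth 0))))))))

/-- Sum of complex polynomials; argument `(x, y, N, p)`. -/
def addComplex (b : ℕ) : Code :=
  .pair
    (callLinear b (.fst (nth 0)) (.fst (nth 1)) (nth 2) (.const 0) (.const 0) (.const 0)
      (.const 0))
    (callLinear b (.snd (nth 0)) (.snd (nth 1)) (nth 2) (.const 0) (.const 0) (.const 0)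
      (.const 0))

/-- A call of `addComplex`. -/
def callAddComplex (b : ℕ) (x y ctx : Code) : Code := .call (b + 10) (.pair x (.pair y ctx))

/-- The trees of products of linear factors; argument `(list, d, N, p)`, value
`((tree, D, N), rest)`. -/
def products (b : ℕ) : Code :=
  .ifNeg (.sub (nth 1) (.const 1))
    (.ifLeaf (nth 0)
      (.letIn (.pair (.pair (.shl (.const 1) (drop 3)) (.const 0))
          (.pair (.const 0) (.const 0)))
        (.pair (.pair (.pair (nth 0) (.const 0))
            (.pair (nth 0) (.pair (.pair (.const 0) (.const 0)) (.pair (.const 0) (.const 0)))))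
          (.const 0)))
      (.letIn (.shl (.const 1) (drop 3))
        (.letIn (.sub (.const 0) (.fst (.fst (.fst (nth 1)))))
          (.letIn (.sub (.const 0) (.snd (.fst (.fst (nth 2)))))
            (.pair
              (.pair
                (.pair (.pair (.pair (nth 1) (nth 2)) (.pair (nth 0) (.const 0)))
                  (.snd (.fst (nth 3))))
                (.pair (.pair (.pair (nth 2) (nth 1)) (.pair (.const 0) (nth 0)))
                  (.pair (.pair (.sub (.const 0) (nth 2)) (.const 0))
                    (.pair (.const 0) (.const 0)))))
              (.snd (nth 3)))))))
    (.letIn (.sub (nth 1) (.const 1))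
      (.letIn (.call (b + 11) (.pair (nth 1) (.pair (nth 0) (drop 3))))
        (.letIn (.call (b + 11) (.pair (.snd (nth 0)) (.pair (nth 1) (drop 4))))
          (.pair
            (.pair
              (.pair
                (callMulComplex b (.fst (.fst (.fst (nth 1)))) (.fst (.fst (.fst (nth 0))))
                  (drop 5))
                (.pair (.fst (.fst (nth 1))) (.fst (.fst (nth 0)))))
              (.pair
                (callMulComplex b (.fst (.snd (.fst (nth 1)))) (.fst (.snd (.fst (nth 0))))
                  (drop 5))
                (callAddComplex b
                  (callMulComplex b (.snd (.snd (.fst (nth 1)))) (.fst (.snd (.fst (nth 0))))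
                    (drop 5))
                  (callMulComplex b (.snd (.snd (.fst (nth 0)))) (.fst (.snd (.fst (nth 1))))
                    (drop 5))
                  (drop 5))))
            (.snd (nth 0))))))

/-- Mirror image of a tree. -/
def mirror (b : ℕ) : Code :=
  .ifLeaf .arg .arg (.pair (.call (b + 12) (.snd .arg)) (.call (b + 12) (.fst .arg)))

/-- Reciprocal of an integer `a` of `k + 5` bits, `k` a power of two; argument `(k, a)`. -/
def recip (b : ℕ) : Code :=
  .ifNeg (.sub (nth 0) (.const 2))
    (.sub (.const 192) (.shl (drop 1) (.const 1)))
    (.letIn (.shr (nth 0) (.const 1))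
      (.letIn (.call (b + 13) (.pair (nth 0) (.shr (drop 2) (nth 0))))
        (.letIn (.ifNeg (.sub (nth 2) (.const 32)) (.const 1) (.shr (nth 2) (.const 5)))
          (.sub (.shl (nth 1) (.add (nth 2) (.const 1)))
            (.shr (.call (b + 1) (.pair (nth 0) (.pair (drop 4)
                (.call (b + 1) (.pair (nth 0) (.pair (nth 1) (nth 1)))))))
              (.add (.add (nth 2) (nth 2)) (.const 10)))))))

/-- A call of `mulBoth`. -/
def callMul (b : ℕ) (x y p : Code) : Code := .call (b + 1) (.pair p (.pair x y))

/-- Complex division; argument `(y, m, N, p)`. -/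
def divComplex (b : ℕ) : Code :=
  .letIn (.add (callMul b (.fst (nth 1)) (.fst (nth 1)) (drop 3))
      (callMul b (.snd (nth 1)) (.snd (nth 1)) (drop 3)))
    (.letIn (.size (nth 0))
      (.letIn (.call (b + 13) (.pair (nth 4)
          (.shl (nth 1) (.sub (.add (nth 4) (.const 5)) (nth 0)))))
        (.letIn (.sub (.add (.add (nth 5) (.const 5)) (nth 1)) (drop 6))
          (.pair
            (.shr (callMul b (.add (callMul b (.fst (nth 4)) (.fst (nth 5)) (drop 7))
              (callMul b (.snd (nth 4)) (.snd (nth 5)) (drop 7))) (nth 1) (drop 7)) (nth 0))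
            (.shr (callMul b (.sub (callMul b (.snd (nth 4)) (.fst (nth 5)) (drop 7))
              (callMul b (.fst (nth 4)) (.snd (nth 5)) (drop 7))) (nth 1) (drop 7)) (nth 0))))))

/-- The interpolating polynomial of a subtree from the reversed transformed power sums;
argument `(tree, Z, N, p)`. -/
def solve (b : ℕ) : Code :=
  .ifLeaf (.fst (nth 1))
    (.ifLeaf (.snd (nth 0))
      (.pair (.pair (.const 0) (.const 0)) (.pair (.const 0) (.const 0)))
      (.letIn (.call (b + 14) (.pair (.snd (nth 0)) (.pair (nth 1) (drop 2))))
        (.pair (.pair (.fst (nth 0)) (.const 0)) (.pair (.snd (nth 0)) (.const 0)))))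
    (.letIn (callMulComplex b (.fst (.snd (.snd (nth 0)))) (nth 1) (drop 2))
      (.letIn (.call (b + 15) (.pair (.fst (.snd (nth 1)))
          (.pair (.pair (.snd (.fst (.fst (nth 0)))) (.snd (.fst (.snd (nth 0))))) (drop 3))))
        (.letIn (callMulComplex b (.fst (.fst (.snd (nth 2)))) (nth 3) (drop 4))
          (.letIn (.call (b + 15) (.pair (.snd (.snd (nth 3)))
              (.pair (.pair (.snd (.fst (.fst (nth 0)))) (.snd (.fst (.snd (nth 0)))))
                (drop 5))))
            (callAddComplex b
              (callMulComplex b (nth 2) (.fst (.snd (.snd (nth 4)))) (drop 6))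
              (callMulComplex b (nth 0) (.fst (.fst (.snd (nth 4)))) (drop 6))
              (drop 6))))))

/-- The list of the coefficients of a complex polynomial, followed by `acc`; argument
`(re, im, acc)`. -/
def flatten (b : ℕ) : Code :=
  .ifLeaf (nth 0)
    (.pair (.pair (nth 0) (nth 1)) (drop 2))
    (.call (b + 16) (.pair (.fst (nth 0)) (.pair (.fst (nth 1))
      (.call (b + 16) (.pair (.snd (nth 0)) (.pair (.snd (nth 1)) (drop 2)))))))

/-- As many entries of the second list as the first one has; argument `(list, list)`. -/
def takeLike (b : ℕ) : Code :=
  .ifLeaf (nth 0) (.const 0)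
    (.pair (.fst (drop 1)) (.call (b + 17) (.pair (.snd (nth 0)) (.snd (drop 1)))))

/-- The length of a list. -/
def length (b : ℕ) : Code :=
  .ifLeaf .arg (.const 0) (.add (.const 1) (.call (b + 18) (.snd .arg)))

/-- Interpolation; argument `(ℓ, p, list)`. -/
def interpolation (b : ℕ) : Code :=
  .letIn (.shl (.const 1) (.add (.size (nth 1)) (.const 3)))
    (.letIn (.pair (nth 0) (nth 2))
      (.letIn (.size (.call (b + 18) (drop 4)))
        (.letIn (.call (b + 11) (.pair (drop 5) (.pair (nth 0) (nth 1))))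
          (.letIn (.call (b + 9) (.pair
              (.pair (.fst (.fst (.fst (.snd (.fst (nth 0))))))
                (.fst (.snd (.fst (.snd (.fst (nth 0)))))))
              (nth 2)))
            (.letIn (callMulComplex b
                (.pair (.fst (.fst (.snd (.snd (.fst (nth 1))))))
                  (.fst (.snd (.snd (.snd (.fst (nth 1)))))))
                (nth 0) (nth 3))
              (.letIn (.call (b + 15) (.pair (.fst (.fst (nth 2)))
                  (.pair
                    (.pair (.call (b + 12) (.fst (.fst (nth 0))))
                      (.call (b + 12) (.fst (.snd (nth 0)))))
                    (nth 4))))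
                (.call (b + 17) (.pair (drop 9)
                  (.call (b + 16) (.pair (.fst (nth 0))
                    (.pair (.snd (nth 0)) (.const 0))))))))))))

/-- All functions. -/
def functions (b f : ℕ) : List Code :=
  [mulPieces b f, mulBoth b, reduceOnce, reduce b, linear b, mulMod b, mulPoly b, depth b,
    mulComplex b, negInv b, addComplex b, products b, mirror b, recip b, divComplex b, solve b,
    flatten b, takeLike b, length b, interpolation b]

/-- `P` holds the functions of the interpolation program from number `b` on. -/
def Loaded (P : Program) (b f : ℕ) : Prop :=
  ∀ i, i < 20 → P[b + i]? = (functions b f)[i]?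

end Interp

/-! ### Multiplication of long integers in pieces -/

namespace Interp
open Code

/-- Multiplication of integers of at most `s` bits takes at most `B` operations. -/
def MulCost (P : Program) (f s B : ℕ) : Prop :=
  ∀ a b : ℤ, bitLen a ≤ s → bitLen b ≤ s → Within P f (.pair (.int a) (.int b)) (.int (a * b)) B

section
variable {P : Program} {b f : ℕ}

/-- The bounds are not strict on purpose: floor division of a negative number never rises above -1,
so a strict bound would fail for k = 0. -/
theorem abs_ediv_two_pow_le {a : ℤ} {s k : ℕ} (h : |a| ≤ 2 ^ (s + k)) : |a / 2 ^ s| ≤ 2 ^ k := by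
  have hs : (0 : ℤ) < 2 ^ s := by positivity
  rw [pow_add, abs_le] at h
  rw [abs_le]
  constructor
  · rw [Int.le_ediv_iff_mul_le hs]; linarith [h.1]
  · refine Int.ediv_le_of_le_mul hs ?_; linarith [h.2]

/-- Induction on the number k of pieces: x = 2^s ⌊x / 2^s⌋ + (x mod 2^s), where the remainder is a
nonnegative piece of s bits for either sign of x. The induction ends with x in {-1, 0, 1}, which is
a last piece; hence k + 1 calls of the given multiplication. -/
theorem mulPieces_spec (hP : Loaded P b f) {s B : ℕ} (hs : 1 ≤ s) (hf : MulCost P f s B)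
    (k : ℕ) (x y : ℤ) (hx : |x| ≤ 2 ^ (k * s)) (hy : bitLen y ≤ s) :
    Within P b (.pair (.int s) (.pair (.int x) (.int y))) (.int (x * y))
      ((k + 1) * (B + 100 * (k + 2) * s)) := by
  induction k generalizing x with
  | zero =>
    refine within_of_wp (hP 0 (by norm_num)) ?_
    have hx1 : bitLen x ≤ 1 := bitLen_le_of_abs_le (s := 0) (by simpa using hx)
    have h1 := bitLen_natCast_le s
    have h2 := bitLen_natCast_le (bitLen x)
    simp only [mulPieces, ↓wp_rules, ↓shape_rules]
    rw [if_neg (by omega)]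
    refine ⟨_, _, hf x y (by omega) hy, fun t ht => ⟨rfl, ?_⟩⟩
    nlinarith
  | succ k ih =>
    refine within_of_wp (hP 0 (by norm_num)) ?_
    have hx1 : bitLen x ≤ (k + 1) * s + 1 := bitLen_le_of_abs_le hx
    have h1 := bitLen_natCast_le s
    have h2 := bitLen_natCast_le (bitLen x)
    simp only [mulPieces, ↓wp_rules, ↓shape_rules]
    by_cases hc : bitLen x ≤ s
    · rw [if_neg (by omega)]
      refine ⟨_, _, hf x y hc hy, fun t ht => ⟨rfl, ?_⟩⟩
      nlinarith
    · rw [if_pos (by omega)]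
      have hq : |x / 2 ^ s| ≤ 2 ^ (k * s) :=
        abs_ediv_two_pow_le (by rwa [show s + k * s = (k + 1) * s by ring])
      have hr : x - x / 2 ^ s * 2 ^ s = x % 2 ^ s := by
        rw [Int.emod_def]; ring
      have hr0 : 0 ≤ x % 2 ^ s := Int.emod_nonneg _ (by positivity)
      have hr1 : x % 2 ^ s < 2 ^ s := Int.emod_lt_of_pos _ (by positivity)
      have hr2 : bitLen (x % 2 ^ s) ≤ s := by
        rw [bitLen_le_iff, abs_of_nonneg hr0]; exact hr1
      have hq1 := bitLen_le_of_abs_le hq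
      have hq2 : bitLen (x / 2 ^ s * 2 ^ s) ≤ (k + 1) * s + 1 := by
        refine bitLen_le_of_abs_le ?_
        rw [abs_mul, abs_pow, abs_two, add_mul, one_mul, pow_add]
        gcongr
      have hy1 := abs_le_of_bitLen_le hy
      have hm : bitLen (x / 2 ^ s * y) ≤ (k + 1) * s + 1 := by
        refine bitLen_le_of_abs_le ?_
        rw [abs_mul, add_mul, one_mul, pow_add]
        gcongr
      have hm1 : bitLen (x / 2 ^ s * y * 2 ^ s) ≤ (k + 2) * s + 1 := by
        refine bitLen_le_of_abs_le ?_
        rw [abs_mul, abs_mul, abs_pow, abs_two, show (k + 2) * s = k * s + s + s by ring,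
          pow_add, pow_add]
        gcongr
      have hm2 : bitLen (x % 2 ^ s * y) ≤ 2 * s + 1 := by
        refine bitLen_le_of_abs_le ?_
        rw [abs_mul, two_mul, pow_add, abs_of_nonneg hr0]
        gcongr
      refine ⟨_, _, ih _ hq, fun t ht => ?_⟩
      simp only [↓shape_rules]
      refine ⟨_, _, hr ▸ hf _ y hr2 hy, fun t' ht' => ?_⟩
      simp only [↓shape_rules]
      refine ⟨?_, ?_⟩
      · congr 1
        ring
      · rw [hr]
        linarith

/-- The same decomposition for the second factor. For bounded k and l this is a bounded number of
products of s bits, plus linear work; a direct call at length ks would cost μ(ks), which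
superadditivity does not bound by a multiple of μ(s). -/
theorem mulBoth_spec (hP : Loaded P b f) {s B : ℕ} (hs : 1 ≤ s) (hf : MulCost P f s B)
    (k l : ℕ) (x y : ℤ) (hx : |x| ≤ 2 ^ (k * s)) (hy : |y| ≤ 2 ^ (l * s)) :
    Within P (b + 1) (.pair (.int s) (.pair (.int x) (.int y))) (.int (x * y))
      ((l + 1) * ((k + 1) * (B + 100 * (k + 2) * s) + 100 * (k + l + 2) * s)) := by
  induction l generalizing y with
  | zero =>
    refine within_of_wp (hP 1 (by norm_num)) ?_
    have hx1 : bitLen y ≤ 1 := bitLen_le_of_abs_le (s := 0) (by simpa using hy)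
    have h1 := bitLen_natCast_le s
    have h2 := bitLen_natCast_le (bitLen y)
    simp only [mulBoth, ↓wp_rules, ↓shape_rules]
    rw [if_neg (by omega)]
    refine ⟨_, _, mulPieces_spec hP hs hf k x y hx (by omega), fun t ht => ⟨rfl, ?_⟩⟩
    nlinarith
  | succ l ih =>
    refine within_of_wp (hP 1 (by norm_num)) ?_
    have hx1 : bitLen y ≤ (l + 1) * s + 1 := bitLen_le_of_abs_le hy
    have h1 := bitLen_natCast_le s
    have h2 := bitLen_natCast_le (bitLen y)
    simp only [mulBoth, ↓wp_rules, ↓shape_rules]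
    by_cases hc : bitLen y ≤ s
    · rw [if_neg (by omega)]
      refine ⟨_, _, mulPieces_spec hP hs hf k x y hx hc, fun t ht => ⟨rfl, ?_⟩⟩
      have : 0 ≤ (k + 1) * (B + 100 * (k + 2) * s) := Nat.zero_le _
      nlinarith
    · rw [if_pos (by omega)]
      have hq : |y / 2 ^ s| ≤ 2 ^ (l * s) :=
        abs_ediv_two_pow_le (by rwa [show s + l * s = (l + 1) * s by ring])
      have hr : y - y / 2 ^ s * 2 ^ s = y % 2 ^ s := by
        rw [Int.emod_def]; ring
      have hr0 : 0 ≤ y % 2 ^ s := Int.emod_nonneg _ (by positivity)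
      have hr1 : y % 2 ^ s < 2 ^ s := Int.emod_lt_of_pos _ (by positivity)
      have hr2 : bitLen (y % 2 ^ s) ≤ s := by
        rw [bitLen_le_iff, abs_of_nonneg hr0]; exact hr1
      have hq1 := bitLen_le_of_abs_le hq
      have hq2 : bitLen (y / 2 ^ s * 2 ^ s) ≤ (l + 1) * s + 1 := by
        refine bitLen_le_of_abs_le ?_
        rw [abs_mul, abs_pow, abs_two, add_mul, one_mul, pow_add]
        gcongr
      have hm : bitLen (x * (y / 2 ^ s)) ≤ (k + l) * s + 1 := by
        refine bitLen_le_of_abs_le ?_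
        rw [abs_mul, add_mul, pow_add]
        gcongr
      have hm1 : bitLen (x * (y / 2 ^ s) * 2 ^ s) ≤ (k + l + 1) * s + 1 := by
        refine bitLen_le_of_abs_le ?_
        rw [abs_mul, abs_mul, abs_pow, abs_two, show (k + l + 1) * s = k * s + l * s + s by ring,
          pow_add, pow_add]
        gcongr
      have hm2 : bitLen (x * (y % 2 ^ s)) ≤ (k + 1) * s + 1 := by
        refine bitLen_le_of_abs_le ?_
        rw [abs_mul, add_mul, one_mul, pow_add, abs_of_nonneg hr0]
        gcongr
      refine ⟨_, _, ih _ hq, fun t ht => ?_⟩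
      simp only [↓shape_rules]
      refine ⟨_, _, hr ▸ mulPieces_spec hP hs hf k x _ hx hr2, fun t' ht' => ?_⟩
      simp only [↓shape_rules]
      refine ⟨?_, ?_⟩
      · congr 1
        ring
      · rw [hr]
        linarith
end
end Interp

namespace Interp
open Code

/-! ### Reduction modulo `2 ^ N + 1` -/

/-- One reduction step modulo `2 ^ N + 1`. -/
def red₁ (N : ℕ) (x : ℤ) : ℤ :=
  x - (x + 2 ^ (N - 1)) / 2 ^ N * 2 ^ N - (x + 2 ^ (N - 1)) / 2 ^ N

/-- Reduction modulo `2 ^ N + 1`. -/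
def red (N : ℕ) (x : ℤ) : ℤ := red₁ N (red₁ N x)

theorem red₁_emod (N : ℕ) (x : ℤ) : (2 ^ N + 1 : ℤ) ∣ red₁ N x - x :=
  ⟨-((x + 2 ^ (N - 1)) / 2 ^ N), by rw [red₁]; ring⟩

theorem red_emod (N : ℕ) (x : ℤ) : (2 ^ N + 1 : ℤ) ∣ red N x - x := by
  have := dvd_add (red₁_emod N (red₁ N x)) (red₁_emod N x)
  rwa [sub_add_sub_cancel] at this

theorem two_pow_pred {N : ℕ} (hN : 8 ≤ N) : (2 : ℤ) ^ N = 2 * 2 ^ (N - 1) := by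
  rw [← pow_succ', Nat.sub_add_cancel (by omega)]

/-- With q the rounded quotient of x by 2^N, the step subtracts q(2^N + 1): the difference x - q 2^N
is a centred residue, and a further |q| ≤ H + 1 is lost. -/
theorem red₁_le {N : ℕ} (hN : 8 ≤ N) {x H : ℤ} (h : |x| ≤ 2 ^ N * H) :
    |red₁ N x| ≤ 2 ^ (N - 1) + (H + 1) := by
  have hpos : (0 : ℤ) < 2 ^ N := by positivity
  have h2 := two_pow_pred hN
  have e1 : (x + 2 ^ (N - 1)) % 2 ^ N = x + 2 ^ (N - 1) - 2 ^ N * ((x + 2 ^ (N - 1)) / 2 ^ N) :=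
    Int.emod_def _ _
  have e2 : 0 ≤ (x + 2 ^ (N - 1)) % 2 ^ N := Int.emod_nonneg _ hpos.ne'
  have e3 : (x + 2 ^ (N - 1)) % 2 ^ N < 2 ^ N := Int.emod_lt_of_pos _ hpos
  have hq1 : (x + 2 ^ (N - 1)) / 2 ^ N ≤ H + 1 := by
    refine Int.ediv_le_of_le_mul hpos ?_
    nlinarith [le_abs_self x]
  have hq2 : -(H + 1) ≤ (x + 2 ^ (N - 1)) / 2 ^ N := by
    rw [Int.le_ediv_iff_mul_le hpos]
    nlinarith [neg_abs_le x]
  rw [red₁, abs_le]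
  constructor <;> linarith

/-- One step is not enough, since its quotient may be as large as 8 · 2^N; after it the number is at
most 9 · 2^N, and the second quotient is at most 10. -/
theorem red_le {N : ℕ} (hN : 8 ≤ N) {x : ℤ} (h : |x| ≤ 2 ^ (2 * N + 3)) :
    |red N x| ≤ 2 ^ (N - 1) + 32 := by
  have h2 := two_pow_pred hN
  have h3 : (256 : ℤ) ≤ 2 ^ N := by
    calc (256 : ℤ) = 2 ^ 8 := by norm_num
      _ ≤ _ := pow_le_pow_right₀ (by norm_num) hN
  have h4 : |red₁ N x| ≤ 2 ^ (N - 1) + (2 ^ N * 8 + 1) :=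
    red₁_le hN (h.trans (le_of_eq (by rw [two_mul, pow_add, pow_add]; ring)))
  have h5 : |red₁ N (red₁ N x)| ≤ 2 ^ (N - 1) + (9 + 1) := red₁_le hN (by linarith)
  rw [red]; linarith

theorem red₁_eq_self {N : ℕ} (hN : 8 ≤ N) {x : ℤ} (h : |x| < 2 ^ (N - 1)) : red₁ N x = x := by
  have h2 := two_pow_pred hN
  rw [abs_lt] at h
  have : (x + 2 ^ (N - 1)) / 2 ^ N = 0 := Int.ediv_eq_zero_of_lt (by linarith) (by linarith)
  rw [red₁, this]; ring

theorem red_eq_self {N : ℕ} (hN : 8 ≤ N) {x : ℤ} (h : |x| < 2 ^ (N - 1)) : red N x = x := by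
  rw [red, red₁_eq_self hN h, red₁_eq_self hN h]

section
variable {P : Program} {b f : ℕ}

theorem reduceOnce_spec (hP : Loaded P b f) {N : ℕ} (hN : 8 ≤ N) {x : ℤ}
    (h : |x| ≤ 2 ^ (2 * N + 3)) :
    Within P (b + 2) (.pair (.int N) (.int x)) (.int (red₁ N x)) (60 * N) := by
  refine within_of_wp (hP 2 (by norm_num)) ?_
  simp only [reduceOnce, ↓wp_rules, ↓shape_rules]
  have hN1 : ((N - 1 : ℕ) : ℤ) = N - 1 := by omega
  refine ⟨N - 1, hN1, ?_⟩
  simp only [one_mul]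
  have h1 := bitLen_natCast_le N
  have h2 := bitLen_le_of_abs_le h
  have h3 : bitLen ((2 : ℤ) ^ (N - 1)) ≤ N - 1 + 1 :=
    bitLen_le_of_abs_le (by rw [abs_of_nonneg (by positivity)])
  have hb : (2 : ℤ) ^ (N - 1) ≤ 2 ^ (2 * N + 3) := pow_le_pow_right₀ (by norm_num) (by omega)
  have hs : |x + 2 ^ (N - 1)| ≤ 2 ^ (2 * N + 4) := by
    refine (abs_add_le _ _).trans ?_
    rw [abs_of_nonneg (by positivity : (0 : ℤ) ≤ 2 ^ (N - 1)), pow_succ _ (2 * N + 3)]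
    linarith
  have h4 := bitLen_le_of_abs_le hs
  have hq : |(x + 2 ^ (N - 1)) / 2 ^ N| ≤ 2 ^ (N + 4) :=
    abs_ediv_two_pow_le (by rwa [show N + (N + 4) = 2 * N + 4 by ring])
  have h5 := bitLen_le_of_abs_le hq
  have hm : |(x + 2 ^ (N - 1)) / 2 ^ N * 2 ^ N| ≤ 2 ^ (2 * N + 4) := by
    rw [abs_mul, abs_pow, abs_two, show 2 * N + 4 = N + 4 + N by ring, pow_add _ (N + 4)]
    gcongr
  have h6 := bitLen_le_of_abs_le hm
  have hm' : |x - (x + 2 ^ (N - 1)) / 2 ^ N * 2 ^ N| ≤ 2 ^ (2 * N + 5) := by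
    refine (abs_sub _ _).trans ?_
    have : (2 : ℤ) ^ (2 * N + 3) ≤ 2 ^ (2 * N + 4) := pow_le_pow_right₀ (by norm_num) (by omega)
    rw [pow_succ _ (2 * N + 4)]
    linarith
  have h7 := bitLen_le_of_abs_le hm'
  have h8 : bitLen ((N : ℤ) - 1) ≤ N := by
    rw [← hN1]; exact (bitLen_natCast_le _).trans (by omega)
  refine ⟨rfl, ?_⟩
  rw [bitLen_one]
  omega

theorem reduce_spec (hP : Loaded P b f) {N : ℕ} (hN : 8 ≤ N) {x : ℤ}
    (h : |x| ≤ 2 ^ (2 * N + 3)) :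
    Within P (b + 3) (.pair (.int N) (.int x)) (.int (red N x)) (130 * N) := by
  refine within_of_wp (hP 3 (by norm_num)) ?_
  simp only [reduce, ↓wp_rules, ↓shape_rules]
  refine ⟨_, _, reduceOnce_spec hP hN h, fun t ht => ⟨_, _, reduceOnce_spec hP hN ?_,
    fun t' ht' => ⟨rfl, ?_⟩⟩⟩
  · have h2 := two_pow_pred hN
    have h3 : (1 : ℤ) ≤ 2 ^ (N - 1) := one_le_pow₀ (by norm_num)
    have h4 : |red₁ N x| ≤ 2 ^ (N - 1) + (2 ^ N * 8 + 1) :=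
      red₁_le hN (h.trans (le_of_eq (by rw [two_mul, pow_add, pow_add]; ring)))
    have h5 : (2 : ℤ) ^ (2 * N + 3) = 2 ^ N * (2 ^ N * 8) := by
      rw [two_mul, pow_add, pow_add]; ring
    nlinarith
  · omega
end

/-! ### Perfect trees -/

/-- Perfect binary trees of depth `d` with integer leaves. -/
inductive Tr : ℕ → Type
  | leaf (z : ℤ) : Tr 0
  | node {d : ℕ} (x y : Tr d) : Tr (d + 1)

namespace Tr

/-- The value that represents a tree. -/
def toVal : {d : ℕ} → Tr d → Val
  | _, leaf z => .int z
  | _, node x y => .pair x.toVal y.toVal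

/-- Leafwise combination. -/
def map₂ (g : ℤ → ℤ → ℤ) : {d : ℕ} → Tr d → Tr d → Tr d
  | _, leaf z, leaf w => leaf (g z w)
  | _, node x y, node x' y' => node (map₂ g x x') (map₂ g y y')

/-- All leaves satisfy `p`. -/
def All (p : ℤ → Prop) : {d : ℕ} → Tr d → Prop
  | _, leaf z => p z
  | _, node x y => All p x ∧ All p y

theorem All.mono {p q : ℤ → Prop} (h : ∀ z, p z → q z) {d : ℕ} {x : Tr d} (hx : x.All p) :
    x.All q := by
  induction x with
  | leaf z => exact h z hx
  | node x y ihx ihy => exact ⟨ihx hx.1, ihy hx.2⟩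

theorem All.map₂ {p q r : ℤ → Prop} {g : ℤ → ℤ → ℤ} (h : ∀ z w, p z → q w → r (g z w)) {d : ℕ}
    {x y : Tr d} (hx : x.All p) (hy : y.All q) : (x.map₂ g y).All r := by
  induction x with
  | leaf z => cases y; exact h _ _ hx hy
  | node x x' ihx ihy =>
    cases y
    exact ⟨ihx hx.1 hy.1, ihy hx.2 hy.2⟩

end Tr

/-- The leafwise operation of `linear`. -/
def lin (N e e₂ e₃ : ℕ) (σ x y : ℤ) : ℤ :=
  red N ((if σ < 0 then x - y * 2 ^ e else x + y * 2 ^ e) * 2 ^ e₂) / 2 ^ e₃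

theorem lin_arg_le {N e e₂ : ℕ} (he : e + e₂ ≤ N) {σ x y : ℤ} (hx : |x| ≤ 2 ^ N)
    (hy : |y| ≤ 2 ^ N) :
    |(if σ < 0 then x - y * 2 ^ e else x + y * 2 ^ e)| ≤ 2 ^ (N + e + 1) ∧
    |(if σ < 0 then x - y * 2 ^ e else x + y * 2 ^ e) * 2 ^ e₂| ≤ 2 ^ (2 * N + 3) := by
  have h1 : |y * 2 ^ e| ≤ 2 ^ (N + e) := by
    rw [abs_mul, abs_pow, abs_two, pow_add]; gcongr
  have h2 : (2 : ℤ) ^ N ≤ 2 ^ (N + e) := pow_le_pow_right₀ (by norm_num) (by omega)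
  have h3 : |(if σ < 0 then x - y * 2 ^ e else x + y * 2 ^ e)| ≤ 2 ^ (N + e + 1) := by
    rw [pow_succ]
    split_ifs
    · exact (abs_sub _ _).trans (by linarith)
    · exact (abs_add_le _ _).trans (by linarith)
  refine ⟨h3, ?_⟩
  rw [abs_mul, abs_pow, abs_two]
  calc _ ≤ (2 : ℤ) ^ (N + e + 1) * 2 ^ e₂ := by gcongr
    _ = 2 ^ (N + e + 1 + e₂) := by rw [pow_add _ (N + e + 1)]
    _ ≤ _ := pow_le_pow_right₀ (by norm_num) (by omega)

/-- The argument of `linear`. -/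
def linArg (v w : Val) (N e e₂ e₃ : ℕ) (σ : ℤ) : Val :=
  .pair v (.pair w (.pair (.int N) (.pair (.int e) (.pair (.int e₂) (.pair (.int e₃) (.int σ))))))

section
variable {P : Program} {b f : ℕ}

/-- The factor 2 · 2^d - 1 is the number of all nodes of a perfect tree, each charged with 300 N
operations; counting inner nodes as well lets the bound pass through the induction. -/
theorem linear_spec (hP : Loaded P b f) {N e e₂ e₃ : ℕ} (σ : ℤ) (hN : 8 ≤ N) (he : e + e₂ ≤ N)
    (he₃ : e₃ ≤ N) {d : ℕ} {x y : Tr d} (hx : x.All fun z => |z| ≤ 2 ^ N)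
    (hy : y.All fun z => |z| ≤ 2 ^ N) :
    Within P (b + 4) (linArg x.toVal y.toVal N e e₂ e₃ σ) (x.map₂ (lin N e e₂ e₃ σ) y).toVal
      ((2 * 2 ^ d - 1) * (300 * N)) := by
  induction x with
  | leaf z =>
    cases y with | leaf w =>
    refine within_of_wp (hP 4 (by norm_num)) ?_
    simp only [linear, linArg, Tr.toVal, Tr.map₂, ↓wp_rules, ↓shape_rules]
    obtain ⟨h1, h2⟩ := lin_arg_le he (σ := σ) hx hy
    have h3 := bitLen_le_of_abs_le h1
    have h4 := bitLen_le_of_abs_le hx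
    have h5 := bitLen_le_of_abs_le hy
    have h6 : bitLen (w * 2 ^ e) ≤ N + e + 1 := bitLen_le_of_abs_le (by
      rw [abs_mul, abs_pow, abs_two, pow_add]; gcongr; exact hy)
    have h7 : |red N ((if σ < 0 then z - w * 2 ^ e else z + w * 2 ^ e) * 2 ^ e₂)| ≤ 2 ^ N := by
      refine (red_le hN h2).trans ?_
      have : (2 : ℤ) ^ 5 ≤ 2 ^ (N - 1) := pow_le_pow_right₀ (by norm_num) (by omega)
      have := two_pow_pred hN
      linarith
    have h8 := bitLen_le_of_abs_le h7
    have h9 := bitLen_natCast_le e₃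
    split_ifs at h2 h3 h7 h8 ⊢ with hσ
    all_goals
      refine ⟨_, _, reduce_spec hP hN h2, fun t ht => ?_⟩
      simp only [↓shape_rules]
      refine ⟨?_, ?_⟩
      · simp only [lin, hσ, if_true, if_false]
      · norm_num
        omega
  | @node d x x' ihx ihy =>
    cases y with | node y y' =>
    refine within_of_wp (hP 4 (by norm_num)) ?_
    simp only [linear, linArg, Tr.toVal, Tr.map₂, ↓wp_rules, ↓shape_rules]
    refine ⟨_, _, ihx hx.1 hy.1, fun t ht => ⟨_, _, ihy hx.2 hy.2, fun t' ht' => ⟨rfl, ?_⟩⟩⟩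
    -- Substituting 2^d = q + 1 removes the truncated subtractions.
    obtain ⟨q, hq⟩ : ∃ q, 2 ^ d = q + 1 := ⟨2 ^ d - 1, (Nat.sub_add_cancel Nat.one_le_two_pow).symm⟩
    rw [hq] at ht ht'
    rw [pow_succ, hq]
    rw [show 2 * (q + 1) - 1 = 2 * q + 1 by omega] at ht ht'
    rw [show 2 * ((q + 1) * 2) - 1 = 4 * q + 3 by omega]
    linarith
end
end Interp

/-! ### The Fourier transform modulo `2 ^ N + 1` -/

namespace Interp
open Code Polynomial

namespace Tr

/-- Coefficient number `k`. -/
def coeff : {d : ℕ} → Tr d → ℕ → ℤ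
  | _, leaf z, k => if k = 0 then z else 0
  | _, @node d x y, k => if k < 2 ^ d then x.coeff k else y.coeff (k - 2 ^ d)

theorem coeff_eq_zero {d : ℕ} (x : Tr d) {k : ℕ} (h : 2 ^ d ≤ k) : x.coeff k = 0 := by
  induction x generalizing k with
  | leaf z => rw [coeff, if_neg]; simp at h; omega
  | @node d x y ihx ihy =>
    rw [pow_succ] at h
    rw [coeff, if_neg (by omega), ihy (by omega)]

theorem coeff_node_add {d : ℕ} (x y : Tr d) (k : ℕ) : (node x y).coeff (k + 2 ^ d) = y.coeff k := by
  rw [coeff, if_neg (by omega), Nat.add_sub_cancel]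

theorem coeff_node_lt {d : ℕ} (x y : Tr d) {k : ℕ} (h : k < 2 ^ d) :
    (node x y).coeff k = x.coeff k := by
  rw [coeff, if_pos h]

theorem coeff_map₂ {g : ℤ → ℤ → ℤ} {d : ℕ} (x y : Tr d) {k : ℕ} (h : k < 2 ^ d) :
    (x.map₂ g y).coeff k = g (x.coeff k) (y.coeff k) := by
  induction x generalizing k with
  | leaf z =>
    cases y
    have : k = 0 := by simpa using h
    simp [coeff, map₂, this]
  | @node d x x' ihx ihy =>
    cases y
    rw [map₂, coeff, coeff, coeff]
    rw [pow_succ] at h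
    split_ifs with hk
    · exact ihx _ hk
    · exact ihy _ (by omega)

theorem All.coeff {p : ℤ → Prop} {d : ℕ} {x : Tr d} (h : x.All p) (h0 : p 0) (k : ℕ) :
    p (x.coeff k) := by
  induction x generalizing k with
  | leaf z => rw [Tr.coeff]; split_ifs; exacts [h, h0]
  | node x y ihx ihy => rw [Tr.coeff]; split_ifs; exacts [ihx h.1 _, ihy h.2 _]

theorem all_of_coeff {p : ℤ → Prop} {d : ℕ} {x : Tr d} (h : ∀ k < 2 ^ d, p (x.coeff k)) :
    x.All p := by
  induction x with
  | leaf z =>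
    change p z
    simpa [Tr.coeff] using h 0 (by norm_num)
  | @node d x y ihx ihy =>
    have h2 : 2 ^ (d + 1) = 2 ^ d + 2 ^ d := by ring
    refine ⟨ihx fun k hk => ?_, ihy fun k hk => ?_⟩
    · simpa [coeff_node_lt x y hk] using h k (by omega)
    · simpa [coeff_node_add x y k] using h (k + 2 ^ d) (by omega)

/-- The polynomial with the leaves as coefficients. -/
noncomputable def poly (R : Type*) [CommRing R] : {d : ℕ} → Tr d → R[X]
  | _, leaf z => C (z : R)
  | _, @node d x y => x.poly R + X ^ 2 ^ d * y.poly R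

variable {R : Type*} [CommRing R]

theorem coeff_poly {d : ℕ} (x : Tr d) (k : ℕ) : (x.poly R).coeff k = (x.coeff k : R) := by
  induction x generalizing k with
  | leaf z => rw [poly, coeff_C, Tr.coeff]; split_ifs <;> simp
  | @node d x y ihx ihy =>
    rw [poly, coeff_add, coeff_X_pow_mul', ihx, ihy, Tr.coeff]
    split_ifs with h h'
    · omega
    · simp [x.coeff_eq_zero h]
    · simp
    · omega

theorem poly_map₂ {g : ℤ → ℤ → ℤ} {α β : R} (h : ∀ z w, (g z w : R) = α * z + β * w) {d : ℕ}
    (x y : Tr d) : (x.map₂ g y).poly R = C α * x.poly R + C β * y.poly R := by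
  induction x with
  | leaf z => cases y; simp [map₂, poly, h]
  | node x x' ihx ihy => cases y; rw [map₂, poly, poly, poly, ihx, ihy]; ring

theorem degree_poly_lt {d : ℕ} (x : Tr d) : (x.poly R).degree < (2 ^ d : ℕ) := by
  rw [degree_lt_iff_coeff_zero]
  intro k hk
  rw [coeff_poly, x.coeff_eq_zero hk, Int.cast_zero]

end Tr

theorem red_cast (N : ℕ) (x : ℤ) : ((red N x : ℤ) : ZMod (2 ^ N + 1)) = x := by
  have h := (ZMod.intCast_zmod_eq_zero_iff_dvd (red N x - x) (2 ^ N + 1)).2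
    (by exact_mod_cast red_emod N x)
  rwa [Int.cast_sub, sub_eq_zero] at h

theorem lin_cast (N e e₂ : ℕ) (σ x y : ℤ) : ((lin N e e₂ 0 σ x y : ℤ) : ZMod (2 ^ N + 1)) =
    2 ^ e₂ * x + ((if σ < 0 then -1 else 1) * 2 ^ e * 2 ^ e₂) * y := by
  rw [lin, pow_zero, Int.ediv_one, red_cast]
  split_ifs <;> push_cast <;> ring

theorem poly_map₂_lin {N e e₂ : ℕ} (σ : ℤ) {d : ℕ} (x y : Tr d) :
    (x.map₂ (lin N e e₂ 0 σ) y).poly (ZMod (2 ^ N + 1)) =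
      C (2 ^ e₂) * x.poly _ + C ((if σ < 0 then -1 else 1) * 2 ^ e * 2 ^ e₂) * y.poly _ :=
  Tr.poly_map₂ (fun z w => lin_cast N e e₂ σ z w) x y

theorem lin_le {N e e₂ : ℕ} (hN : 8 ≤ N) (he : e + e₂ ≤ N) {σ x y : ℤ} (hx : |x| ≤ 2 ^ N)
    (hy : |y| ≤ 2 ^ N) : |lin N e e₂ 0 σ x y| ≤ 2 ^ (N - 1) + 32 := by
  rw [lin, pow_zero, Int.ediv_one]
  exact red_le hN (lin_arg_le he hx hy).2

theorem le_two_pow {N : ℕ} (hN : 8 ≤ N) {z : ℤ} (h : |z| ≤ 2 ^ (N - 1) + 32) : |z| ≤ 2 ^ N := by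
  have h1 : (2 : ℤ) ^ 7 ≤ 2 ^ (N - 1) := pow_le_pow_right₀ (by norm_num) (by omega)
  have := two_pow_pred hN
  linarith

/-- One step of Chinese remaindering for F² - θ² = (F - θ)(F + θ). The factors are coprime because 2
and θ are units. Modulo F - θ one has Fη = -1 and the combination becomes 2r; modulo F + θ one has
Fη = 1 and it becomes 2r'. Leaving the factor 2 in place avoids a halving at every level. -/
theorem sub_pow_dvd_of_dvd {R : Type*} [CommRing R] {F θ η x x' y y' r r' c : R[X]}
    (hη : θ * η = -1) (h2 : IsUnit (2 : R[X]))
    (h₁ : F - θ ∣ r - c * ((x + θ * x') * (y + θ * y')))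
    (h₂ : F + θ ∣ r' - c * ((x - θ * x') * (y - θ * y'))) :
    F ^ 2 - θ ^ 2 ∣ (r + r' + F * (η * (r' - r))) - 2 * c * ((x + F * x') * (y + F * y')) := by
  obtain ⟨q, hq⟩ := h₁
  obtain ⟨q', hq'⟩ := h₂
  obtain ⟨u, hu⟩ := h2.exists_left_inv
  have hcop : IsCoprime (F - θ) (F + θ) :=
    ⟨u * η, -(u * η), by linear_combination (-2 * u) * hη + hu⟩
  rw [show F ^ 2 - θ ^ 2 = (F - θ) * (F + θ) by ring]
  refine hcop.mul_dvd ⟨2 * q + (r' - r) * η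
    - 2 * c * (x' * (y + θ * y') + y' * (x + θ * x') + (F - θ) * x' * y'), ?_⟩
    ⟨2 * q' + (r' - r) * η
    - 2 * c * (x' * (y - θ * y') + y' * (x - θ * x') + (F + θ) * x' * y'), ?_⟩
  · linear_combination 2 * hq + (r' - r) * hη
  · linear_combination 2 * hq' - (r' - r) * hη

/-- The standing assumptions: `P` holds the program, `N` is the length of the modulus, `p` the
precision, and `B` bounds the cost of a multiplication of `p`-bit integers. -/
structure Setting (P : Program) (b f N p B : ℕ) : Prop where
  loaded : Loaded P b f
  mulCost : MulCost P f p B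
  one_le : 1 ≤ p
  le_cost : p ≤ B
  le_mod : 8 * p ≤ N
  mod_le : N ≤ 16 * p

section
variable {P : Program} {b f N p B : ℕ}

theorem Setting.eight_le (hS : Setting P b f N p B) : 8 ≤ N := by
  have := hS.one_le; have := hS.le_mod; omega

/-- The length 32p covers residues, since N ≤ 16p, and the operands of the division below. The
numerical constant absorbs the linear work through p ≤ B. -/
theorem Setting.mul (hS : Setting P b f N p B) {x y : ℤ} (hx : |x| ≤ 2 ^ (32 * p))
    (hy : |y| ≤ 2 ^ (32 * p)) :
    Within P (b + 1) (.pair (.int p) (.pair (.int x) (.int y))) (.int (x * y)) (5000000 * B) := by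
  refine (mulBoth_spec hS.loaded hS.one_le hS.mulCost 32 32 x y hx hy).mono ?_
  have := hS.le_cost
  omega

/-- The argument of `mulMod`. -/
def mulModArg {d : ℕ} (x y : Tr d) (e N p : ℕ) : Val :=
  .pair x.toVal (.pair y.toVal (.pair (.int e) (.pair (.int N) (.int p))))

theorem two_pow_zmod (N : ℕ) : (2 : ZMod (2 ^ N + 1)) ^ N = -1 := by
  have : ((2 ^ N + 1 : ℕ) : ZMod (2 ^ N + 1)) = 0 := ZMod.natCast_self _
  push_cast at this
  linear_combination this

theorem isUnit_two_zmod {N : ℕ} (hN : 8 ≤ N) : IsUnit (2 : (ZMod (2 ^ N + 1))[X]) := by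
  refine .of_mul_eq_one (C (-2 ^ (N - 1))) ?_
  have h := two_pow_zmod N
  have h2 : (2 : ZMod (2 ^ N + 1)) ^ N = 2 * 2 ^ (N - 1) := by
    rw [← pow_succ', Nat.sub_add_cancel (by omega)]
  rw [show (2 : (ZMod (2 ^ N + 1))[X]) = C 2 from rfl, ← C_mul, ← C_1]
  congr 1
  linear_combination h2 - h

-- Recursive transform of radix 2: X^(2^(d+1)) - 2^(2h) splits into X^(2^d) - 2^h and X^(2^d) + 2^h,
-- and -2^h = 2^(h+N) brings the second factor into the form of the first. The divisibility of N and
-- e by 2^d keeps the exponents even down to the leaves. Inner nodes need only shifts and additions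
-- of N-bit residues, so that integer products occur at the 2^d leaves only; each of the d levels
-- doubles the result once.
set_option maxHeartbeats 1000000 in
theorem mulMod_spec (hS : Setting P b f N p B) {d e : ℕ} (x y : Tr d)
    (hx : x.All fun z => |z| ≤ 2 ^ N) (hy : y.All fun z => |z| ≤ 2 ^ N)
    (hdN : 2 ^ d ∣ N) (hde : 2 ^ d ∣ e) (heN : e < 2 * N) :
    ∃ r : Tr d, Within P (b + 5) (mulModArg x y e N p) r.toVal
        (2 ^ d * (d + 1) * (6000000 * B)) ∧
      (r.All fun z => |z| ≤ 2 ^ (N - 1) + 32) ∧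
      (X ^ 2 ^ d - C (2 ^ e) ∣
        r.poly (ZMod (2 ^ N + 1)) - C (2 ^ d) * (x.poly _ * y.poly _)) := by
  have hP := hS.loaded
  have hN := hS.eight_le
  have hpB := hS.le_cost
  have hNp := hS.mod_le
  have hp := hS.one_le
  induction d generalizing e with
  | zero =>
    cases x with | leaf z =>
    cases y with | leaf w =>
    have hz : |z| ≤ 2 ^ N := hx
    have hw : |w| ≤ 2 ^ N := hy
    have hNp' : (2 : ℤ) ^ N ≤ 2 ^ (32 * p) :=
      pow_le_pow_right₀ (by norm_num) (hS.mod_le.trans (by omega))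
    have hzw : |z * w| ≤ 2 ^ (2 * N + 3) := by
      rw [abs_mul, pow_add, two_mul, pow_add]
      have : |z| * |w| ≤ 2 ^ N * 2 ^ N := by gcongr
      linarith [show (0 : ℤ) ≤ 2 ^ N * 2 ^ N by positivity]
    refine ⟨.leaf (red N (z * w)), ?_, red_le hN hzw, ?_⟩
    · refine within_of_wp (hP 5 (by norm_num)) ?_
      simp only [mulMod, mulModArg, Tr.toVal, ↓wp_rules, ↓shape_rules]
      refine ⟨_, _, hS.mul (hz.trans hNp') (hw.trans hNp'), fun t ht => ?_⟩
      refine ⟨_, _, reduce_spec hP hN hzw, fun t ht => ⟨rfl, ?_⟩⟩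
      omega
    · simp [Tr.poly, red_cast]
  | succ d ih =>
    cases x with | node x x' =>
    cases y with | node y y' =>
    obtain ⟨h, rfl⟩ : ∃ h, e = 2 * h := (dvd_trans ⟨2 ^ d, by ring⟩ hde)
    have hdh : 2 ^ d ∣ h := by
      rw [pow_succ'] at hde; exact Nat.dvd_of_mul_dvd_mul_left two_pos hde
    have hdN' : 2 ^ d ∣ N := (pow_dvd_pow 2 (Nat.le_succ d)).trans hdN
    have hhN : h + 0 ≤ N := by omega
    have key : ∀ (σ : ℤ) {z w : Tr d}, (z.All fun z => |z| ≤ 2 ^ N) →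
        (w.All fun z => |z| ≤ 2 ^ N) → (z.map₂ (lin N h 0 0 σ) w).All fun z => |z| ≤ 2 ^ N :=
      fun σ z w hz hw => by
        refine Tr.All.map₂ (fun z w h1 h2 => ?_) hz hw
        exact le_two_pow hN (lin_le hN hhN h1 h2)
    obtain ⟨r, hr, hrb, hrp⟩ := ih (x.map₂ (lin N h 0 0 0) x') (y.map₂ (lin N h 0 0 0) y')
      (key 0 hx.1 hx.2) (key 0 hy.1 hy.2) hdN' hdh (by omega)
    obtain ⟨r', hr', hrb', hrp'⟩ := ih (x.map₂ (lin N h 0 0 (-1)) x')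
      (y.map₂ (lin N h 0 0 (-1)) y')
      (key (-1) hx.1 hx.2) (key (-1) hy.1 hy.2) hdN' (dvd_add hdh hdN') (by omega : h + N < 2 * N)
    have hrb2 := hrb.mono fun z => le_two_pow hN
    have hrb2' := hrb'.mono fun z => le_two_pow hN
    have hsub : 0 + (N - h) ≤ N := by omega
    -- The lower half is r + r', the upper half (r' - r) 2^(N-h), where 2^(N-h) is the η of
    -- `sub_pow_dvd_of_dvd` because 2^h · 2^(N-h) = 2^N = -1.
    refine ⟨.node (r.map₂ (lin N 0 0 0 0) r') (r'.map₂ (lin N 0 (N - h) 0 (-1)) r), ?_, ?_, ?_⟩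
    · refine within_of_wp (hP 5 (by norm_num)) ?_
      simp only [mulMod, mulModArg, callLinear, Tr.toVal, ↓wp_rules, ↓shape_rules]
      refine ⟨1, rfl, ?_⟩
      beta_reduce
      -- The program halves the exponent by a shift.
      have hh : ((2 * h : ℕ) : ℤ) / 2 ^ 1 = (h : ℤ) := by push_cast; omega
      rw [hh]
      refine ⟨_, _, linear_spec hP 0 hN hhN (Nat.zero_le N) hx.1 hx.2, fun t₁ ht₁ => ?_⟩
      refine ⟨_, _, linear_spec hP 0 hN hhN (Nat.zero_le N) hy.1 hy.2, fun t₂ ht₂ => ?_⟩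
      refine ⟨_, _, hr, fun t₃ ht₃ => ?_⟩
      refine ⟨_, _, linear_spec hP (-1) hN hhN (Nat.zero_le N) hx.1 hx.2, fun t₄ ht₄ => ?_⟩
      refine ⟨_, _, linear_spec hP (-1) hN hhN (Nat.zero_le N) hy.1 hy.2, fun t₅ ht₅ => ?_⟩
      refine ⟨_, _, hr', fun t₆ ht₆ => ?_⟩
      refine ⟨_, _, linear_spec hP 0 hN (e := 0) (e₂ := 0) (Nat.zero_le N) (Nat.zero_le N)
        hrb2 hrb2', fun t₇ ht₇ => ?_⟩
      have hNh : ((N - h : ℕ) : ℤ) = N - h := by omega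
      rw [← hNh]
      refine ⟨_, _, linear_spec hP (-1) hN hsub (Nat.zero_le N) hrb2' hrb2, fun t₈ ht₈ => ?_⟩
      refine ⟨rfl, ?_⟩
      have b1 := bitLen_natCast_le N
      have b2 := bitLen_natCast_le h
      have b3 := bitLen_natCast_le (2 * h)
      rw [bitLen_zero, bitLen_one, bitLen_neg_one]
      have hq : 1 ≤ 2 ^ d := Nat.one_le_two_pow
      have hlin : (2 * 2 ^ d - 1) * (300 * N) ≤ 2 ^ d * (9600 * B) := by
        calc _ ≤ (2 * 2 ^ d) * (300 * N) := Nat.mul_le_mul_right _ (Nat.sub_le _ _)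
          _ ≤ (2 * 2 ^ d) * (300 * (16 * B)) := by gcongr; omega
          _ = _ := by ring
      have hB : 1 ≤ B := by omega
      have hBq : B ≤ 2 ^ d * B := Nat.le_mul_of_pos_left _ hq
      have : bitLen ((1 : ℕ) : ℤ) = 1 := bitLen_one
      rw [pow_succ]
      have e1 : 2 ^ d * 2 * (d + 1 + 1) * (6000000 * B) =
        2 * (2 ^ d * (d + 1) * (6000000 * B)) + 12000000 * (2 ^ d * B) := by ring
      rw [e1]
      have e2 : 2 ^ d * (9600 * B) = 9600 * (2 ^ d * B) := by ring
      omega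
    · constructor
      · refine Tr.All.map₂ (fun z w h1 h2 => ?_) hrb2 hrb2'
        exact lin_le hN (Nat.zero_le N) h1 h2
      · refine Tr.All.map₂ (fun z w h1 h2 => ?_) hrb2' hrb2
        exact lin_le hN hsub h1 h2
    · have hη : (C (2 ^ h) * C (2 ^ (N - h)) : (ZMod (2 ^ N + 1))[X]) = -1 := by
        rw [← C_mul, ← pow_add, Nat.add_sub_of_le (by omega), two_pow_zmod]; simp
      simp only [poly_map₂_lin] at hrp hrp'
      have := sub_pow_dvd_of_dvd (F := X ^ 2 ^ d) (r := r.poly _) (r' := r'.poly _)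
        (x := x.poly _) (x' := x'.poly _) (y := y.poly _) (y' := y'.poly _) (c := C (2 ^ d))
        hη (isUnit_two_zmod hN) (by simpa using hrp)
        (by
          rw [pow_add, two_pow_zmod] at hrp'
          simpa [sub_eq_add_neg] using hrp')
      convert this using 1
      · rw [pow_succ 2 d, pow_mul X, two_mul h, pow_add, C_mul, sq (C (2 ^ h))]
      · have hC : (C 2 : (ZMod (2 ^ N + 1))[X]) = 2 := rfl
        simp only [Tr.poly, poly_map₂_lin, pow_succ]
        simp [hC]
        ring
end
end Interp

/-! ### Exact products of integer polynomials -/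

namespace Interp
open Code Polynomial

section
variable {P : Program} {b f N p B : ℕ}

/-- The pair of the length of the modulus and the precision. -/
def context (N p : ℕ) : Val := .pair (.int N) (.int p)

/-- The coefficients of a product. -/
def conv {d : ℕ} (x y : Tr d) (k : ℕ) : ℤ :=
  ∑ ij ∈ Finset.HasAntidiagonal.antidiagonal k, x.coeff ij.1 * y.coeff ij.2

theorem coeff_mul_poly {R : Type*} [CommRing R] {d : ℕ} (x y : Tr d) (k : ℕ) :
    (x.poly R * y.poly R).coeff k = (conv x y k : R) := by
  rw [coeff_mul, conv, Int.cast_sum]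
  refine Finset.sum_congr rfl fun ij _ => ?_
  rw [Tr.coeff_poly, Tr.coeff_poly, Int.cast_mul]

theorem conv_eq_zero {d : ℕ} (x y : Tr d) {k : ℕ} (h : 2 ^ (d + 1) ≤ k) : conv x y k = 0 := by
  refine Finset.sum_eq_zero fun ij hij => ?_
  rw [Finset.HasAntidiagonal.mem_antidiagonal] at hij
  rw [pow_succ] at h
  rcases le_or_gt (2 ^ d) ij.1 with h1 | h1
  · rw [x.coeff_eq_zero h1, zero_mul]
  · rw [y.coeff_eq_zero (by omega), mul_zero]

theorem abs_conv_le {d : ℕ} {x y : Tr d} {q : ℕ} (hx : x.All fun z => |z| ≤ 2 ^ q)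
    (hy : y.All fun z => |z| ≤ 2 ^ q) (k : ℕ) : |conv x y k| ≤ 2 ^ (d + 1 + 2 * q) := by
  rcases le_or_gt (2 ^ (d + 1)) k with h | h
  · rw [conv_eq_zero x y h]; simp
  · refine (Finset.abs_sum_le_sum_abs _ _).trans ?_
    have : ∀ ij ∈ Finset.HasAntidiagonal.antidiagonal k, |x.coeff ij.1 * y.coeff ij.2| ≤ 2 ^ (2 * q) := by
      intro ij _
      rw [abs_mul, two_mul, pow_add]
      exact mul_le_mul (hx.coeff (by simp) _) (hy.coeff (by simp) _) (abs_nonneg _) (by positivity)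
    refine (Finset.sum_le_card_nsmul _ _ _ this).trans ?_
    rw [Finset.Nat.card_antidiagonal, nsmul_eq_mul, pow_add]
    gcongr
    exact_mod_cast h

theorem eq_of_dvd_of_natDegree_lt {N : ℕ} {m : ℕ} (hm : 1 ≤ m) {r s : (ZMod (2 ^ N + 1))[X]}
    (hr : r.degree < m) (hs : s.degree < m) (h : X ^ m - 1 ∣ r - s) : r = s := by
  have : Nontrivial (ZMod (2 ^ N + 1)) := ZMod.nontrivial_iff.2 (by simp)
  have hmon : (X ^ m - 1 : (ZMod (2 ^ N + 1))[X]).Monic := monic_X_pow_sub_C 1 (by omega)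
  have hdeg : (X ^ m - 1 : (ZMod (2 ^ N + 1))[X]).degree = m := degree_X_pow_sub_C (by omega) 1
  by_contra hne
  refine hmon.not_dvd_of_degree_lt (sub_ne_zero.2 hne) ?_ h
  rw [hdeg]
  exact (degree_sub_le _ _).trans_lt (max_lt hr hs)

/-- The outermost remaindering step, with θ = 1. Here the factors are not cut into halves: they
already have fewer than 2^d coefficients, and s is their unreduced product. -/
theorem sub_one_dvd_of_dvd {R : Type*} [CommRing R] {F s r r' : R[X]} (h2 : IsUnit (2 : R[X]))
    (h₁ : F - 1 ∣ r - s) (h₂ : F + 1 ∣ r' - s) :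
    F ^ 2 - 1 ∣ (r + r' + F * (r - r')) - 2 * s := by
  obtain ⟨q, hq⟩ := h₁
  obtain ⟨q', hq'⟩ := h₂
  obtain ⟨u, hu⟩ := h2.exists_left_inv
  have hcop : IsCoprime (F - 1) (F + 1) := ⟨-u, u, by linear_combination hu⟩
  rw [show F ^ 2 - 1 = (F - 1) * (F + 1) by ring]
  refine hcop.mul_dvd ⟨2 * q + (r - r'), ?_⟩ ⟨2 * q' + (r - r'), ?_⟩
  · linear_combination 2 * hq
  · linear_combination 2 * hq'

/-- The product has fewer than 2^(d+1) coefficients, hence is determined by its residues modulo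
X^(2^d) - 1 and X^(2^d) + 1, which are the exponents e = 0 and e = N of `mulMod_spec`. The
hypothesis on q makes the scaled true coefficients so small that congruence modulo 2^N + 1 forces
equality of integers. -/
theorem mulPoly_spec (hS : Setting P b f N p B) {d q : ℕ} (hd : 2 ^ d ∣ N)
    (hq : 2 * d + 2 * q + 5 ≤ N) {x y : Tr d} (hx : x.All fun z => |z| ≤ 2 ^ q)
    (hy : y.All fun z => |z| ≤ 2 ^ q) :
    ∃ r : Tr (d + 1), Within P (b + 6) (.pair x.toVal (.pair y.toVal (context N p))) r.toVal
        (2 ^ d * (d + 1) * (13000000 * B)) ∧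
      ∀ k, r.coeff k = 2 ^ (d + 1) * conv x y k := by
  have hP := hS.loaded
  have hN := hS.eight_le
  have hpB := hS.le_cost
  have hNp := hS.mod_le
  have hp := hS.one_le
  have hqN : (2 : ℤ) ^ q ≤ 2 ^ N := pow_le_pow_right₀ (by norm_num) (by omega)
  have hx' : x.All fun z => |z| ≤ 2 ^ N := hx.mono fun z hz => hz.trans hqN
  have hy' : y.All fun z => |z| ≤ 2 ^ N := hy.mono fun z hz => hz.trans hqN
  obtain ⟨r, hr, hrb, hrp⟩ := mulMod_spec hS x y hx' hy' hd (dvd_zero _) (by omega : 0 < 2 * N)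
  obtain ⟨r', hr', hrb', hrp'⟩ := mulMod_spec hS x y hx' hy' hd hd (by omega : N < 2 * N)
  have hrb2 := hrb.mono fun z => le_two_pow hN
  have hrb2' := hrb'.mono fun z => le_two_pow hN
  set s : Tr (d + 1) := .node (r.map₂ (lin N 0 0 0 0) r') (r.map₂ (lin N 0 0 0 (-1)) r') with hs
  have hsb : s.All fun z => |z| ≤ 2 ^ (N - 1) + 32 := by
    constructor
    all_goals
      refine Tr.All.map₂ (fun z w h1 h2 => ?_) hrb2 hrb2'
      exact lin_le hN (Nat.zero_le N) h1 h2
  refine ⟨s, ?_, ?_⟩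
  · refine within_of_wp (hP 6 (by norm_num)) ?_
    simp only [mulPoly, context, callLinear, hs, Tr.toVal, ↓wp_rules, ↓shape_rules]
    refine ⟨_, _, hr, fun t₁ ht₁ => ?_⟩
    refine ⟨_, _, hr', fun t₂ ht₂ => ?_⟩
    refine ⟨_, _, linear_spec hP 0 hN (e := 0) (e₂ := 0) (Nat.zero_le N) (Nat.zero_le N)
        hrb2 hrb2', fun t₃ ht₃ => ?_⟩
    refine ⟨_, _, linear_spec hP (-1) hN (e := 0) (e₂ := 0) (Nat.zero_le N) (Nat.zero_le N)
        hrb2 hrb2', fun t₄ ht₄ => ?_⟩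
    refine ⟨rfl, ?_⟩
    rw [bitLen_zero, bitLen_neg_one]
    have hq : 1 ≤ 2 ^ d := Nat.one_le_two_pow
    have hlin : (2 * 2 ^ d - 1) * (300 * N) ≤ 2 ^ d * (9600 * B) := by
      calc _ ≤ (2 * 2 ^ d) * (300 * N) := Nat.mul_le_mul_right _ (Nat.sub_le _ _)
        _ ≤ (2 * 2 ^ d) * (300 * (16 * B)) := by gcongr; omega
        _ = _ := by ring
    have hB : 1 ≤ B := by omega
    have hBq : B ≤ 2 ^ d * B := Nat.le_mul_of_pos_left _ hq
    have hBq' : 2 ^ d * B ≤ 2 ^ d * (d + 1) * B := by gcongr; nlinarith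
    have e1 : 2 ^ d * (9600 * B) = 9600 * (2 ^ d * B) := by ring
    have e2 : 2 ^ d * (d + 1) * (6000000 * B) = 6000000 * (2 ^ d * (d + 1) * B) := by ring
    have e3 : 2 ^ d * (d + 1) * (13000000 * B) = 13000000 * (2 ^ d * (d + 1) * B) := by ring
    omega
  · have hC : (C 2 : (ZMod (2 ^ N + 1))[X]) = 2 := rfl
    have hdvd : X ^ 2 ^ (d + 1) - 1 ∣ s.poly (ZMod (2 ^ N + 1)) -
        C (2 ^ (d + 1)) * (x.poly _ * y.poly _) := by
      have := sub_one_dvd_of_dvd (F := X ^ 2 ^ d) (isUnit_two_zmod hN)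
        (by simpa using hrp) (by rw [two_pow_zmod] at hrp'; simpa using hrp')
      convert this using 1
      · rw [pow_succ 2 d, pow_mul X]
      · simp only [hs, Tr.poly, poly_map₂_lin, pow_succ]
        simp [hC]
        ring
    have heq := eq_of_dvd_of_natDegree_lt Nat.one_le_two_pow (Tr.degree_poly_lt s) (by
      rw [degree_lt_iff_coeff_zero]
      intro k hk
      rw [coeff_C_mul, coeff_mul_poly, conv_eq_zero x y hk, Int.cast_zero, mul_zero]) hdvd
    intro k
    have hk := congrArg (fun a => Polynomial.coeff a k) heq
    simp only [coeff_C_mul, coeff_mul_poly, Tr.coeff_poly] at hk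
    have hk' : ((s.coeff k - 2 ^ (d + 1) * conv x y k : ℤ) : ZMod (2 ^ N + 1)) = 0 := by
      push_cast
      rw [hk, sub_self]
    rw [ZMod.intCast_zmod_eq_zero_iff_dvd] at hk'
    have b1 : |s.coeff k| ≤ 2 ^ (N - 1) + 32 := hsb.coeff (by rw [abs_zero]; positivity) k
    have b2 : |2 ^ (d + 1) * conv x y k| ≤ 2 ^ (N - 3) * 1 := by
      rw [abs_mul, abs_pow, abs_two, mul_one]
      calc _ ≤ (2 : ℤ) ^ (d + 1) * 2 ^ (d + 1 + 2 * q) := by gcongr; exact abs_conv_le hx hy k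
        _ = 2 ^ (2 * d + 2 * q + 2) := by rw [← pow_add]; congr 1; ring
        _ ≤ _ := pow_le_pow_right₀ (by norm_num) (by omega)
    have b3 : (2 : ℤ) ^ N = 8 * 2 ^ (N - 3) := by
      rw [show (8 : ℤ) = 2 ^ 3 by norm_num, ← pow_add]; congr 1; omega
    have b4 := two_pow_pred hN
    have b5 : (2 : ℤ) ^ 5 ≤ 2 ^ (N - 3) := pow_le_pow_right₀ (by norm_num) (by omega)
    -- In units of 2^(N-3), the computed residue is at most 4 + 1 and the true value at most 1,
    -- while the modulus exceeds 8.
    have := Int.eq_zero_of_abs_lt_dvd hk' (by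
      push_cast
      refine (abs_sub _ _).trans_lt ?_
      linarith)
    linarith

theorem depth_spec (hS : Setting P b f N p B) {d : ℕ} (x : Tr d) :
    Within P (b + 7) x.toVal (.int d) ((d + 1) * (d + 20)) := by
  induction x with
  | leaf z =>
    refine within_of_wp (hS.loaded 7 (by norm_num)) ?_
    simp only [depth, Tr.toVal, ↓wp_rules, ↓shape_rules]
    rw [bitLen_zero]
    exact ⟨rfl, by norm_num⟩
  | @node d x y ih _ =>
    refine within_of_wp (hS.loaded 7 (by norm_num)) ?_
    simp only [depth, Tr.toVal, ↓wp_rules, ↓shape_rules]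
    refine ⟨_, _, ih, fun t ht => ?_⟩
    simp only [↓shape_rules]
    rw [bitLen_one]
    refine ⟨by push_cast; rw [add_comm], ?_⟩
    have := bitLen_natCast_le d
    nlinarith

end

/-! ### Complex polynomials -/

/-- Complex polynomials with `2 ^ d` coefficients. -/
structure CTr (d : ℕ) where
  /-- the real parts -/
  re : Tr d
  /-- the imaginary parts -/
  im : Tr d

namespace CTr

/-- The value that represents a complex polynomial. -/
def toVal {d : ℕ} (x : CTr d) : Val := .pair x.re.toVal x.im.toVal

/-- All real and imaginary parts satisfy `q`. -/
def All (q : ℤ → Prop) {d : ℕ} (x : CTr d) : Prop := x.re.All q ∧ x.im.All q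

/-- The power series with coefficients in `2 ^ (-p) ℤ[i]`. -/
noncomputable def ps (p : ℕ) {d : ℕ} (x : CTr d) : PowerSeries ℂ :=
  PowerSeries.mk fun k => ((x.re.coeff k : ℂ) + x.im.coeff k * Complex.I) / 2 ^ p

theorem coeff_ps (p : ℕ) {d : ℕ} (x : CTr d) (k : ℕ) : PowerSeries.coeff k (x.ps p) =
    ((x.re.coeff k : ℂ) + x.im.coeff k * Complex.I) / 2 ^ p := by
  rw [ps, PowerSeries.coeff_mk]

theorem coeff_ps_eq_zero (p : ℕ) {d : ℕ} (x : CTr d) {k : ℕ} (h : 2 ^ d ≤ k) :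
    PowerSeries.coeff k (x.ps p) = 0 := by
  rw [coeff_ps, x.re.coeff_eq_zero h, x.im.coeff_eq_zero h]; simp

/-- Juxtaposition of a lower and an upper half. -/
def node {d : ℕ} (x y : CTr d) : CTr (d + 1) := ⟨.node x.re y.re, .node x.im y.im⟩

theorem coeff_ps_node_lt (p : ℕ) {d : ℕ} (x y : CTr d) {k : ℕ} (h : k < 2 ^ d) :
    PowerSeries.coeff k ((node x y).ps p) = PowerSeries.coeff k (x.ps p) := by
  rw [coeff_ps, coeff_ps, node, Tr.coeff_node_lt _ _ h, Tr.coeff_node_lt _ _ h]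

theorem coeff_ps_node_add (p : ℕ) {d : ℕ} (x y : CTr d) (k : ℕ) :
    PowerSeries.coeff (k + 2 ^ d) ((node x y).ps p) = PowerSeries.coeff k (y.ps p) := by
  rw [coeff_ps, coeff_ps, node, Tr.coeff_node_add, Tr.coeff_node_add]

theorem exists_node {d : ℕ} (x : CTr (d + 1)) : ∃ y z : CTr d, x = node y z := by
  obtain ⟨r, i⟩ := x
  cases r with | node r r' =>
  cases i with | node i i' =>
  exact ⟨⟨r, i⟩, ⟨r', i'⟩, rfl⟩

end CTr

/-- The sum of the absolute values of the first `L` coefficients. -/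
noncomputable def nrm (L : ℕ) (A : PowerSeries ℂ) : ℝ :=
  ∑ k ∈ Finset.range L, ‖PowerSeries.coeff k A‖

theorem nrm_nonneg (L : ℕ) (A : PowerSeries ℂ) : 0 ≤ nrm L A :=
  Finset.sum_nonneg fun _ _ => norm_nonneg _

theorem norm_coeff_le_nrm {L k : ℕ} (h : k < L) (A : PowerSeries ℂ) :
    ‖PowerSeries.coeff k A‖ ≤ nrm L A :=
  Finset.single_le_sum (f := fun k => ‖PowerSeries.coeff k A‖) (fun _ _ => norm_nonneg _)
    (Finset.mem_range.2 h)

theorem nrm_congr {L : ℕ} {A A' : PowerSeries ℂ}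
    (h : ∀ k < L, PowerSeries.coeff k A = PowerSeries.coeff k A') : nrm L A = nrm L A' :=
  Finset.sum_congr rfl fun k hk => by rw [h k (Finset.mem_range.1 hk)]

theorem nrm_mono {L L' : ℕ} (h : L ≤ L') (A : PowerSeries ℂ) : nrm L A ≤ nrm L' A :=
  Finset.sum_le_sum_of_subset_of_nonneg (Finset.range_mono h) fun _ _ _ => norm_nonneg _

theorem nrm_eq_of_coeff_eq_zero {L L' : ℕ} (h : L ≤ L') {A : PowerSeries ℂ}
    (hA : ∀ k, L ≤ k → PowerSeries.coeff k A = 0) : nrm L' A = nrm L A := by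
  refine (Finset.sum_subset (Finset.range_mono h) fun k _ hk => ?_).symm
  rw [hA k (by simpa using hk), norm_zero]

theorem nrm_add (L : ℕ) (A A' : PowerSeries ℂ) : nrm L (A + A') ≤ nrm L A + nrm L A' := by
  rw [nrm, nrm, nrm, ← Finset.sum_add_distrib]
  exact Finset.sum_le_sum fun k _ => by rw [map_add]; exact norm_add_le _ _

theorem nrm_neg (L : ℕ) (A : PowerSeries ℂ) : nrm L (-A) = nrm L A := by
  simp [nrm]

theorem nrm_sub (L : ℕ) (A A' : PowerSeries ℂ) : nrm L (A - A') ≤ nrm L A + nrm L A' := by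
  rw [sub_eq_add_neg, ← nrm_neg L A']; exact nrm_add _ _ _

theorem nrm_zero (L : ℕ) : nrm L 0 = 0 := by simp [nrm]

theorem nrm_le_card_mul {L : ℕ} {A : PowerSeries ℂ} {c : ℝ}
    (h : ∀ k < L, ‖PowerSeries.coeff k A‖ ≤ c) : nrm L A ≤ L * c := by
  refine (Finset.sum_le_card_nsmul _ _ c fun k hk => h k (Finset.mem_range.1 hk)).trans ?_
  rw [Finset.card_range, nsmul_eq_mul]

/-- The coefficients of the product below L involve only index pairs with sum below L, and these lie
in the square of all pairs of indices below L. Submultiplicativity keeps degrees out of the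
propagation of errors. -/
theorem nrm_mul (L : ℕ) (A A' : PowerSeries ℂ) : nrm L (A * A') ≤ nrm L A * nrm L A' := by
  have h1 : nrm L (A * A') ≤ ∑ k ∈ Finset.range L, ∑ ij ∈ Finset.HasAntidiagonal.antidiagonal k,
      ‖PowerSeries.coeff ij.1 A‖ * ‖PowerSeries.coeff ij.2 A'‖ := by
    refine Finset.sum_le_sum fun k _ => ?_
    rw [PowerSeries.coeff_mul]
    refine (norm_sum_le _ _).trans (Finset.sum_le_sum fun ij _ => ?_)
    rw [norm_mul]
  refine h1.trans ?_
  rw [nrm, nrm, Finset.sum_mul_sum, ← Finset.sum_product', Finset.sum_sigma']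
  have hinj : Set.InjOn (fun q : (_ : ℕ) × ℕ × ℕ => q.2)
      ((Finset.range L).sigma fun k => Finset.HasAntidiagonal.antidiagonal k) := by
    rintro ⟨k, ij⟩ h ⟨k', ij'⟩ h' heq
    simp only [Finset.coe_sigma, Set.mem_sigma_iff, Finset.mem_coe,
      Finset.HasAntidiagonal.mem_antidiagonal] at h h' heq
    subst heq
    obtain rfl : k = k' := h.2.symm.trans h'.2
    rfl
  rw [← Finset.sum_image (f := fun q : ℕ × ℕ =>
    ‖PowerSeries.coeff q.1 A‖ * ‖PowerSeries.coeff q.2 A'‖) hinj]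
  refine Finset.sum_le_sum_of_subset_of_nonneg ?_ fun _ _ _ => by positivity
  intro q hq
  simp only [Finset.mem_image, Finset.mem_sigma, Finset.mem_range,
    Finset.HasAntidiagonal.mem_antidiagonal, Finset.mem_product] at hq ⊢
  obtain ⟨⟨k, ij⟩, ⟨hk, hij⟩, rfl⟩ := hq
  simp only at hk hij ⊢
  omega

end Interp

/-! ### Rounded arithmetic of complex polynomials -/

namespace Interp
open Code

/-- Small integers are their own centred residues, so the modular operation doubles as exact
addition and subtraction followed by a rounding shift. -/
theorem lin_exact {N e₃ : ℕ} (hN : 8 ≤ N) {σ x y : ℤ} (hx : |x| ≤ 2 ^ (N - 3))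
    (hy : |y| ≤ 2 ^ (N - 3)) :
    lin N 0 0 e₃ σ x y = (if σ < 0 then x - y else x + y) / 2 ^ e₃ := by
  have h1 : (2 : ℤ) ^ (N - 1) = 4 * 2 ^ (N - 3) := by
    rw [show (4 : ℤ) = 2 ^ 2 by norm_num, ← pow_add]; congr 1; omega
  have h2 : (0 : ℤ) < 2 ^ (N - 3) := by positivity
  rw [lin, pow_zero, mul_one, mul_one, red_eq_self hN]
  split_ifs
  · exact (abs_sub _ _).trans_lt (by linarith)
  · exact (abs_add_le _ _).trans_lt (by linarith)

theorem abs_floor_div_sub_le (s : ℤ) (p : ℕ) :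
    |((s / 2 ^ p : ℤ) : ℝ) - s / 2 ^ p| ≤ 1 := by
  have hp : (0 : ℤ) < 2 ^ p := by positivity
  have hp' : (0 : ℝ) < 2 ^ p := by positivity
  have h1 : s % 2 ^ p = s - 2 ^ p * (s / 2 ^ p) := Int.emod_def _ _
  have h2 : 0 ≤ s % 2 ^ p := Int.emod_nonneg _ hp.ne'
  have h3 : s % 2 ^ p < 2 ^ p := Int.emod_lt_of_pos _ hp
  have h1' : ((s % 2 ^ p : ℤ) : ℝ) = s - 2 ^ p * (s / 2 ^ p : ℤ) := by exact_mod_cast h1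
  have h2' : (0 : ℝ) ≤ (s % 2 ^ p : ℤ) := by exact_mod_cast h2
  have h3' : ((s % 2 ^ p : ℤ) : ℝ) < 2 ^ p := by exact_mod_cast h3
  rw [show (s : ℝ) = 2 ^ p * (s / 2 ^ p : ℤ) + (s % 2 ^ p : ℤ) by linarith, add_div,
    mul_div_cancel_left₀ _ hp'.ne', sub_add_cancel_left, abs_neg, abs_of_nonneg (by positivity),
    div_le_one hp']
  exact h3'.le

section
variable {P : Program} {b f N p B : ℕ}

/-- The argument of the operations on complex polynomials. -/
def complexArg (v w : Val) (N p : ℕ) : Val := .pair v (.pair w (context N p))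

-- Four real products. A single shift by p + 1 + d removes both the factor 2^(d+1) left by the
-- transform and one of the two factors 2^p of the fixed-point format, so that each real or
-- imaginary part is rounded only once; 2^(d+1) coefficients with two parts each give the bound.
set_option maxHeartbeats 1000000 in
theorem mulComplex_spec_of_all (hS : Setting P b f N p B) {d : ℕ} (hd : 2 ^ d ∣ N)
    (hdp : 2 * d + 8 ≤ p) {x y : CTr d} (hx : x.All fun z => |z| ≤ 2 ^ (2 * p))
    (hy : y.All fun z => |z| ≤ 2 ^ (2 * p)) :
    ∃ r : CTr (d + 1), Within P (b + 8) (complexArg x.toVal y.toVal N p) r.toVal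
        (2 ^ d * (d + 1) * (60000000 * B)) ∧
      ∀ L, nrm L (r.ps p - x.ps p * y.ps p) ≤ 2 ^ (d + 2) / 2 ^ p := by
  have hP := hS.loaded
  have hN := hS.eight_le
  have hpB := hS.le_cost
  have hNp := hS.mod_le
  have hpN := hS.le_mod
  have hp := hS.one_le
  have hq : 2 * d + 2 * (2 * p) + 5 ≤ N := by omega
  obtain ⟨r₁, hr₁, hc₁⟩ := mulPoly_spec hS hd hq hx.1 hy.1
  obtain ⟨r₂, hr₂, hc₂⟩ := mulPoly_spec hS hd hq hx.2 hy.2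
  obtain ⟨r₃, hr₃, hc₃⟩ := mulPoly_spec hS hd hq hx.1 hy.2
  obtain ⟨r₄, hr₄, hc₄⟩ := mulPoly_spec hS hd hq hx.2 hy.1
  have hsmall : ∀ {r : Tr (d + 1)} {u v : Tr d}, (u.All fun z => |z| ≤ 2 ^ (2 * p)) →
      (v.All fun z => |z| ≤ 2 ^ (2 * p)) → (∀ k, r.coeff k = 2 ^ (d + 1) * conv u v k) →
      r.All fun z => |z| ≤ 2 ^ (N - 3) := by
    intro r u v hu hv hr
    refine Tr.all_of_coeff fun k _ => ?_
    rw [hr, abs_mul, abs_pow, abs_two]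
    calc _ ≤ (2 : ℤ) ^ (d + 1) * 2 ^ (d + 1 + 2 * (2 * p)) := by
          gcongr; exact abs_conv_le hu hv k
      _ = 2 ^ (2 * d + 4 * p + 2) := by rw [← pow_add]; congr 1; ring
      _ ≤ _ := pow_le_pow_right₀ (by norm_num) (by omega)
  have hs₁ := hsmall hx.1 hy.1 hc₁
  have hs₂ := hsmall hx.2 hy.2 hc₂
  have hs₃ := hsmall hx.1 hy.2 hc₃
  have hs₄ := hsmall hx.2 hy.1 hc₄
  have h3N : (2 : ℤ) ^ (N - 3) ≤ 2 ^ N := pow_le_pow_right₀ (by norm_num) (by omega)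
  refine ⟨⟨r₁.map₂ (lin N 0 0 (p + 1 + d) (-1)) r₂, r₃.map₂ (lin N 0 0 (p + 1 + d) 0) r₄⟩,
    ?_, ?_⟩
  · refine within_of_wp (hP 8 (by norm_num)) ?_
    simp only [mulComplex, complexArg, context, callLinear, callMulPoly, CTr.toVal, ↓wp_rules,
      ↓shape_rules]
    refine ⟨_, _, depth_spec hS x.re, fun t₁ ht₁ => ?_⟩
    simp only [↓shape_rules]
    refine ⟨_, _, hr₁, fun t₂ ht₂ => ⟨_, _, hr₂, fun t₃ ht₃ => ?_⟩⟩
    have hcast : (p : ℤ) + 1 + d = ((p + 1 + d : ℕ) : ℤ) := by push_cast; ring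
    rw [hcast]
    refine ⟨_, _, linear_spec hP (-1) hN (e := 0) (e₂ := 0) (Nat.zero_le N) (by omega)
      (hs₁.mono fun z hz => hz.trans h3N) (hs₂.mono fun z hz => hz.trans h3N),
      fun t₄ ht₄ => ?_⟩
    refine ⟨_, _, hr₃, fun t₅ ht₅ => ⟨_, _, hr₄, fun t₆ ht₆ => ?_⟩⟩
    refine ⟨_, _, linear_spec hP 0 hN (e := 0) (e₂ := 0) (Nat.zero_le N) (by omega)
      (hs₃.mono fun z hz => hz.trans h3N) (hs₄.mono fun z hz => hz.trans h3N),
      fun t₇ ht₇ => ?_⟩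
    refine ⟨rfl, ?_⟩
    have hb1 := bitLen_natCast_le p
    have hb2 := bitLen_natCast_le d
    have hb3 : bitLen ((p : ℤ) + 1) ≤ p + 1 := by exact_mod_cast bitLen_natCast_le (p + 1)
    rw [bitLen_zero, bitLen_neg_one, bitLen_one]
    have hq : 1 ≤ 2 ^ d := Nat.one_le_two_pow
    have hlin : (2 * 2 ^ (d + 1) - 1) * (300 * N) ≤ 2 ^ d * (19200 * B) := by
      calc _ ≤ (2 * 2 ^ (d + 1)) * (300 * N) := Nat.mul_le_mul_right _ (Nat.sub_le _ _)
        _ ≤ (2 * 2 ^ (d + 1)) * (300 * (16 * B)) := by gcongr; omega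
        _ = _ := by ring
    have hB : 1 ≤ B := by omega
    have hBq : B ≤ 2 ^ d * B := Nat.le_mul_of_pos_left _ hq
    have hBq' : 2 ^ d * B ≤ 2 ^ d * (d + 1) * B := by gcongr; nlinarith
    have hdep : (d + 1) * (d + 20) ≤ 13 * (2 ^ d * B) := by
      have : d + 1 ≤ 2 ^ d := d.lt_two_pow_self
      calc _ ≤ 2 ^ d * (13 * B) := by gcongr; omega
        _ = _ := by ring
    have e1 : 2 ^ d * (19200 * B) = 19200 * (2 ^ d * B) := by ring
    have e2 : 2 ^ d * (d + 1) * (13000000 * B) = 13000000 * (2 ^ d * (d + 1) * B) := by ring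
    have e3 : 2 ^ d * (d + 1) * (60000000 * B) = 60000000 * (2 ^ d * (d + 1) * B) := by ring
    omega
  · intro L
    have hzero : ∀ k, 2 ^ (d + 1) ≤ k → PowerSeries.coeff k
        (CTr.ps p ⟨r₁.map₂ (lin N 0 0 (p + 1 + d) (-1)) r₂,
          r₃.map₂ (lin N 0 0 (p + 1 + d) 0) r₄⟩ - x.ps p * y.ps p) = 0 := by
      intro k hk
      rw [map_sub, CTr.coeff_ps_eq_zero _ _ hk, PowerSeries.coeff_mul, Finset.sum_eq_zero, sub_zero]
      intro ij hij
      rw [Finset.HasAntidiagonal.mem_antidiagonal] at hij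
      rw [pow_succ] at hk
      rcases le_or_gt (2 ^ d) ij.1 with h1 | h1
      · rw [CTr.coeff_ps_eq_zero _ _ h1, zero_mul]
      · rw [CTr.coeff_ps_eq_zero _ y (by omega), mul_zero]
    have hprod : ∀ k, PowerSeries.coeff k (x.ps p * y.ps p) =
        (((conv x.re y.re k - conv x.im y.im k : ℤ) : ℂ) / 2 ^ p +
          ((conv x.re y.im k + conv x.im y.re k : ℤ) : ℂ) / 2 ^ p * Complex.I) / 2 ^ p := by
      intro k
      rw [PowerSeries.coeff_mul]
      simp only [CTr.coeff_ps, conv]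
      rw [← Finset.sum_sub_distrib, ← Finset.sum_add_distrib]
      push_cast
      rw [Finset.sum_div, Finset.sum_div, Finset.sum_mul, ← Finset.sum_add_distrib, Finset.sum_div]
      refine Finset.sum_congr rfl fun ij _ => ?_
      have hI := Complex.I_mul_I
      field_simp
      linear_combination ((x.im.coeff ij.1 : ℂ) * y.im.coeff ij.2) * hI
    have hle : nrm (2 ^ (d + 1)) (CTr.ps p ⟨r₁.map₂ (lin N 0 0 (p + 1 + d) (-1)) r₂,
        r₃.map₂ (lin N 0 0 (p + 1 + d) 0) r₄⟩ - x.ps p * y.ps p) ≤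
        (2 ^ (d + 1) : ℕ) * (2 / 2 ^ p) := by
      refine nrm_le_card_mul fun k hk => ?_
      have hdiv : ∀ s : ℤ, 2 ^ (d + 1) * s / 2 ^ (p + 1 + d) = s / 2 ^ p := by
        intro s
        rw [show p + 1 + d = d + 1 + p by ring, pow_add _ (d + 1),
          Int.mul_ediv_mul_of_pos _ _ (by positivity)]
      have e1 : (r₁.map₂ (lin N 0 0 (p + 1 + d) (-1)) r₂).coeff k =
          (conv x.re y.re k - conv x.im y.im k) / 2 ^ p := by
        rw [Tr.coeff_map₂ _ _ hk, lin_exact hN (hs₁.coeff (by simp) k) (hs₂.coeff (by simp) k),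
          hc₁, hc₂, if_pos (by norm_num), ← mul_sub, hdiv]
      have e2 : (r₃.map₂ (lin N 0 0 (p + 1 + d) 0) r₄).coeff k =
          (conv x.re y.im k + conv x.im y.re k) / 2 ^ p := by
        rw [Tr.coeff_map₂ _ _ hk, lin_exact hN (hs₃.coeff (by simp) k) (hs₄.coeff (by simp) k),
          hc₃, hc₄, if_neg (by norm_num), ← mul_add, hdiv]
      rw [map_sub, hprod, CTr.coeff_ps, e1, e2, ← sub_div, norm_div, norm_pow, Complex.norm_two]
      gcongr
      generalize conv x.re y.re k - conv x.im y.im k = s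
      generalize conv x.re y.im k + conv x.im y.re k = s'
      have h1 := abs_floor_div_sub_le s p
      have h2 := abs_floor_div_sub_le s' p
      rw [show ((s / 2 ^ p : ℤ) : ℂ) + ((s' / 2 ^ p : ℤ) : ℂ) * Complex.I -
          ((s : ℂ) / 2 ^ p + (s' : ℂ) / 2 ^ p * Complex.I) =
          ((((s / 2 ^ p : ℤ) : ℝ) - s / 2 ^ p : ℝ) : ℂ) +
          ((((s' / 2 ^ p : ℤ) : ℝ) - s' / 2 ^ p : ℝ) : ℂ) * Complex.I by push_cast; ring]
      refine (norm_add_le _ _).trans ?_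
      rw [norm_mul, Complex.norm_I, mul_one, Complex.norm_real, Complex.norm_real,
        Real.norm_eq_abs, Real.norm_eq_abs]
      linarith
    have : ((2 ^ (d + 1) : ℕ) : ℝ) * (2 / 2 ^ p) = 2 ^ (d + 2) / 2 ^ p := by
      push_cast; rw [pow_succ _ (d + 1)]; ring
    rw [← this]
    refine le_trans ?_ hle
    rcases le_total L (2 ^ (d + 1)) with hL | hL
    · exact nrm_mono hL _
    · rw [nrm_eq_of_coeff_eq_zero hL hzero]

/-- Converts norm bounds, which the error analysis supplies, into the size condition under which the
integer arithmetic is exact. -/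
theorem CTr.all_of_nrm_le {d : ℕ} {x : CTr d} (h : nrm (2 ^ d) (x.ps p) ≤ 2 ^ p) :
    x.All fun z => |z| ≤ 2 ^ (2 * p) := by
  have key : ∀ k < 2 ^ d, ‖(x.re.coeff k : ℂ) + x.im.coeff k * Complex.I‖ ≤ 2 ^ (2 * p) := by
    intro k hk
    have := (norm_coeff_le_nrm hk (x.ps p)).trans h
    rw [CTr.coeff_ps, norm_div, norm_pow, Complex.norm_two, div_le_iff₀ (by positivity)] at this
    rwa [two_mul, pow_add]
  constructor
  · refine Tr.all_of_coeff fun k hk => ?_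
    have h1 := (Complex.abs_re_le_norm _).trans (key k hk)
    simp at h1
    exact_mod_cast h1
  · refine Tr.all_of_coeff fun k hk => ?_
    have h1 := (Complex.abs_im_le_norm _).trans (key k hk)
    simp at h1
    exact_mod_cast h1

/-- Addition in fixed point produces no rounding error at all. -/
theorem addComplex_spec (hS : Setting P b f N p B) {d : ℕ} (hp4 : 4 ≤ p) {x y : CTr d}
    (hx : nrm (2 ^ d) (x.ps p) ≤ 2 ^ p) (hy : nrm (2 ^ d) (y.ps p) ≤ 2 ^ p) :
    ∃ r : CTr d, Within P (b + 10) (complexArg x.toVal y.toVal N p) r.toVal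
        (2 ^ d * (20000 * B)) ∧ r.ps p = x.ps p + y.ps p := by
  have hP := hS.loaded
  have hN := hS.eight_le
  have hpB := hS.le_cost
  have hNp := hS.mod_le
  have hpN := hS.le_mod
  have h1 : (2 : ℤ) ^ (2 * p) ≤ 2 ^ (N - 3) := pow_le_pow_right₀ (by norm_num) (by omega)
  have h2 : (2 : ℤ) ^ (2 * p) ≤ 2 ^ N := pow_le_pow_right₀ (by norm_num) (by omega)
  have hx := CTr.all_of_nrm_le hx
  have hy := CTr.all_of_nrm_le hy
  refine ⟨⟨x.re.map₂ (lin N 0 0 0 0) y.re, x.im.map₂ (lin N 0 0 0 0) y.im⟩, ?_, ?_⟩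
  · refine within_of_wp (hP 10 (by norm_num)) ?_
    simp only [addComplex, complexArg, context, callLinear, CTr.toVal, ↓wp_rules,
      ↓shape_rules]
    refine ⟨_, _, linear_spec hP 0 hN (e := 0) (e₂ := 0) (Nat.zero_le N) (Nat.zero_le N)
      (hx.1.mono fun z hz => hz.trans h2) (hy.1.mono fun z hz => hz.trans h2),
      fun t₁ ht₁ => ?_⟩
    refine ⟨_, _, linear_spec hP 0 hN (e := 0) (e₂ := 0) (Nat.zero_le N) (Nat.zero_le N)
      (hx.2.mono fun z hz => hz.trans h2) (hy.2.mono fun z hz => hz.trans h2),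
      fun t₁ ht₁ => ?_⟩
    refine ⟨rfl, ?_⟩
    rw [bitLen_zero]
    have hq : 1 ≤ 2 ^ d := Nat.one_le_two_pow
    have hlin : (2 * 2 ^ d - 1) * (300 * N) ≤ 2 ^ d * (9600 * B) := by
      calc _ ≤ (2 * 2 ^ d) * (300 * N) := Nat.mul_le_mul_right _ (Nat.sub_le _ _)
        _ ≤ (2 * 2 ^ d) * (300 * (16 * B)) := by gcongr; omega
        _ = _ := by ring
    have hB : 1 ≤ B := by omega
    have hBq : B ≤ 2 ^ d * B := Nat.le_mul_of_pos_left _ hq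
    have e1 : 2 ^ d * (9600 * B) = 9600 * (2 ^ d * B) := by ring
    have e2 : 2 ^ d * (20000 * B) = 20000 * (2 ^ d * B) := by ring
    omega
  · ext k
    rcases le_or_gt (2 ^ d) k with hk | hk
    · rw [map_add, CTr.coeff_ps_eq_zero _ _ hk, CTr.coeff_ps_eq_zero _ _ hk,
        CTr.coeff_ps_eq_zero _ _ hk, add_zero]
    · have key : ∀ {u v : Tr d}, (u.All fun z => |z| ≤ 2 ^ (2 * p)) →
          (v.All fun z => |z| ≤ 2 ^ (2 * p)) →
          (u.map₂ (lin N 0 0 0 0) v).coeff k = u.coeff k + v.coeff k := by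
        intro u v hu hv
        rw [Tr.coeff_map₂ _ _ hk, lin_exact hN ((hu.coeff (by simp) k).trans h1)
          ((hv.coeff (by simp) k).trans h1)]
        simp
      rw [map_add, CTr.coeff_ps, CTr.coeff_ps, CTr.coeff_ps, key hx.1 hy.1, key hx.2 hy.2]
      push_cast
      ring

/-- Rounded multiplication with error bounds. -/
theorem mulComplex_spec (hS : Setting P b f N p B) {d : ℕ} (hd : 2 ^ d ∣ N)
    (hdp : 2 * d + 8 ≤ p) {x y : CTr d} (hx : nrm (2 ^ d) (x.ps p) ≤ 2 ^ p)
    (hy : nrm (2 ^ d) (y.ps p) ≤ 2 ^ p) :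
    ∃ r : CTr (d + 1), Within P (b + 8) (complexArg x.toVal y.toVal N p) r.toVal
        (2 ^ d * (d + 1) * (60000000 * B)) ∧
      ∀ L, nrm L (r.ps p - x.ps p * y.ps p) ≤ 2 ^ (d + 2) / 2 ^ p :=
  mulComplex_spec_of_all hS hd hdp (CTr.all_of_nrm_le hx) (CTr.all_of_nrm_le hy)

end
end Interp

namespace Interp
open Code

/-! ### Reciprocals of power series -/

theorem nrm_mul_sub {L : ℕ} {x y A A' : PowerSeries ℂ} {δ δ' α β : ℝ} (hx : nrm L (x - A) ≤ δ)
    (hy : nrm L (y - A') ≤ δ') (hA : nrm L A ≤ α) (hA' : nrm L A' ≤ β) :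
    nrm L (x * y - A * A') ≤ δ * (β + δ') + α * δ' := by
  have h1 : nrm L y ≤ β + δ' := by
    rw [show y = A' + (y - A') by ring]
    exact (nrm_add _ _ _).trans (add_le_add hA' hy)
  rw [show x * y - A * A' = (x - A) * y + A * (y - A') by ring]
  refine (nrm_add _ _ _).trans (add_le_add ((nrm_mul _ _ _).trans ?_) ((nrm_mul _ _ _).trans ?_))
  · exact mul_le_mul hx h1 (nrm_nonneg _ _) ((nrm_nonneg _ _).trans hx)
  · exact mul_le_mul hA hy (nrm_nonneg _ _) ((nrm_nonneg _ _).trans hA)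

/-- The power series without its first `m` coefficients. -/
noncomputable def shiftPs (m : ℕ) (A : PowerSeries ℂ) : PowerSeries ℂ :=
  PowerSeries.mk fun k => PowerSeries.coeff (k + m) A

theorem coeff_shiftPs (m : ℕ) (A : PowerSeries ℂ) (k : ℕ) :
    PowerSeries.coeff k (shiftPs m A) = PowerSeries.coeff (k + m) A := by
  rw [shiftPs, PowerSeries.coeff_mk]

theorem shiftPs_sub (m : ℕ) (A A' : PowerSeries ℂ) :
    shiftPs m (A - A') = shiftPs m A - shiftPs m A' := by
  ext k; simp [coeff_shiftPs]

theorem shiftPs_add (m : ℕ) (A A' : PowerSeries ℂ) :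
    shiftPs m (A + A') = shiftPs m A + shiftPs m A' := by
  ext k; simp [coeff_shiftPs]

theorem nrm_add_len (m m' : ℕ) (A : PowerSeries ℂ) :
    nrm (m + m') A = nrm m A + nrm m' (shiftPs m A) := by
  rw [nrm, nrm, nrm, Finset.sum_range_add]
  simp only [coeff_shiftPs, add_comm]

theorem nrm_shiftPs_le (m m' : ℕ) (A : PowerSeries ℂ) :
    nrm m' (shiftPs m A) ≤ nrm (m + m') A := by
  rw [nrm_add_len]; linarith [nrm_nonneg m A]

theorem shiftPs_node (p : ℕ) {d : ℕ} (x y : CTr d) :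
    shiftPs (2 ^ d) ((CTr.node x y).ps p) = y.ps p := by
  ext k; rw [coeff_shiftPs, CTr.coeff_ps_node_add]

theorem nrm_node_sub (p : ℕ) {d : ℕ} (x y : CTr d) (A : PowerSeries ℂ) :
    nrm (2 ^ d) (x.ps p - A) = nrm (2 ^ d) ((CTr.node x y).ps p - A) :=
  nrm_congr fun k hk => by rw [map_sub, map_sub, CTr.coeff_ps_node_lt _ _ _ hk]

theorem nrm_ps_eq (p : ℕ) {d L : ℕ} (h : 2 ^ d ≤ L) (x : CTr d) :
    nrm L (x.ps p) = nrm (2 ^ d) (x.ps p) :=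
  nrm_eq_of_coeff_eq_zero h fun _ hk => CTr.coeff_ps_eq_zero _ _ hk

/-- The upper half of `D g²` is close to that of `-h`, if `g` is close to the lower half of `-h`
and `h` is the reciprocal of `D`. -/
theorem newton_step {D h g : PowerSeries ℂ} (hDh : D * h = 1) {m : ℕ} {θ e : ℝ}
    (hg : ∀ k, m ≤ k → PowerSeries.coeff k g = 0) (hD : nrm (m + m) D ≤ θ)
    (hh : nrm (m + m) h ≤ θ) (he : nrm m (g + h) ≤ e) (he1 : e ≤ 1) (hθ : 1 ≤ θ) :
    nrm m (shiftPs m (D * (g * g) + h)) ≤ 3 * θ ^ 2 * e := by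
  -- T is the part of h from degree m on, and u, of degree below m, is the error of g as an
  -- approximation of the lower part of -h.
  set T : PowerSeries ℂ := PowerSeries.mk fun k => if k < m then 0 else PowerSeries.coeff k h
    with hT
  set u : PowerSeries ℂ := g + (h - T) with hu
  have hT0 : ∀ k < m, PowerSeries.coeff k T = 0 := fun k hk => by simp [hT, hk]
  have hT1 : ∀ k, m ≤ k → PowerSeries.coeff k T = PowerSeries.coeff k h := fun k hk => by
    simp [hT, not_lt.2 hk]
  have hu1 : ∀ k, m ≤ k → PowerSeries.coeff k u = 0 := fun k hk => by
    rw [hu, map_add, map_sub, hg k hk, hT1 k hk]; simp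
  have hT2 : ∀ k < m + m, PowerSeries.coeff k (D * (T * T)) = 0 := by
    intro k hk
    rw [PowerSeries.coeff_mul]
    refine Finset.sum_eq_zero fun ij hij => ?_
    rw [Finset.HasAntidiagonal.mem_antidiagonal] at hij
    rw [PowerSeries.coeff_mul, Finset.sum_eq_zero, mul_zero]
    intro ab hab
    rw [Finset.HasAntidiagonal.mem_antidiagonal] at hab
    rcases lt_or_ge ab.1 m with h1 | h1
    · rw [hT0 _ h1, zero_mul]
    · rw [hT0 ab.2 (by omega), mul_zero]
  -- Expansion of D(u + T - h)² with Dh = 1. Between the degrees m and 2m only D(u² + 2uT) survives: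
  -- h - T and u end below m, and T² starts at degree 2m.
  have hid : D * (g * g) + h = 2 * (h - T) - 2 * u + D * (u * u + 2 * (u * T)) + D * (T * T) := by
    rw [show g = u + T - h by rw [hu]; ring]
    linear_combination (h - 2 * u - 2 * T) * hDh
  have hnu : nrm (m + m) u ≤ e := by
    rw [nrm_eq_of_coeff_eq_zero (Nat.le_add_right m m) hu1]
    refine le_of_eq_of_le (nrm_congr fun k hk => ?_) he
    rw [hu, map_add, map_sub, hT0 k hk, sub_zero, map_add]
  have hnT : nrm (m + m) T ≤ θ := by
    refine le_trans (Finset.sum_le_sum fun k _ => ?_) hh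
    rcases lt_or_ge k m with h1 | h1
    · rw [hT0 _ h1, norm_zero]; positivity
    · rw [hT1 _ h1]
  have e0 : 0 ≤ e := (nrm_nonneg _ _).trans hnu
  have hmain : nrm (m + m) (D * (u * u + 2 * (u * T))) ≤ θ * (e * e + 2 * (e * θ)) := by
    refine (nrm_mul _ _ _).trans (mul_le_mul hD ?_ (nrm_nonneg _ _) (by linarith))
    rw [two_mul, two_mul]
    have h1 := nrm_mul (m + m) u u
    have h2 := nrm_mul (m + m) u T
    have h3 := nrm_add (m + m) (u * u) (u * T + u * T)
    have h4 := nrm_add (m + m) (u * T) (u * T)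
    have h5 := mul_le_mul hnu hnu (nrm_nonneg _ _) e0
    have h6 := mul_le_mul hnu hnT (nrm_nonneg _ _) e0
    linarith
  have heq : nrm m (shiftPs m (D * (g * g) + h)) =
      nrm m (shiftPs m (D * (u * u + 2 * (u * T)))) := by
    refine nrm_congr fun k hk => ?_
    have h2 : ∀ A : PowerSeries ℂ, PowerSeries.coeff (k + m) (2 * A) =
        2 * PowerSeries.coeff (k + m) A := fun A => by rw [two_mul, two_mul, map_add]
    rw [coeff_shiftPs, coeff_shiftPs, hid, map_add, map_add, map_sub, h2, h2, map_sub,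
      hT1 _ (Nat.le_add_left m k), hu1 _ (Nat.le_add_left m k), hT2 _ (by omega)]
    simp
  rw [heq]
  refine (nrm_shiftPs_le _ _ _).trans (hmain.trans ?_)
  have : e * e ≤ e * θ := by gcongr; linarith
  nlinarith

section
variable {P : Program} {b f N p B : ℕ}

-- Newton's iteration g ↦ 2g + Dg² for -1/D, in which g itself has no upper half, so only the upper
-- half of Dg² is computed. The error grows by at most 5θ² per doubling: 3θ² by `newton_step`, θ²
-- for the lower half, and θ² for the errors of the input and of rounding, which Λ dominates.
set_option maxHeartbeats 1000000 in
theorem negInv_spec (hS : Setting P b f N p B) {D h : PowerSeries ℂ} (hDh : D * h = 1)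
    (hh0 : PowerSeries.coeff 0 h = 1) {M : ℕ} (hM : 2 ^ M ∣ N) (hMp : 2 * M + 8 ≤ p)
    {θ δ Λ : ℝ} (hθ : 1 ≤ θ) (hD : nrm (2 ^ M) D ≤ θ) (hh : nrm (2 ^ M) h ≤ θ) (hδ1 : δ ≤ 1)
    (hΛ : 5 * θ ^ 2 * δ + 2 * θ * (2 ^ (M + 2) / 2 ^ p) ≤ Λ)
    (hΛ1 : Λ * (5 * θ ^ 2) ^ M ≤ 1) (hp : 5 * θ ^ 2 ≤ 2 ^ p)
    {d : ℕ} (hd : d ≤ M) (x : CTr d) (hx : nrm (2 ^ d) (x.ps p - D) ≤ δ) :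
    ∃ g : CTr d, Within P (b + 9) (.pair x.toVal (context N p)) g.toVal
        (2 ^ d * (d + 1) * (200000000 * B)) ∧
      nrm (2 ^ d) (g.ps p + h) ≤ Λ * (5 * θ ^ 2) ^ d := by
  have hδ : 0 ≤ δ := (nrm_nonneg _ _).trans hx
  have hΛ0 : 0 ≤ Λ := le_trans (by positivity) hΛ
  have hP := hS.loaded
  have hpB := hS.le_cost
  have hp1 := hS.one_le
  have hB : 1 ≤ B := by omega
  have hθ2 : 1 ≤ θ ^ 2 := one_le_pow₀ hθ
  induction d with
  | zero =>
    obtain ⟨r, i⟩ := x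
    cases r with | leaf r =>
    cases i with | leaf i =>
    -- As h has constant coefficient 1, the start -1 is exact whatever the input error.
    refine ⟨⟨.leaf (-2 ^ p), .leaf 0⟩, ?_, ?_⟩
    · refine within_of_wp (hP 9 (by norm_num)) ?_
      simp only [negInv, context, CTr.toVal, Tr.toVal, ↓wp_rules, ↓shape_rules]
      refine ⟨by simp, ?_⟩
      rw [bitLen_zero, bitLen_one, one_mul]
      have : bitLen (2 ^ p) ≤ p + 1 :=
        bitLen_le_of_abs_le (by rw [abs_of_nonneg (by positivity)])
      omega
    · simp [nrm, CTr.coeff_ps, Tr.coeff] at hh0 ⊢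
      rw [hh0]
      simpa using hΛ0
  | succ d ih =>
    obtain ⟨x, x', rfl⟩ := x.exists_node
    have h2 : 2 ^ (d + 1) = 2 ^ d + 2 ^ d := by ring
    have hq : 1 ≤ 2 ^ d := Nat.one_le_two_pow
    have hdM : 2 ^ (d + 1) ≤ 2 ^ M := Nat.pow_le_pow_right two_pos hd
    have hx0 : nrm (2 ^ d) (x.ps p - D) ≤ δ := by
      rw [nrm_node_sub p x x']
      exact (nrm_mono (by omega) _).trans hx
    obtain ⟨g, hg, hge⟩ := ih (by omega) x hx0
    set e := Λ * (5 * θ ^ 2) ^ d with he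
    have he0 : 0 ≤ e := by positivity
    have he1 : e ≤ 1 := by
      refine le_trans ?_ hΛ1
      exact mul_le_mul_of_nonneg_left (pow_le_pow_right₀ (by linarith) (by omega)) hΛ0
    have hD' : nrm (2 ^ (d + 1)) D ≤ θ := (nrm_mono hdM _).trans hD
    have hh' : nrm (2 ^ (d + 1)) h ≤ θ := (nrm_mono hdM _).trans hh
    have hgn : nrm (2 ^ (d + 1)) (g.ps p) ≤ θ + 1 := by
      rw [nrm_ps_eq p (by omega), show g.ps p = (g.ps p + h) - h by ring]
      refine (nrm_sub _ _ _).trans ?_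
      linarith [(nrm_mono (by omega : 2 ^ d ≤ 2 ^ (d + 1)) h).trans hh']
    have hgn' : nrm (2 ^ d) (g.ps p) ≤ 2 ^ p :=
      (nrm_mono (by omega) _).trans (hgn.trans (by nlinarith))
    obtain ⟨v, hv, hve⟩ := mulComplex_spec hS ((pow_dvd_pow 2 (by omega)).trans hM)
      (by omega : 2 * d + 8 ≤ p) hgn' hgn'
    set η : ℝ := 2 ^ (M + 2) / 2 ^ p with hη
    have hη0 : 0 ≤ η := by positivity
    have hη1 : η ≤ 1 := by
      rw [hη, div_le_one (by positivity)]
      exact pow_le_pow_right₀ (by norm_num) (by omega)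
    have hηle : ∀ k ≤ M, (2 : ℝ) ^ (k + 2) / 2 ^ p ≤ η := by
      intro k hk
      rw [hη]
      gcongr
      norm_num
    have hve' : nrm (2 ^ (d + 1)) (v.ps p - g.ps p * g.ps p) ≤ η :=
      (hve _).trans (hηle d (by omega))
    have hgg : nrm (2 ^ (d + 1)) (g.ps p * g.ps p) ≤ (θ + 1) * (θ + 1) :=
      (nrm_mul _ _ _).trans (mul_le_mul hgn hgn (nrm_nonneg _ _) (by linarith))
    have hvn : nrm (2 ^ (d + 1)) (v.ps p) ≤ 5 * θ ^ 2 := by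
      rw [show v.ps p = (v.ps p - g.ps p * g.ps p) + g.ps p * g.ps p by ring]
      refine (nrm_add _ _ _).trans ?_
      nlinarith
    have hxn : nrm (2 ^ (d + 1)) ((CTr.node x x').ps p) ≤ 2 ^ p := by
      rw [show (CTr.node x x').ps p = ((CTr.node x x').ps p - D) + D by ring]
      refine (nrm_add _ _ _).trans ?_
      nlinarith
    obtain ⟨V, hV, hVe⟩ := mulComplex_spec hS ((pow_dvd_pow 2 (by omega)).trans hM)
      (by omega : 2 * (d + 1) + 8 ≤ p) hxn (hvn.trans hp)
    obtain ⟨V₀, V₁, rfl⟩ := V.exists_node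
    obtain ⟨V₂, V₃, rfl⟩ := V₀.exists_node
    -- V has four quarters of length 2^d; the second one, V₃, holds the coefficients from 2^d to
    -- 2^(d+1) - 1.
    refine ⟨.node g V₃, ?_, ?_⟩
    · refine within_of_wp (hP 9 (by norm_num)) ?_
      simp only [negInv, context, callMulComplex, CTr.node, CTr.toVal, Tr.toVal, ↓wp_rules,
        ↓shape_rules]
      refine ⟨_, _, hg, fun t₁ ht₁ => ?_⟩
      refine ⟨_, _, hv, fun t₂ ht₂ => ?_⟩
      refine ⟨_, _, hV, fun t₃ ht₃ => ?_⟩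
      simp only [CTr.node, CTr.toVal, Tr.toVal, ↓shape_rules]
      refine ⟨trivial, ?_⟩
      have hBq : B ≤ 2 ^ d * B := Nat.le_mul_of_pos_left _ hq
      rw [pow_succ] at ht₃ ⊢
      have e1 : 2 ^ d * (d + 1) * (60000000 * B) =
        60000000 * (d * (2 ^ d * B)) + 60000000 * (2 ^ d * B) := by ring
      have e2 : 2 ^ d * 2 * (d + 1 + 1) * (60000000 * B) =
        120000000 * (d * (2 ^ d * B)) + 240000000 * (2 ^ d * B) := by ring
      have e3 : 2 ^ d * (d + 1) * (200000000 * B) =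
        200000000 * (d * (2 ^ d * B)) + 200000000 * (2 ^ d * B) := by ring
      have e4 : 2 ^ d * 2 * (d + 1 + 1) * (200000000 * B) =
        400000000 * (d * (2 ^ d * B)) + 800000000 * (2 ^ d * B) := by ring
      rw [e3] at ht₁; rw [e1] at ht₂; rw [e2] at ht₃; rw [e4]
      omega
    · rw [h2, nrm_add_len, shiftPs_add, shiftPs_node]
      have p1 : nrm (2 ^ d) ((g.node V₃).ps p + h) ≤ e := by
        have := nrm_node_sub p g V₃ (-h)
        rw [sub_neg_eq_add, sub_neg_eq_add] at this
        rwa [← this]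
      have p2 := newton_step hDh (fun k hk => CTr.coeff_ps_eq_zero p g hk) (h2 ▸ hD') (h2 ▸ hh')
        hge he1 hθ
      have p3 : nrm (2 ^ d) (V₃.ps p - shiftPs (2 ^ d) (D * (g.ps p * g.ps p))) ≤
          η + (δ * ((θ + 1) * (θ + 1) + η) + θ * η) := by
        have q1 : nrm (2 ^ (d + 1)) ((V₂.node V₃).ps p -
            (CTr.node x x').ps p * v.ps p) ≤ η := by
          rw [nrm_node_sub p (V₂.node V₃) V₁]
          exact (hVe _).trans (hηle (d + 1) (by omega))
        have q2 := nrm_mul_sub hx hve' hD' hgg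
        have q3 := nrm_add (2 ^ (d + 1)) ((V₂.node V₃).ps p - (CTr.node x x').ps p * v.ps p)
          ((CTr.node x x').ps p * v.ps p - D * (g.ps p * g.ps p))
        rw [sub_add_sub_cancel] at q3
        have q4 := nrm_shiftPs_le (2 ^ d) (2 ^ d)
          ((V₂.node V₃).ps p - D * (g.ps p * g.ps p))
        rw [shiftPs_sub, shiftPs_node, ← h2] at q4
        linarith
      have p4 := nrm_add (2 ^ d) (V₃.ps p - shiftPs (2 ^ d) (D * (g.ps p * g.ps p)))
        (shiftPs (2 ^ d) (D * (g.ps p * g.ps p) + h))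
      rw [shiftPs_add, ← add_assoc, sub_add_cancel, ← shiftPs_add] at p4
      have p5 : δ * ((θ + 1) * (θ + 1) + η) ≤ δ * (5 * θ ^ 2) := by
        gcongr; nlinarith
      have p6 : η ≤ θ * η := by nlinarith
      have p7 : Λ ≤ θ ^ 2 * e := by
        have : Λ ≤ e := by
          rw [he]
          exact le_mul_of_one_le_right hΛ0 (one_le_pow₀ (by linarith))
        nlinarith
      have p8 : e ≤ θ ^ 2 * e := by nlinarith
      have p9 : Λ * (5 * θ ^ 2) ^ (d + 1) = 5 * (θ ^ 2 * e) := by rw [he, pow_succ]; ring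
      rw [p9]
      linarith
end
end Interp

namespace Interp
open Code

/-! ### Products of linear factors -/

section
variable {α R : Type*} [CommRing R]

/-- The product of the `g i`. -/
def lprod (g : α → R) (s : List α) : R := (s.map g).prod

/-- The sum over `i` of `c i` times the product of the `g j` with `j ≠ i`. -/
def lsum (g c : α → R) : List α → R
  | [] => 0
  | a :: s => c a * lprod g s + g a * lsum g c s

theorem lprod_nil (g : α → R) : lprod g [] = 1 := rfl

theorem lprod_cons (g : α → R) (a : α) (s : List α) : lprod g (a :: s) = g a * lprod g s := by
  simp [lprod]

theorem lprod_append (g : α → R) (s t : List α) : lprod g (s ++ t) = lprod g s * lprod g t := by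
  simp [lprod]

/-- A product rule; it drives both the construction of G and the final combination A = A₁P₂ + A₂P₁.
-/
theorem lsum_append (g c : α → R) (s t : List α) :
    lsum g c (s ++ t) = lsum g c s * lprod g t + lsum g c t * lprod g s := by
  induction s with
  | nil => simp [lsum, lprod_nil]
  | cons a s ih => rw [List.cons_append, lsum, lsum, ih, lprod_append, lprod_cons]; ring

end

theorem nrm_C (L : ℕ) (a : ℂ) : nrm L (PowerSeries.C a) ≤ ‖a‖ := by
  rcases L with _ | L
  · simp [nrm]
  · rw [nrm, Finset.sum_range_succ', Finset.sum_eq_zero]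
    · simp
    · intro k _; simp

theorem nrm_one (L : ℕ) : nrm L 1 ≤ 1 := by
  have := nrm_C L 1
  simpa using this

theorem nrm_X (L : ℕ) : nrm L PowerSeries.X ≤ 1 := by
  refine (nrm_mono (Nat.le_add_right L 2) _).trans ?_
  rw [nrm, Finset.sum_range_succ', Finset.sum_range_succ', Finset.sum_eq_zero]
  · simp
  · intro k _; simp [PowerSeries.coeff_X]

theorem nrm_C_mul_X (L : ℕ) (a : ℂ) : nrm L (PowerSeries.C a * PowerSeries.X) ≤ ‖a‖ :=
  (nrm_mul _ _ _).trans ((mul_le_mul (nrm_C L a) (nrm_X L) (nrm_nonneg _ _)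
    (norm_nonneg _)).trans_eq (mul_one _))

section
variable {α : Type*}

theorem nrm_lprod_le {L : ℕ} {g : α → PowerSeries ℂ} {β : ℝ} {s : List α}
    (h : ∀ i ∈ s, nrm L (g i) ≤ β) : nrm L (lprod g s) ≤ β ^ s.length := by
  induction s with
  | nil => simpa [lprod_nil] using nrm_one L
  | cons a s ih =>
    rw [lprod_cons, List.length_cons, pow_succ']
    have h1 := h a (by simp)
    exact (nrm_mul _ _ _).trans (mul_le_mul h1 (ih fun i hi => h i (by simp [hi]))
      (nrm_nonneg _ _) ((nrm_nonneg _ _).trans h1))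

/-- Replacing β by 2β pays for the number of summands. -/
theorem nrm_lsum_le {L : ℕ} {g c : α → PowerSeries ℂ} {β γ : ℝ} {s : List α} (hβ : 1 ≤ β)
    (hγ : 0 ≤ γ) (h : ∀ i ∈ s, nrm L (g i) ≤ β) (hc : ∀ i ∈ s, nrm L (c i) ≤ γ) :
    nrm L (lsum g c s) ≤ γ * (2 * β) ^ s.length := by
  induction s with
  | nil => simpa [lsum, nrm_zero] using hγ
  | cons a s ih =>
    have h1 := h a (by simp)
    have h2 := hc a (by simp)
    have h3 := nrm_lprod_le fun i hi => h i (List.mem_cons_of_mem a hi)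
    have h4 := ih (fun i hi => h i (by simp [hi])) (fun i hi => hc i (by simp [hi]))
    have h5 : β ^ s.length ≤ β * (2 * β) ^ s.length := by
      calc _ ≤ (2 * β) ^ s.length := by gcongr; linarith
        _ ≤ _ := le_mul_of_one_le_left (by positivity) hβ
    have h6 := (nrm_mul L (c a) (lprod g s)).trans
      (mul_le_mul h2 (h3.trans h5) (nrm_nonneg _ _) hγ)
    have h7 := (nrm_mul L (g a) (lsum g c s)).trans
      (mul_le_mul h1 h4 (nrm_nonneg _ _) (by linarith))
    rw [lsum, List.length_cons, pow_succ]
    refine (nrm_add _ _ _).trans ?_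
    linarith

/-- The factor `X - x`. -/
noncomputable def fac (x : ℂ) : PowerSeries ℂ := PowerSeries.X - PowerSeries.C x

/-- The reversed factor `1 - x X`. -/
noncomputable def rfac (x : ℂ) : PowerSeries ℂ := 1 - PowerSeries.C x * PowerSeries.X

theorem nrm_fac_le (L : ℕ) {x : ℂ} {R : ℝ} (hR : 1 ≤ R) (hx : ‖x‖ ≤ R) :
    nrm L (fac x) ≤ 2 * R := by
  refine (nrm_sub _ _ _).trans ?_
  linarith [nrm_X L, nrm_C L x]

theorem nrm_rfac_le (L : ℕ) {x : ℂ} {R : ℝ} (hR : 1 ≤ R) (hx : ‖x‖ ≤ R) :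
    nrm L (rfac x) ≤ 2 * R := by
  refine (nrm_sub _ _ _).trans ?_
  linarith [nrm_one L, nrm_C_mul_X L x]

/-- The data of an instance, as the program sees it: knots `x i` of absolute value at most `R`,
known up to an error `ε`, and at most `2 ^ M` of them. -/
structure Approx (p M : ℕ) (ε R : ℝ) (x : α → ℂ) (X : α → GaussianInt) : Prop where
  one_le : 1 ≤ R
  knot : ∀ i, ‖x i‖ ≤ R
  near : ∀ i, ‖x i - dyadic p (X i)‖ ≤ ε
  prec : 1 / 2 ^ p ≤ ε
  err : ε * (32 * R) ^ 2 ^ M ≤ 1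
  size : (4 * R) ^ 2 ^ M + 1 ≤ 2 ^ p

theorem CTr.ps_pair (p : ℕ) (r r' i i' : ℤ) :
    CTr.ps p ⟨.node (.leaf r) (.leaf r'), .node (.leaf i) (.leaf i')⟩ =
      PowerSeries.C (((r : ℂ) + i * Complex.I) / 2 ^ p) +
      PowerSeries.C (((r' : ℂ) + i' * Complex.I) / 2 ^ p) * PowerSeries.X := by
  ext k
  rw [CTr.coeff_ps]
  rcases k with _ | _ | k
  · simp [Tr.coeff]
  · simp [Tr.coeff, PowerSeries.coeff_C]
  · simp [Tr.coeff, PowerSeries.coeff_succ_mul_X]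

/-- `v` represents the tree of products of the factors `X - x i` for `i` in a list of at most
`2 ^ d` entries. -/
def IsTree (p : ℕ) (ε κ : ℝ) (x : α → ℂ) (Y : α → GaussianInt) : ℕ → List α → Val → Prop
  | 0, s, v => ∃ c : CTr 1, (∀ L, nrm L (c.ps p - lprod (fun i => fac (x i)) s) ≤ ε * κ ^ 2 ^ 0) ∧
      (s = [] ∧ v = .pair c.toVal (.int 0) ∨
        ∃ i, s = [i] ∧ v = .pair c.toVal (Val.ofGauss (Y i)))
  | d + 1, s, v => ∃ c : CTr (d + 2),
      (∀ L, nrm L (c.ps p - lprod (fun i => fac (x i)) s) ≤ ε * κ ^ 2 ^ (d + 1)) ∧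
      ∃ s₁ s₂ v₁ v₂, s = s₁ ++ s₂ ∧ IsTree p ε κ x Y d s₁ v₁ ∧ IsTree p ε κ x Y d s₂ v₂ ∧
        v = .pair c.toVal (.pair v₁ v₂)

theorem IsTree.exists_root {p : ℕ} {ε κ : ℝ} {x : α → ℂ} {Y : α → GaussianInt} {d : ℕ}
    {s : List α} {v : Val} (h : IsTree p ε κ x Y d s v) : ∃ (c : CTr (d + 1)) (w : Val),
      v = .pair c.toVal w ∧
      ∀ L, nrm L (c.ps p - lprod (fun i => fac (x i)) s) ≤ ε * κ ^ 2 ^ d := by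
  cases d with
  | zero =>
    obtain ⟨c, hc, ⟨_, rfl⟩ | ⟨i, _, rfl⟩⟩ := h
    · exact ⟨c, _, rfl, hc⟩
    · exact ⟨c, _, rfl, hc⟩
  | succ d =>
    obtain ⟨c, hc, s₁, s₂, v₁, v₂, _, _, _, rfl⟩ := h
    exact ⟨c, _, rfl, hc⟩

theorem IsTree.length_le {p : ℕ} {ε κ : ℝ} {x : α → ℂ} {Y : α → GaussianInt} {d : ℕ}
    {s : List α} {v : Val} (h : IsTree p ε κ x Y d s v) : s.length ≤ 2 ^ d := by
  induction d generalizing s v with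
  | zero =>
    obtain ⟨c, hc, ⟨rfl, _⟩ | ⟨i, rfl, _⟩⟩ := h <;> simp
  | succ d ih =>
    obtain ⟨c, hc, s₁, s₂, v₁, v₂, rfl, h₁, h₂, _⟩ := h
    rw [List.length_append, pow_succ]
    linarith [ih h₁, ih h₂]

/-- One level of the error recursion, with m = 2^d and b₀ = 4R. Norms grow like β = b₀^m and errors
like K = (8b₀)^m, so K ≥ 8β and K ≥ 8m leave room for the errors of both factors and for rounding.
The leading 2 provides for a sum of two products; C₀ allows a factor of norm C₀β whose error is E
instead of ε. -/
theorem error_step {ε b₀ : ℝ} {m : ℕ} (hε : 0 ≤ ε) (hb : 1 ≤ b₀) (hm : 1 ≤ m)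
    (hδ : ε * (8 * b₀) ^ m ≤ 1) {E C₀ : ℝ} (hE : C₀ * ε ≤ E) (hE' : ε ≤ E) :
    2 * (E * (8 * b₀) ^ m * (b₀ ^ m + ε * (8 * b₀) ^ m) + C₀ * b₀ ^ m * (ε * (8 * b₀) ^ m)
      + 8 * m * ε) ≤ E * (8 * b₀) ^ (2 * m) := by
  have hE0 : 0 ≤ E := hε.trans hE'
  set K := (8 * b₀) ^ m with hK
  set β := b₀ ^ m with hβ
  have h1 : 1 ≤ β := one_le_pow₀ hb
  have h2 : 8 * β ≤ K := by
    rw [hK, mul_pow]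
    have : (8 : ℝ) ^ 1 ≤ 8 ^ m := pow_le_pow_right₀ (by norm_num) hm
    rw [pow_one] at this
    gcongr
  have h3 : (8 : ℝ) * m ≤ K := by
    rw [hK, mul_pow]
    have h4 : (8 : ℝ) * m ≤ 8 ^ m := by
      have : 8 * m ≤ 8 ^ m := by
        obtain ⟨j, rfl⟩ : ∃ j, m = j + 1 := ⟨m - 1, by omega⟩
        have : j < 8 ^ j := j.lt_pow_self (by norm_num)
        rw [pow_succ]; omega
      exact_mod_cast this
    nlinarith [show (0 : ℝ) ≤ 8 ^ m by positivity]
  have hK0 : 0 ≤ K := by linarith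
  have h5 : (8 * b₀) ^ (2 * m) = K * K := by rw [hK, two_mul, pow_add]
  rw [h5]
  have h6 : 8 * m * ε ≤ K * E := by
    calc (8 : ℝ) * m * ε ≤ K * ε := by gcongr
      _ ≤ _ := by gcongr
  have h7 : C₀ * β * (ε * K) ≤ E * K * β := by
    calc C₀ * β * (ε * K) = (C₀ * ε) * K * β := by ring
      _ ≤ _ := by gcongr
  have h8 : E * K * (β + ε * K) ≤ E * K * (β + 1) := by gcongr
  have h9 : E * K * (8 * β) ≤ E * K * K := by gcongr
  have h10 : E * K * 1 ≤ E * K * β := by gcongr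
  linarith

variable {P : Program} {b f N p B : ℕ} {M : ℕ} {ε R : ℝ} {x : α → ℂ} {X Y : α → GaussianInt}

/-- The list of pairs (knot, value). -/
def encode (X Y : α → GaussianInt) (l : List α) : Val :=
  Val.ofList (l.map fun i => .pair (Val.ofGauss (X i)) (Val.ofGauss (Y i)))

theorem Approx.pow_le (hA : Approx p M ε R x X) {k : ℕ} (hk : k ≤ 2 ^ M) :
    (4 * R) ^ k ≤ (4 * R) ^ 2 ^ M :=
  pow_le_pow_right₀ (by linarith [hA.one_le]) hk

theorem Approx.eps_nonneg (hA : Approx p M ε R x X) : 0 ≤ ε :=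
  le_trans (by positivity) hA.prec

theorem Approx.err_le (hA : Approx p M ε R x X) {k : ℕ} (hk : k ≤ 2 ^ M) :
    ε * (32 * R) ^ k ≤ 1 :=
  le_trans (mul_le_mul_of_nonneg_left (pow_le_pow_right₀ (by linarith [hA.one_le]) hk)
    hA.eps_nonneg) hA.err

theorem Approx.nrm_le (hA : Approx p M ε R x X) {d L : ℕ} (hd : d ≤ M) {A A' : PowerSeries ℂ}
    (h : nrm L (A - A') ≤ ε * (32 * R) ^ 2 ^ d) (h' : nrm L A' ≤ (4 * R) ^ 2 ^ d) :
    nrm L A ≤ 2 ^ p := by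
  have hk : 2 ^ d ≤ 2 ^ M := Nat.pow_le_pow_right two_pos hd
  have h1 := nrm_add L (A - A') A'
  rw [sub_add_cancel] at h1
  linarith [hA.err_le hk, hA.pow_le hk, hA.size]

theorem Approx.nrm_lprod_le (hA : Approx p M ε R x X) {g : ℂ → PowerSeries ℂ}
    (hg : ∀ L {z : ℂ}, ‖z‖ ≤ R → nrm L (g z) ≤ 2 * R) {s : List α} {k : ℕ} (hs : s.length ≤ k)
    (L : ℕ) : nrm L (lprod (fun i => g (x i)) s) ≤ (4 * R) ^ k := by
  have hR := hA.one_le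
  refine (Interp.nrm_lprod_le fun i _ => hg L (hA.knot i)).trans ?_
  calc (2 * R) ^ s.length ≤ (4 * R) ^ s.length := by gcongr; linarith
    _ ≤ _ := pow_le_pow_right₀ (by linarith) hs

theorem Approx.nrm_lsum_le (hA : Approx p M ε R x X) {g : ℂ → PowerSeries ℂ}
    (hg : ∀ L {z : ℂ}, ‖z‖ ≤ R → nrm L (g z) ≤ 2 * R) {s : List α} {k : ℕ} (hs : s.length ≤ k)
    (L : ℕ) {c : α → PowerSeries ℂ} {γ : ℝ} (hγ : 0 ≤ γ) (hc : ∀ i ∈ s, nrm L (c i) ≤ γ) :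
    nrm L (lsum (fun i => g (x i)) c s) ≤ γ * (4 * R) ^ k := by
  have hR := hA.one_le
  refine (Interp.nrm_lsum_le (by linarith : 1 ≤ 2 * R) hγ (fun i _ => hg L (hA.knot i)) hc).trans ?_
  rw [show 2 * (2 * R) = 4 * R by ring]
  gcongr
  linarith

/-- The error of a rounded product or of a sum of two of them. -/
theorem Approx.mul_err (hA : Approx p M ε R x X) {d L : ℕ} (hd : d + 1 ≤ M)
    {r A A' a a' : PowerSeries ℂ} (hr : nrm L (r - A * A') ≤ 2 ^ (d + 1 + 2) / 2 ^ p)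
    {E C₀ : ℝ} (hE : C₀ * ε ≤ E) (hE' : ε ≤ E)
    (hA₁ : nrm L (A - a) ≤ E * (32 * R) ^ 2 ^ d) (ha : nrm L a ≤ C₀ * (4 * R) ^ 2 ^ d)
    (hA' : nrm L (A' - a') ≤ ε * (32 * R) ^ 2 ^ d) (ha' : nrm L a' ≤ (4 * R) ^ 2 ^ d) :
    2 * nrm L (r - a * a') ≤ E * (32 * R) ^ 2 ^ (d + 1) := by
  have hR := hA.one_le
  have hk : 2 ^ d ≤ 2 ^ M := Nat.pow_le_pow_right two_pos (by omega)
  have h1 := error_step (b₀ := 4 * R) (m := 2 ^ d) hA.eps_nonneg (by linarith)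
    Nat.one_le_two_pow (by rw [show 8 * (4 * R) = 32 * R by ring]; exact hA.err_le hk) hE hE'
  rw [show 8 * (4 * R) = 32 * R by ring] at h1
  rw [pow_succ' 2 d]
  refine le_trans ?_ h1
  have h2 := nrm_mul_sub hA₁ hA' ha ha'
  have h3 := nrm_add L (r - A * A') (A * A' - a * a')
  rw [sub_add_sub_cancel] at h3
  have h4 : (2 : ℝ) ^ (d + 1 + 2) / 2 ^ p ≤ 8 * ((2 ^ d : ℕ) : ℝ) * ε := by
    calc (2 : ℝ) ^ (d + 1 + 2) / 2 ^ p = 8 * ((2 ^ d : ℕ) : ℝ) * (1 / 2 ^ p) := by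
          push_cast; rw [pow_add, pow_succ]; ring
      _ ≤ _ := by gcongr; exact hA.prec
  linarith

theorem dyadic_eq (p : ℕ) (z : GaussianInt) :
    dyadic p z = ((z.re : ℂ) + z.im * Complex.I) / 2 ^ p := by
  rw [dyadic, GaussianInt.toComplex_def]

theorem ofList_nil : Val.ofList [] = .int 0 := rfl
theorem ofList_cons (a : Val) (l : List Val) : Val.ofList (a :: l) = .pair a (Val.ofList l) := rfl

theorem bitLen_gauss_le (hA : Approx p M ε R x X) (i : α) :
    bitLen (X i).re ≤ 2 * p + 1 ∧ bitLen (X i).im ≤ 2 * p + 1 := by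
  have hR := hA.one_le
  have h1 : ‖dyadic p (X i)‖ ≤ 2 ^ p := by
    have h2 := norm_sub_le (x i) (x i - dyadic p (X i))
    rw [sub_sub_cancel] at h2
    have h3 := hA.err_le Nat.one_le_two_pow
    have h4 : R ≤ (4 * R) ^ 2 ^ M := by
      have := hA.pow_le (k := 1) Nat.one_le_two_pow
      rw [pow_one] at this
      linarith
    have h5 : ε ≤ ε * (32 * R) ^ 1 := by
      rw [pow_one]; exact le_mul_of_one_le_right hA.eps_nonneg (by linarith)
    linarith [hA.near i, hA.knot i, hA.size]
  rw [dyadic, norm_div, norm_pow, Complex.norm_two, div_le_iff₀ (by positivity), ← pow_add,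
    ← two_mul] at h1
  constructor
  · refine bitLen_le_of_abs_le ?_
    have := (Complex.abs_re_le_norm _).trans h1
    rw [← GaussianInt.intCast_re] at this
    exact_mod_cast this
  · refine bitLen_le_of_abs_le ?_
    have := (Complex.abs_im_le_norm _).trans h1
    rw [← GaussianInt.intCast_im] at this
    exact_mod_cast this

-- At every node the products of X - x_i are kept, while D and G are only passed on to the parent.
-- When the list runs out, a leaf carries the empty product 1 and the empty sum 0, so no knots are
-- needed to fill up to a power of two. The cost recurrence W(d+1) = 2W(d) + O(2^d (d + 1) B) gives
-- the square of d + 1.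
set_option maxHeartbeats 2000000 in
theorem products_spec (hS : Setting P b f N p B) (hA : Approx p M ε R x X) (hM : 2 ^ M ∣ N)
    (hMp : 2 * M + 8 ≤ p) {d : ℕ} (hd : d ≤ M) (l : List α) :
    ∃ (v : Val) (D G : CTr (d + 1)),
      Within P (b + 11) (.pair (encode X Y l) (.pair (.int d) (context N p)))
        (.pair (.pair v (.pair D.toVal G.toVal)) (encode X Y (l.drop (2 ^ d))))
        (2 ^ d * (d + 1) ^ 2 * (250000000 * B)) ∧
      IsTree p ε (32 * R) x Y d (l.take (2 ^ d)) v ∧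
      (∀ L, nrm L (D.ps p - lprod (fun i => rfac (x i)) (l.take (2 ^ d))) ≤
        ε * (32 * R) ^ 2 ^ d) ∧
      (∀ L, nrm L (G.ps p - lsum (fun i => rfac (x i)) (fun _ => -1) (l.take (2 ^ d))) ≤
        ε * (32 * R) ^ 2 ^ d) := by
  have hP := hS.loaded
  have hpB := hS.le_cost
  have hp1 := hS.one_le
  have hR := hA.one_le
  have hε := hA.eps_nonneg
  have hB : 1 ≤ B := by omega
  have hε1 : ε ≤ ε * (32 * R) ^ 2 ^ 0 := by
    rw [pow_zero, pow_one]; exact le_mul_of_one_le_right hε (by linarith)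
  have h2p : bitLen (2 ^ p) ≤ p + 1 :=
    bitLen_le_of_abs_le (by rw [abs_of_nonneg (by positivity)])
  induction d generalizing l with
  | zero =>
    cases l with
    | nil =>
      have h1 : CTr.ps p ⟨.node (.leaf (2 ^ p)) (.leaf 0), .node (.leaf 0) (.leaf 0)⟩ = 1 := by
        rw [CTr.ps_pair]; simp
      have h0 : CTr.ps p ⟨.node (.leaf 0) (.leaf 0), .node (.leaf 0) (.leaf 0)⟩ = 0 := by
        rw [CTr.ps_pair]; simp
      refine ⟨_, ⟨.node (.leaf (2 ^ p)) (.leaf 0), .node (.leaf 0) (.leaf 0)⟩,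
        ⟨.node (.leaf 0) (.leaf 0), .node (.leaf 0) (.leaf 0)⟩, ?_,
        ⟨⟨.node (.leaf (2 ^ p)) (.leaf 0), .node (.leaf 0) (.leaf 0)⟩, ?_, Or.inl ⟨rfl, rfl⟩⟩,
        ?_, ?_⟩
      · refine within_of_wp (hP 11 (by norm_num)) ?_
        simp only [products, context, encode, List.map_nil, ofList_nil, ↓wp_rules, ↓shape_rules]
        rw [if_pos (by norm_num)]
        refine ⟨by simp [CTr.toVal, Tr.toVal, ofList_nil], ?_⟩
        rw [bitLen_zero, bitLen_one, Nat.cast_zero, bitLen_zero]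
        norm_num
        omega
      · intro L
        rw [h1, List.take_nil, lprod_nil, sub_self, nrm_zero]
        positivity
      · intro L
        rw [h1, List.take_nil, lprod_nil, sub_self, nrm_zero]
        positivity
      · intro L
        rw [h0, List.take_nil, lsum, sub_self, nrm_zero]
        positivity
    | cons i l =>
      have ht : (i :: l).take (2 ^ 0) = [i] := rfl
      have h1 : CTr.ps p ⟨.node (.leaf (-(X i).re)) (.leaf (2 ^ p)),
          .node (.leaf (-(X i).im)) (.leaf 0)⟩ = fac (dyadic p (X i)) := by
        rw [CTr.ps_pair, fac, dyadic_eq, sub_eq_add_neg, ← map_neg, add_comm]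
        congr 2
        · simp
        · push_cast; ring
      have h2 : CTr.ps p ⟨.node (.leaf (2 ^ p)) (.leaf (-(X i).re)),
          .node (.leaf 0) (.leaf (-(X i).im))⟩ = rfac (dyadic p (X i)) := by
        have h2p0 : ((2 : ℂ) ^ p) ≠ 0 := pow_ne_zero _ two_ne_zero
        rw [CTr.ps_pair, rfac, dyadic_eq, sub_eq_add_neg, ← neg_mul, ← map_neg,
          show (((2 ^ p : ℤ) : ℂ) + (0 : ℤ) * Complex.I) / 2 ^ p = 1 by
            push_cast; rw [zero_mul, add_zero, div_self h2p0], map_one,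
          show (((-(X i).re : ℤ) : ℂ) + ((-(X i).im : ℤ) : ℂ) * Complex.I) / 2 ^ p =
            -((((X i).re : ℂ) + (X i).im * Complex.I) / 2 ^ p) by push_cast; ring]
      have h3 : CTr.ps p ⟨.node (.leaf (-2 ^ p)) (.leaf 0), .node (.leaf 0) (.leaf 0)⟩ = -1 := by
        rw [CTr.ps_pair]
        simp
      refine ⟨_, ⟨.node (.leaf (2 ^ p)) (.leaf (-(X i).re)), .node (.leaf 0) (.leaf (-(X i).im))⟩,
        ⟨.node (.leaf (-2 ^ p)) (.leaf 0), .node (.leaf 0) (.leaf 0)⟩, ?_,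
        ⟨⟨.node (.leaf (-(X i).re)) (.leaf (2 ^ p)), .node (.leaf (-(X i).im)) (.leaf 0)⟩, ?_,
          Or.inr ⟨i, rfl, rfl⟩⟩, ?_, ?_⟩
      · refine within_of_wp (hP 11 (by norm_num)) ?_
        simp only [products, context, encode, List.map_cons, ofList_cons, Val.ofGauss, ↓wp_rules,
          ↓shape_rules]
        rw [if_pos (by norm_num)]
        refine ⟨by simp [CTr.toVal, Tr.toVal], ?_⟩
        obtain ⟨b1, b2⟩ := bitLen_gauss_le hA i
        rw [bitLen_zero, bitLen_one, Nat.cast_zero, bitLen_zero, one_mul]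
        norm_num
        omega
      · intro L
        rw [h1]
        rw [ht, lprod_cons, lprod_nil, mul_one]
        simp only [fac]
        rw [sub_sub_sub_cancel_left, ← map_sub]
        exact (nrm_C _ _).trans ((hA.near i).trans hε1)
      · intro L
        rw [h2]
        rw [ht, lprod_cons, lprod_nil, mul_one]
        simp only [rfac]
        rw [sub_sub_sub_cancel_left, ← sub_mul, ← map_sub]
        exact (nrm_C_mul_X _ _).trans ((hA.near i).trans hε1)
      · intro L
        rw [h3]
        rw [ht, lsum, lsum, lprod_nil, mul_one, mul_zero, add_zero, sub_self, nrm_zero]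
        positivity
  | succ d ih =>
    obtain ⟨v₁, D₁, G₁, hr₁, ht₁, hD₁, hG₁⟩ := ih (by omega) l
    obtain ⟨v₂, D₂, G₂, hr₂, ht₂, hD₂, hG₂⟩ := ih (by omega) (l.drop (2 ^ d))
    have hpow : 2 ^ (d + 1) = 2 ^ d + 2 ^ d := by ring
    rw [List.drop_drop, ← hpow] at hr₂
    have htake : l.take (2 ^ (d + 1)) = l.take (2 ^ d) ++ (l.drop (2 ^ d)).take (2 ^ d) := by
      rw [hpow, List.take_add]
    rw [htake]
    have hl₁ : (l.take (2 ^ d)).length ≤ 2 ^ d := List.length_take_le _ _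
    have hl₂ : ((l.drop (2 ^ d)).take (2 ^ d)).length ≤ 2 ^ d := List.length_take_le _ _
    set s₁ := l.take (2 ^ d)
    set s₂ := (l.drop (2 ^ d)).take (2 ^ d)
    obtain ⟨c₁, w₁, rfl, hc₁⟩ := ht₁.exists_root
    obtain ⟨c₂, w₂, rfl, hc₂⟩ := ht₂.exists_root
    have hP₁ := hA.nrm_lprod_le (fun L z hz => nrm_fac_le L hR hz) hl₁
    have hP₂ := hA.nrm_lprod_le (fun L z hz => nrm_fac_le L hR hz) hl₂
    have hE₁ := hA.nrm_lprod_le (fun L z hz => nrm_rfac_le L hR hz) hl₁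
    have hE₂ := hA.nrm_lprod_le (fun L z hz => nrm_rfac_le L hR hz) hl₂
    have hc1 : ∀ L, ∀ i : α, nrm L ((fun _ => -1 : α → PowerSeries ℂ) i) ≤ 1 := fun L i => by
      simpa [nrm_neg] using nrm_one L
    have hF₁ := fun L => hA.nrm_lsum_le (fun L z hz => nrm_rfac_le L hR hz) hl₁ L zero_le_one
      (fun i _ => hc1 L i)
    have hF₂ := fun L => hA.nrm_lsum_le (fun L z hz => nrm_rfac_le L hR hz) hl₂ L zero_le_one
      (fun i _ => hc1 L i)
    simp only [one_mul] at hF₁ hF₂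
    have hdM : d ≤ M := by omega
    have hdN : 2 ^ (d + 1) ∣ N := (pow_dvd_pow 2 hd).trans hM
    have hdp : 2 * (d + 1) + 8 ≤ p := by omega
    obtain ⟨c, hc, hce⟩ := mulComplex_spec hS hdN hdp (hA.nrm_le hdM (hc₁ _) (hP₁ _))
      (hA.nrm_le hdM (hc₂ _) (hP₂ _))
    obtain ⟨D, hD, hDe⟩ := mulComplex_spec hS hdN hdp (hA.nrm_le hdM (hD₁ _) (hE₁ _))
      (hA.nrm_le hdM (hD₂ _) (hE₂ _))
    obtain ⟨G, hG, hGe⟩ := mulComplex_spec hS hdN hdp (hA.nrm_le hdM (hG₁ _) (hF₁ _))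
      (hA.nrm_le hdM (hD₂ _) (hE₂ _))
    obtain ⟨G', hG', hGe'⟩ := mulComplex_spec hS hdN hdp (hA.nrm_le hdM (hG₂ _) (hF₂ _))
      (hA.nrm_le hdM (hD₁ _) (hE₁ _))
    have ec := fun L => hA.mul_err hd (hce L) (C₀ := 1) (E := ε) (by rw [one_mul]) le_rfl (hc₁ L)
      (by rw [one_mul]; exact hP₁ L) (hc₂ L) (hP₂ L)
    have eD := fun L => hA.mul_err hd (hDe L) (C₀ := 1) (E := ε) (by rw [one_mul]) le_rfl (hD₁ L)
      (by rw [one_mul]; exact hE₁ L) (hD₂ L) (hE₂ L)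
    have eG := fun L => hA.mul_err hd (hGe L) (C₀ := 1) (E := ε) (by rw [one_mul]) le_rfl (hG₁ L)
      (by rw [one_mul]; exact hF₁ L) (hD₂ L) (hE₂ L)
    have eG' := fun L => hA.mul_err hd (hGe' L) (C₀ := 1) (E := ε) (by rw [one_mul]) le_rfl (hG₂ L)
      (by rw [one_mul]; exact hF₂ L) (hD₁ L) (hE₁ L)
    have half : ∀ {L A}, 2 * nrm L A ≤ ε * (32 * R) ^ 2 ^ (d + 1) →
        nrm L A ≤ ε * (32 * R) ^ 2 ^ (d + 1) := fun {L A} h => by linarith [nrm_nonneg L A]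
    have hmul : ∀ {L a a'}, nrm L a ≤ (4 * R) ^ 2 ^ d → nrm L a' ≤ (4 * R) ^ 2 ^ d →
        nrm L (a * a') ≤ (4 * R) ^ 2 ^ (d + 1) := fun {L a a'} h h' => by
      rw [hpow, pow_add]
      exact (nrm_mul _ _ _).trans (mul_le_mul h h' (nrm_nonneg _ _) (by positivity))
    obtain ⟨K, hK, hKe⟩ := addComplex_spec hS (by omega)
      (hA.nrm_le hd (half (eG _)) (hmul (hF₁ _) (hE₂ _)))
      (hA.nrm_le hd (half (eG' _)) (hmul (hF₂ _) (hE₁ _)))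
    refine ⟨.pair c.toVal (.pair (.pair c₁.toVal w₁) (.pair c₂.toVal w₂)), D, K, ?_,
      ⟨c, fun L => ?_, s₁, s₂, _, _, rfl, ht₁, ht₂, rfl⟩, fun L => ?_, fun L => ?_⟩
    · refine within_of_wp (hP 11 (by norm_num)) ?_
      have hcast : ((d + 1 : ℕ) : ℤ) - 1 = d := by push_cast; ring
      simp only [products, callMulComplex, callAddComplex, context, ↓wp_rules, ↓shape_rules]
      rw [if_neg (by push_cast; omega), hcast]
      refine ⟨_, _, hr₁, fun t₁ ht₁ => ?_⟩
      simp only [↓shape_rules]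
      refine ⟨_, _, hr₂, fun t₂ ht₂ => ?_⟩
      simp only [↓shape_rules]
      refine ⟨_, _, hc, fun t₃ ht₃ => ⟨_, _, hD, fun t₄ ht₄ => ⟨_, _, hG, fun t₅ ht₅ =>
        ⟨_, _, hG', fun t₆ ht₆ => ⟨_, _, hK, fun t₇ ht₇ => ⟨rfl, ?_⟩⟩⟩⟩⟩⟩
      have hb1 : bitLen ((d + 1 : ℕ) : ℤ) ≤ d + 1 := bitLen_natCast_le _
      have hb2 : bitLen (d : ℤ) ≤ d := bitLen_natCast_le _
      have hBq : B ≤ 2 ^ d * B := Nat.le_mul_of_pos_left _ (by positivity)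
      have e1 : 2 ^ d * (d + 1) ^ 2 * (250000000 * B) = 250000000 * (d * (d * (2 ^ d * B))) +
        500000000 * (d * (2 ^ d * B)) + 250000000 * (2 ^ d * B) := by ring
      have e2 : 2 ^ (d + 1) * (d + 1 + 1) * (60000000 * B) =
        120000000 * (d * (2 ^ d * B)) + 240000000 * (2 ^ d * B) := by ring
      have e3 : 2 ^ (d + 1 + 1) * (20000 * B) = 80000 * (2 ^ d * B) := by ring
      have e4 : 2 ^ (d + 1) * (d + 1 + 1) ^ 2 * (250000000 * B) =
        500000000 * (d * (d * (2 ^ d * B))) +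
        2000000000 * (d * (2 ^ d * B)) + 2000000000 * (2 ^ d * B) := by ring
      rw [e1] at ht₁ ht₂; rw [e2] at ht₃ ht₄ ht₅ ht₆; rw [e3] at ht₇; rw [e4, bitLen_one]
      omega
    · rw [lprod_append]; exact half (ec L)
    · rw [lprod_append]; exact half (eD L)
    · rw [lsum_append, hKe, add_sub_add_comm]
      linarith [nrm_add L (G.ps p - lsum (fun i => rfac (x i)) (fun _ => -1) s₁ *
        lprod (fun i => rfac (x i)) s₂) (G'.ps p - lsum (fun i => rfac (x i)) (fun _ => -1) s₂ *
        lprod (fun i => rfac (x i)) s₁), eG L, eG' L]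
end
end Interp

namespace Interp
open Code

/-! ### Mirror images, reciprocals and quotients -/

namespace Tr

/-- The leaves in the reverse order. -/
def mirror : {d : ℕ} → Tr d → Tr d
  | _, leaf z => leaf z
  | _, node x y => node y.mirror x.mirror

theorem coeff_mirror {d : ℕ} (x : Tr d) {k l : ℕ} (h : k + l + 1 = 2 ^ d) :
    x.mirror.coeff k = x.coeff l := by
  induction x generalizing k l with
  | leaf z =>
    have hk : k = 0 := by simp at h; omega
    have hl : l = 0 := by simp at h; omega
    rw [mirror, hk, hl]
  | @node d x y ihx ihy =>
    rw [pow_succ] at h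
    rw [mirror, coeff, coeff]
    split_ifs with h1 h2 h2
    · omega
    · exact ihy (by omega)
    · exact ihx (by omega)
    · omega

end Tr

section
variable {P : Program} {b f N p B : ℕ}

theorem mirror_spec (hP : Loaded P b f) {d : ℕ} (x : Tr d) :
    Within P (b + 12) x.toVal x.mirror.toVal (2 ^ d * 40 - 20) := by
  induction x with
  | leaf z =>
    refine within_of_wp (hP 12 (by norm_num)) ?_
    simp only [mirror, Tr.toVal, Tr.mirror, ↓wp_rules, ↓shape_rules]
    exact ⟨trivial, by norm_num⟩
  | @node d x y ihx ihy =>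
    refine within_of_wp (hP 12 (by norm_num)) ?_
    simp only [mirror, Tr.toVal, Tr.mirror, ↓wp_rules, ↓shape_rules]
    refine ⟨_, _, ihy, fun t ht => ⟨_, _, ihx, fun t' ht' => ⟨rfl, ?_⟩⟩⟩
    have : 1 ≤ 2 ^ d := Nat.one_le_two_pow
    rw [pow_succ]
    omega

/-- The hypotheses on the cost of the given multiplication: `m s` operations for `s` bits. -/
structure MulBound (P : Program) (f : ℕ) (m : ℕ → ℕ) : Prop where
  mulCost : ∀ s, 1 ≤ s → MulCost P f s (m s)
  le_cost : ∀ s, 1 ≤ s → s ≤ m s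
  two_mul_le : ∀ s, 1 ≤ s → 2 * m s ≤ m (2 * s)

/-- Newton's step for integers reproduces the error bound 16. With H = 2^h and ρ = 2^(2(h+5)) / (a /
2^h), cutting off the lower bits of a moves the reciprocal by at most 4, so |r - ρ| ≤ 20. The step
turns this into H(r - ρ)²/ρ ≤ 400/32, because ρ ≥ 32H, and the floor adds at most 1. -/
theorem recip_step {h : ℕ} (hh : 1 ≤ h) {a r : ℤ} (ha : 2 ^ (2 * h + 4) ≤ a)
    (ha' : a < 2 ^ (2 * h + 5))
    (hr : |(r : ℝ) - 2 ^ (2 * (h + 5)) / ((a / 2 ^ h : ℤ) : ℝ)| ≤ 16) :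
    |r| ≤ 2 ^ (h + 7) ∧
    |((r * 2 ^ (h + 1) - a * (r * r) / 2 ^ (2 * h + 10) : ℤ) : ℝ) -
      2 ^ (2 * (2 * h + 5)) / (a : ℝ)| ≤ 16 := by
  set a' : ℤ := a / 2 ^ h with ha'def
  set H : ℝ := 2 ^ h with hH
  have hH2 : 2 ≤ H := by
    calc (2 : ℝ) = 2 ^ 1 := by norm_num
      _ ≤ _ := pow_le_pow_right₀ (by norm_num) hh
  have hH0 : 0 < H := by linarith
  have p1 : (2 : ℝ) ^ (2 * h + 4) = 16 * H ^ 2 := by rw [hH]; ring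
  have p2 : (2 : ℝ) ^ (2 * h + 5) = 32 * H ^ 2 := by rw [hH]; ring
  have p3 : (2 : ℝ) ^ (2 * (h + 5)) = 1024 * H ^ 2 := by rw [hH]; ring
  have p4 : (2 : ℝ) ^ (2 * (2 * h + 5)) = 1024 * H ^ 4 := by rw [hH]; ring
  have p5 : (2 : ℝ) ^ (2 * h + 10) = 1024 * H ^ 2 := by rw [hH]; ring
  have p6 : (2 : ℝ) ^ (h + 1) = 2 * H := by rw [hH]; ring
  have p7 : (2 : ℝ) ^ (h + 7) = 128 * H := by rw [hH]; ring
  have hα : 16 * H ^ 2 ≤ (a : ℝ) := by rw [← p1]; exact_mod_cast ha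
  have hα' : (a : ℝ) < 32 * H ^ 2 := by rw [← p2]; exact_mod_cast ha'
  set α : ℝ := (a : ℝ) / H with hαdef
  have haα : (a : ℝ) = α * H := by rw [hαdef]; field_simp
  have hα1 : 16 * H ≤ α := by rw [hαdef, le_div_iff₀ hH0]; linarith
  have hα2 : α < 32 * H := by rw [hαdef, div_lt_iff₀ hH0]; linarith
  have hz0 : (0 : ℤ) < 2 ^ h := by positivity
  have ha1 : 16 * H ≤ (a' : ℝ) := by
    have : (16 * 2 ^ h : ℤ) ≤ a' := by
      rw [ha'def, Int.le_ediv_iff_mul_le hz0]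
      calc (16 * 2 ^ h * 2 ^ h : ℤ) = 2 ^ (2 * h + 4) := by ring
        _ ≤ a := ha
    rw [hH]; exact_mod_cast this
  have ha2 : (a' : ℝ) ≤ α := by
    rw [hαdef, le_div_iff₀ hH0, hH]
    exact_mod_cast Int.ediv_mul_le a hz0.ne'
  have ha3 : α ≤ a' + 1 := by
    rw [hαdef, div_le_iff₀ hH0, hH]
    have := Int.lt_ediv_add_one_mul_self a hz0
    exact_mod_cast this.le
  have hα0 : 0 < α := by linarith
  have ha0 : 0 < (a' : ℝ) := by linarith
  set ρ : ℝ := 1024 * H ^ 2 / α with hρ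
  have hρα : ρ * α = 1024 * H ^ 2 := by rw [hρ]; field_simp
  have hρ1 : 32 * H ≤ ρ := by rw [hρ, le_div_iff₀ hα0]; nlinarith
  have hρ2 : ρ ≤ 64 * H := by rw [hρ, div_le_iff₀ hα0]; nlinarith
  have hd : |(r : ℝ) - ρ| ≤ 20 := by
    have h1 : |1024 * H ^ 2 / (a' : ℝ) - ρ| ≤ 4 := by
      have : 1024 * H ^ 2 / (a' : ℝ) - ρ = 1024 * H ^ 2 * (α - a') / (a' * α) := by
        rw [hρ]; field_simp
      rw [this, abs_of_nonneg (div_nonneg (mul_nonneg (by positivity) (by linarith))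
        (by positivity)), div_le_iff₀ (by positivity)]
      have h2 : 16 * H * (16 * H) ≤ a' * α := mul_le_mul ha1 hα1 (by positivity) ha0.le
      have h3 : 1024 * H ^ 2 * (α - a') ≤ 1024 * H ^ 2 * 1 := by gcongr; linarith
      linarith
    rw [p3] at hr
    have := abs_sub_le (r : ℝ) (1024 * H ^ 2 / (a' : ℝ)) ρ
    linarith
  have hd' := abs_le.1 hd
  constructor
  · have : |(r : ℝ)| ≤ 2 ^ (h + 7) := by rw [p7, abs_le]; constructor <;> linarith
    exact_mod_cast this
  · have h1 := abs_floor_div_sub_le (a * (r * r)) (2 * h + 10)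
    rw [p5] at h1
    push_cast at h1 ⊢
    rw [p6, p4]
    have hT : 1024 * H ^ 4 / (a : ℝ) = H * ρ := by rw [haα, hρ]; field_simp
    have hq : (a : ℝ) * (r * r) / (1024 * H ^ 2) = H * (r * r) / ρ := by
      rw [haα, hρ]; field_simp
    rw [hT]
    rw [hq] at h1
    have hρ0 : 0 < ρ := by linarith
    -- The quadratic error identity of Newton's iteration, with target Hρ.
    have h2 : r * (2 * H) - H * (r * r) / ρ - H * ρ = -(H * (r - ρ) ^ 2 / ρ) := by
      field_simp; ring
    have h3 : H * (r - ρ) ^ 2 / ρ ≤ 13 := by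
      rw [div_le_iff₀ hρ0]
      have : (r - ρ) ^ 2 ≤ 400 := by
        rw [← sq_abs]; nlinarith [abs_nonneg ((r : ℝ) - ρ)]
      nlinarith
    have h4 : 0 ≤ H * (r - ρ) ^ 2 / ρ := by positivity
    rw [abs_le] at h1 ⊢
    constructor <;> linarith [h1.1, h1.2]

/-- At length 2^j, products are computed in pieces of s bits with s = 1 for j < 5 and s = 2^(j-5)
afterwards, a bounded number of them. By 2 m(s) ≤ m(2s) the later levels form a geometric sum of at
most 2 m(2^(j-5)); the early ones cost a multiple of m(1) each. Pieces of 1/32 of the length keep s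
≤ p when the length is N. -/
theorem recip_spec (hP : Loaded P b f) {m : ℕ → ℕ} (hm : MulBound P f m) (j : ℕ) (a : ℤ)
    (ha : 2 ^ (2 ^ j + 4) ≤ a) (ha' : a < 2 ^ (2 ^ j + 5)) :
    ∃ r : ℤ, Within P (b + 13) (.pair (.int (2 ^ j : ℕ)) (.int a)) (.int r)
        (30000000 * (2 * m (2 ^ (j - 5)) + min j 5 * m 1)) ∧
      |(r : ℝ) - 2 ^ (2 * (2 ^ j + 5)) / (a : ℝ)| ≤ 16 := by
  induction j generalizing a with
  | zero =>
    norm_num at ha ha'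
    -- The chord of 4096 / a through a = 32 and a = 64; its largest deviation is below 12.
    refine ⟨192 - a * 2 ^ 1, ?_, ?_⟩
    · refine within_of_wp (hP 13 (by norm_num)) ?_
      simp only [recip, ↓wp_rules, ↓shape_rules]
      rw [if_pos (by norm_num)]
      refine ⟨1, rfl, ?_⟩
      beta_reduce
      refine ⟨rfl, ?_⟩
      have b1 : bitLen 192 ≤ 192 := by exact_mod_cast bitLen_natCast_le 192
      have b2 : bitLen 2 ≤ 2 := by exact_mod_cast bitLen_natCast_le 2
      have b3 : bitLen a ≤ 6 := by rw [bitLen_le_iff, abs_of_nonneg (by omega)]; omega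
      have b4 : bitLen (a * 2 ^ 1) ≤ 7 := by rw [bitLen_le_iff, abs_of_nonneg (by omega)]; omega
      have b5 : 1 ≤ m 1 := hm.le_cost 1 le_rfl
      have b6 : bitLen ((2 ^ 0 : ℕ) : ℤ) ≤ 1 := bitLen_natCast_le _
      simp only [bitLen_one, Nat.zero_sub, pow_zero, Nat.cast_one] at b6 ⊢
      omega
    · have h0 : (0 : ℝ) < a := by exact_mod_cast (by linarith : 0 < a)
      rw [← mul_le_mul_iff_left₀ h0, ← abs_of_pos h0, ← abs_mul, abs_of_pos h0, sub_mul,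
        div_mul_cancel₀ _ h0.ne']
      have : |(192 - a * 2 ^ 1) * a - 2 ^ (2 * (2 ^ 0 + 5))| ≤ 16 * a := by
        rw [abs_le]; interval_cases a <;> norm_num
      exact_mod_cast this
  | succ j ih =>
    set h := 2 ^ j with hh
    have h1 : 1 ≤ h := Nat.one_le_two_pow
    have hk : 2 ^ (j + 1) = 2 * h := by rw [hh, pow_succ']
    rw [hk] at ha ha' ⊢
    have hz0 : (0 : ℤ) < 2 ^ h := by positivity
    obtain ⟨r, hr, hre⟩ := ih (a / 2 ^ h)
      (by
        rw [Int.le_ediv_iff_mul_le hz0]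
        calc (2 ^ (h + 4) * 2 ^ h : ℤ) = 2 ^ (2 * h + 4) := by ring
          _ ≤ a := ha)
      (by
        rw [Int.ediv_lt_iff_lt_mul hz0]
        calc a < 2 ^ (2 * h + 5) := ha'
          _ = 2 ^ (h + 5) * 2 ^ h := by ring)
    obtain ⟨hrb, he⟩ := recip_step h1 ha ha' hre
    refine ⟨_, ?_, he⟩
    refine within_of_wp (hP 13 (by norm_num)) ?_
    have hhz : ((2 * h : ℕ) : ℤ) / 2 ^ 1 = (h : ℕ) := by omega
    set s := 2 ^ (j + 1 - 5) with hs
    have hs1 : 1 ≤ s := Nat.one_le_two_pow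
    have hhs : 2 * h ≤ 32 * s := by
      rw [← hk, hs, show 32 = 2 ^ 5 by norm_num, ← pow_add]
      exact Nat.pow_le_pow_right two_pos (by omega)
    have hsm := hm.le_cost s hs1
    -- All operands have at most 2h + 14 ≤ 46s bits.
    have hmul : ∀ {u v : ℤ} {k : ℕ}, |u| ≤ 2 ^ k → |v| ≤ 2 ^ k → k ≤ 2 * h + 14 →
        Within P (b + 1) (.pair (.int s) (.pair (.int u) (.int v))) (.int (u * v))
          (12000000 * m s) := by
      intro u v k hu hv hk
      have hks : (2 : ℤ) ^ k ≤ 2 ^ (46 * s) := pow_le_pow_right₀ (by norm_num) (by omega)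
      refine (mulBoth_spec hP hs1 (hm.mulCost s hs1) 46 46 u v (hu.trans hks)
        (hv.trans hks)).mono ?_
      omega
    have hab : |a| ≤ 2 ^ (2 * h + 5) := by
      rw [abs_of_nonneg (le_trans (by positivity) ha)]; exact ha'.le
    have hrr : |r * r| ≤ 2 ^ (2 * h + 14) := by
      rw [abs_mul, show 2 * h + 14 = (h + 7) + (h + 7) by ring, pow_add]
      exact mul_le_mul hrb hrb (abs_nonneg _) (by positivity)
    have harr : |a * (r * r)| ≤ 2 ^ (2 * h + 10 + (2 * h + 9)) := by
      rw [abs_mul, show 2 * h + 10 + (2 * h + 9) = (2 * h + 5) + (2 * h + 14) by ring, pow_add]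
      exact mul_le_mul hab hrr (abs_nonneg _) (by positivity)
    have b1 := bitLen_le_of_abs_le hab
    have b2 := bitLen_le_of_abs_le hrb
    have b3 := bitLen_le_of_abs_le harr
    have b4 := bitLen_le_of_abs_le (abs_ediv_two_pow_le harr)
    have b5 : bitLen (r * 2 ^ (h + 1)) ≤ 2 * h + 8 + 1 := by
      refine bitLen_le_of_abs_le ?_
      rw [abs_mul, abs_pow, abs_two, show 2 * h + 8 = (h + 7) + (h + 1) by ring,
        pow_add 2 (h + 7)]
      exact mul_le_mul_of_nonneg_right hrb (by positivity)
    have c1 : bitLen 2 ≤ 2 := by exact_mod_cast bitLen_natCast_le 2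
    have c2 : bitLen 32 ≤ 32 := by exact_mod_cast bitLen_natCast_le 32
    have c3 : bitLen 5 ≤ 5 := by exact_mod_cast bitLen_natCast_le 5
    have c4 : bitLen 10 ≤ 10 := by exact_mod_cast bitLen_natCast_le 10
    have c5 := bitLen_natCast_le h
    have c6 := bitLen_natCast_le (2 * h)
    have c7 := bitLen_natCast_le (h + h)
    have c8 := bitLen_natCast_le (2 * h + 10)
    push_cast at c6 c7 c8
    have hcost : 30000000 * (2 * m (2 ^ (j - 5)) + min j 5 * m 1) + 30000000 * m s ≤
        30000000 * (2 * m s + min (j + 1) 5 * m 1) := by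
      by_cases hj : 5 ≤ j
      · have h2 := hm.two_mul_le (2 ^ (j - 5)) Nat.one_le_two_pow
        rw [← pow_succ', show j - 5 + 1 = j + 1 - 5 by omega, ← hs] at h2
        rw [min_eq_right hj, min_eq_right (by omega)]
        omega
      · have h2 : s = 1 := by rw [hs, show j + 1 - 5 = 0 by omega, pow_zero]
        rw [h2, min_eq_left (by omega), min_eq_left (by omega), show j - 5 = 0 by omega, pow_zero]
        exact le_of_eq (by ring)
    have d1 : ((h : ℕ) : ℤ) + 1 = ((h + 1 : ℕ) : ℤ) := by push_cast; ring
    have d2 : ((h : ℕ) : ℤ) + h + 10 = ((2 * h + 10 : ℕ) : ℤ) := by push_cast; ring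
    simp only [recip, ↓wp_rules, ↓shape_rules]
    rw [if_neg (by push_cast; omega)]
    refine ⟨1, rfl, ?_⟩
    beta_reduce
    rw [hhz]
    refine ⟨h, rfl, ?_⟩
    beta_reduce
    refine ⟨_, _, hr, fun t₁ ht₁ => ?_⟩
    simp only [↓shape_rules]
    split_ifs with hlt
    · have h2 : s = 1 := by
        have : j + 1 < 5 := by
          rw [← Nat.pow_lt_pow_iff_right (a := 2) (by norm_num), hk]
          push_cast at hlt; omega
        rw [hs, show j + 1 - 5 = 0 by omega, pow_zero]
      rw [h2, Nat.cast_one] at hmul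
      refine ⟨h + 1, d1.symm, ?_⟩
      beta_reduce
      refine ⟨_, _, hmul hrb hrb (by omega), fun t₂ ht₂ => ?_⟩
      refine ⟨_, _, hmul (hab.trans (pow_le_pow_right₀ (by norm_num) (by omega))) hrr le_rfl,
        fun t₃ ht₃ => ?_⟩
      simp only [↓shape_rules]
      refine ⟨2 * h + 10, d2.symm, rfl, ?_⟩
      push_cast
      rw [bitLen_one]
      rw [h2] at hcost hsm hhs ⊢
      omega
    · have h2 : ((2 * h : ℕ) : ℤ) / 2 ^ 5 = s := by
        have : 5 ≤ j + 1 := by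
          rw [← Nat.pow_le_pow_iff_right (a := 2) (by norm_num), hk]
          push_cast at hlt; omega
        have h3 : 2 * h = 2 ^ 5 * s := by
          rw [← hk, hs, ← pow_add]
          congr 1; omega
        rw [h3]; push_cast
        exact Int.mul_ediv_cancel_left _ (by norm_num)
      refine ⟨5, rfl, ?_⟩
      beta_reduce
      rw [h2]
      refine ⟨h + 1, d1.symm, ?_⟩
      beta_reduce
      refine ⟨_, _, hmul hrb hrb (by omega), fun t₂ ht₂ => ?_⟩
      refine ⟨_, _, hmul (hab.trans (pow_le_pow_right₀ (by norm_num) (by omega))) hrr le_rfl,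
        fun t₃ ht₃ => ?_⟩
      simp only [↓shape_rules]
      refine ⟨2 * h + 10, d2.symm, rfl, ?_⟩
      push_cast
      rw [bitLen_one]
      omega

end
end Interp

/-! ### Division of complex numbers in fixed point -/

namespace Interp
open Code

section
variable {P : Program} {b f N p B : ℕ}

/-- Reciprocals of integers of `N + 5` bits are computed in `O(B)` operations. -/
def HasRecip (P : Program) (b N B : ℕ) : Prop :=
  ∀ a : ℤ, 2 ^ (N + 4) ≤ a → a < 2 ^ (N + 5) →
    ∃ r : ℤ, Within P (b + 13) (.pair (.int N) (.int a)) (.int r) (210000000 * B) ∧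
      |(r : ℝ) - 2 ^ (2 * (N + 5)) / (a : ℝ)| ≤ 16

/-- Here r is 2^(w+e)/u up to 16, so that z r / 2^(w+e-p) is 2^p z/u up to 16 |z| / 2^(w+e-p). This
is at most 2^(3p+6-w) ≤ 1, and the floor adds at most 1. -/
theorem quotient_error {w e p : ℕ} (hpw : 3 * p + 6 ≤ w) {u z r : ℤ} (hu : 1 ≤ u) (hue : u < 2 ^ e)
    (hz : |z| ≤ 2 ^ (2 * p + 2) * u)
    (hr : |(r : ℝ) - 2 ^ (2 * w) / ((u * 2 ^ (w - e) : ℤ) : ℝ)| ≤ 16) (hew : e ≤ w) :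
    |((z * r / 2 ^ (w + e - p) : ℤ) : ℝ) - 2 ^ p * (z / u)| ≤ 2 := by
  have h1 := abs_floor_div_sub_le (z * r) (w + e - p)
  have hu0 : (0 : ℝ) < u := by exact_mod_cast hu
  have hT : (2 : ℝ) ^ (2 * w) / ((u * 2 ^ (w - e) : ℤ) : ℝ) = 2 ^ (w + e) / u := by
    push_cast
    rw [div_eq_div_iff (by positivity) (by positivity), ← mul_assoc, mul_right_comm, ← pow_add]
    congr 2
    omega
  rw [hT] at hr
  have hK : (2 : ℝ) ^ (w + e) = 2 ^ (w + e - p) * 2 ^ p := by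
    rw [← pow_add]; congr 1; omega
  have h2 : |((z * r : ℤ) : ℝ) / 2 ^ (w + e - p) - 2 ^ p * (z / u)| ≤ 1 := by
    have : ((z * r : ℤ) : ℝ) / 2 ^ (w + e - p) - 2 ^ p * (z / u) =
        z / 2 ^ (w + e - p) * (r - 2 ^ (w + e) / u) := by
      rw [hK]; push_cast; field_simp
    rw [this, abs_mul, abs_div, abs_of_nonneg (by positivity : (0 : ℝ) ≤ 2 ^ (w + e - p))]
    have hz' : |(z : ℝ)| ≤ 2 ^ (2 * p + 2) * 2 ^ e := by
      have : |z| ≤ 2 ^ (2 * p + 2) * 2 ^ e :=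
        hz.trans (mul_le_mul_of_nonneg_left hue.le (by positivity))
      exact_mod_cast this
    calc _ ≤ (2 : ℝ) ^ (2 * p + 2) * 2 ^ e / 2 ^ (w + e - p) * 16 := by gcongr
      _ = 2 ^ (2 * p + 6 + e) / 2 ^ (w + e - p) := by
        rw [pow_add _ (2 * p + 6), pow_add, pow_add _ _ 6]; ring
      _ ≤ 1 := by
        rw [div_le_one (by positivity)]
        exact pow_le_pow_right₀ (by norm_num) (by omega)
  have := abs_sub_le (((z * r / 2 ^ (w + e - p) : ℤ) : ℝ)) (((z * r : ℤ) : ℝ) / 2 ^ (w + e - p))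
    (2 ^ p * (z / u))
  linarith

-- Multiplication of y by the conjugate of m, followed by a reciprocal of u = |m|², shifted exactly
-- to N + 5 bits. The only lower bound on m that is needed is m ≠ 0: as the parts of m are integers,
-- they are bounded by u, which bounds the numerators relative to u.
set_option maxHeartbeats 1000000 in
set_option maxRecDepth 4000 in
theorem divComplex_spec (hS : Setting P b f N p B) (hR : HasRecip P b N B) (hp : 4 ≤ p)
    {y₀ y₁ m₀ m₁ : ℤ} (hy₀ : |y₀| ≤ 2 ^ (2 * p)) (hy₁ : |y₁| ≤ 2 ^ (2 * p))
    (hm₀ : |m₀| ≤ 2 ^ (2 * p)) (hm₁ : |m₁| ≤ 2 ^ (2 * p)) (hm : m₀ ^ 2 + m₁ ^ 2 ≠ 0) :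
    ∃ c₀ c₁ : ℤ, Within P (b + 14) (.pair (.pair (.int y₀) (.int y₁))
        (.pair (.pair (.int m₀) (.int m₁)) (context N p))) (.pair (.int c₀) (.int c₁))
        (300000000 * B) ∧
      ‖((c₀ : ℂ) + c₁ * Complex.I) / 2 ^ p -
        ((y₀ : ℂ) + y₁ * Complex.I) / (m₀ + m₁ * Complex.I)‖ ≤ 4 / 2 ^ p := by
  have hP := hS.loaded
  have hNp := hS.mod_le
  have hpN := hS.le_mod
  have hpB := hS.le_cost
  have hle : (2 : ℤ) ^ (2 * p) ≤ 2 ^ (32 * p) := pow_le_pow_right₀ (by norm_num) (by omega)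
  have habs : ∀ {x y : ℤ}, |x| ≤ 2 ^ (2 * p) → |y| ≤ 2 ^ (2 * p) → |x * y| ≤ 2 ^ (4 * p) := by
    intro x y hx hy
    rw [abs_mul, show 4 * p = 2 * p + 2 * p by ring, pow_add]
    exact mul_le_mul hx hy (abs_nonneg _) (by positivity)
  have hp4 : (0 : ℤ) < 2 ^ (4 * p) := by positivity
  have hsucc : (2 : ℤ) ^ (4 * p + 1) = 2 * 2 ^ (4 * p) := by ring
  set u : ℤ := m₀ * m₀ + m₁ * m₁ with hu
  have hu1 : 1 ≤ u := by
    have : 0 ≤ u := by nlinarith [sq_nonneg m₀, sq_nonneg m₁]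
    have h2 : u ≠ 0 := by rw [hu, ← sq, ← sq]; exact hm
    omega
  have hub : |u| ≤ 2 ^ (4 * p + 1) := by
    rw [hsucc]; exact (abs_add_le _ _).trans (by linarith [habs hm₀ hm₀, habs hm₁ hm₁])
  set e := bitLen u with he
  have he1 : e ≤ 4 * p + 2 := bitLen_le_of_abs_le hub
  have hue : u < 2 ^ e := by
    have := bitLen_le_iff.1 (le_refl e)
    rwa [abs_of_nonneg (by omega)] at this
  have he0 : 1 ≤ e := by
    by_contra h
    have : e = 0 := by omega
    rw [this] at hue
    omega
  have hue' : 2 ^ (e - 1) ≤ u := by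
    have := lt_bitLen_iff.1 (show e - 1 < bitLen u by omega)
    rwa [abs_of_nonneg (by omega)] at this
  obtain ⟨r, hr, hre⟩ := hR (u * 2 ^ (N + 5 - e))
    (by
      rw [show N + 4 = e - 1 + (N + 5 - e) by omega, pow_add]
      gcongr)
    (by
      calc u * 2 ^ (N + 5 - e) < 2 ^ e * 2 ^ (N + 5 - e) := by gcongr
        _ = _ := by rw [← pow_add]; congr 1; omega)
  have hrb : |r| ≤ 2 ^ (N + 8) := by
    have h1 : (2 : ℝ) ^ (2 * (N + 5)) / ((u * 2 ^ (N + 5 - e) : ℤ) : ℝ) ≤ 2 ^ (N + 6) := by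
      have h2 : (2 : ℤ) ^ (N + 4) ≤ u * 2 ^ (N + 5 - e) := by
        rw [show N + 4 = e - 1 + (N + 5 - e) by omega, pow_add]
        gcongr
      have h3 : (2 : ℝ) ^ (N + 4) ≤ ((u * 2 ^ (N + 5 - e) : ℤ) : ℝ) := by exact_mod_cast h2
      rw [div_le_iff₀ (lt_of_lt_of_le (by positivity) h3)]
      calc (2 : ℝ) ^ (2 * (N + 5)) = 2 ^ (N + 6) * 2 ^ (N + 4) := by ring
        _ ≤ _ := by gcongr
    have h0 : (0 : ℝ) ≤ 2 ^ (2 * (N + 5)) / ((u * 2 ^ (N + 5 - e) : ℤ) : ℝ) := by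
      have : (0 : ℝ) < u := by exact_mod_cast (by omega : 0 < u)
      push_cast; positivity
    have h4 : (16 : ℝ) ≤ 2 ^ (N + 6) := by
      calc (16 : ℝ) = 2 ^ 4 := by norm_num
        _ ≤ _ := pow_le_pow_right₀ (by norm_num) (by omega)
    have h5 : |(r : ℝ)| ≤ 2 ^ (N + 8) := by
      rw [show (2 : ℝ) ^ (N + 8) = 4 * 2 ^ (N + 6) by ring, abs_le]
      rw [abs_le] at hre
      constructor <;> linarith [hre.1, hre.2]
    exact_mod_cast h5
  have hrb' : |r| ≤ 2 ^ (32 * p) := hrb.trans (pow_le_pow_right₀ (by norm_num) (by omega))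
  set z : ℤ := y₀ * m₀ + y₁ * m₁ with hz
  set z' : ℤ := y₁ * m₀ - y₀ * m₁ with hz'
  have hzb : |z| ≤ 2 ^ (4 * p + 1) := by
    rw [hsucc]; exact (abs_add_le _ _).trans (by linarith [habs hy₀ hm₀, habs hy₁ hm₁])
  have hzb' : |z'| ≤ 2 ^ (4 * p + 1) := by
    rw [hsucc]; exact (abs_sub _ _).trans (by linarith [habs hy₁ hm₀, habs hy₀ hm₁])
  have hle' : (2 : ℤ) ^ (4 * p + 1) ≤ 2 ^ (32 * p) := pow_le_pow_right₀ (by norm_num) (by omega)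
  -- The absolute value of an integer is at most its square.
  have hmle : |m₀| ≤ u ∧ |m₁| ≤ u := by
    have q0 : |m₀| ≤ m₀ * m₀ := by
      rw [← abs_mul_abs_self m₀]
      rcases eq_or_ne m₀ 0 with h | h
      · simp [h]
      · exact le_mul_of_one_le_left (abs_nonneg _) (Int.one_le_abs h)
    have q1 : |m₁| ≤ m₁ * m₁ := by
      rw [← abs_mul_abs_self m₁]
      rcases eq_or_ne m₁ 0 with h | h
      · simp [h]
      · exact le_mul_of_one_le_left (abs_nonneg _) (Int.one_le_abs h)
    constructor <;> nlinarith [mul_self_nonneg m₀, mul_self_nonneg m₁]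
  have hyu : ∀ {y m : ℤ}, |y| ≤ 2 ^ (2 * p) → |m| ≤ u → |y * m| ≤ 2 ^ (2 * p) * u := by
    intro y m h1 h2
    rw [abs_mul]
    exact mul_le_mul h1 h2 (abs_nonneg _) (by positivity)
  have h4u : (2 : ℤ) ^ (2 * p + 2) * u = 4 * (2 ^ (2 * p) * u) := by ring
  have hpu : 0 ≤ (2 : ℤ) ^ (2 * p) * u := by positivity
  have hzu : |z| ≤ 2 ^ (2 * p + 2) * u := by
    rw [h4u]
    exact (abs_add_le _ _).trans (by linarith [hyu hy₀ hmle.1, hyu hy₁ hmle.2])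
  have hzu' : |z'| ≤ 2 ^ (2 * p + 2) * u := by
    rw [h4u]
    exact (abs_sub _ _).trans (by linarith [hyu hy₁ hmle.1, hyu hy₀ hmle.2])
  have q₀ := quotient_error (by omega : 3 * p + 6 ≤ N + 5) hu1 hue hzu hre (by omega)
  have q₁ := quotient_error (by omega : 3 * p + 6 ≤ N + 5) hu1 hue hzu' hre (by omega)
  clear_value z z' e u
  refine ⟨z * r / 2 ^ (N + 5 + e - p), z' * r / 2 ^ (N + 5 + e - p), ?_, ?_⟩
  rotate_left
  · have hm' : (m₀ : ℂ) + m₁ * Complex.I ≠ 0 := by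
      intro h
      have h0 := congrArg Complex.re h
      have h1 := congrArg Complex.im h
      simp at h0 h1
      exact hm (by rw [h0, h1]; norm_num)
    have huc : (u : ℂ) ≠ 0 := by exact_mod_cast (by omega : u ≠ 0)
    have hdiv : ((y₀ : ℂ) + y₁ * Complex.I) / (m₀ + m₁ * Complex.I) =
        (((z / u : ℝ) : ℂ) + ((z' / u : ℝ) : ℂ) * Complex.I) := by
      rw [div_eq_iff hm']
      push_cast
      field_simp
      rw [hz, hz', hu]
      push_cast
      linear_combination (-(m₁ * (y₁ * m₀ - y₀ * m₁) : ℂ)) * Complex.I_sq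
    rw [hdiv, le_div_iff₀ (by positivity)]
    calc _ = ‖((((z * r / 2 ^ (N + 5 + e - p) : ℤ) : ℝ) - 2 ^ p * (z / u) : ℝ) : ℂ) +
        ((((z' * r / 2 ^ (N + 5 + e - p) : ℤ) : ℝ) - 2 ^ p * (z' / u) : ℝ) : ℂ) * Complex.I‖ := by
          have hn : (2 : ℝ) ^ p = ‖(2 : ℂ) ^ p‖ := by simp
          conv_lhs => rw [hn, ← norm_mul]
          congr 1
          push_cast
          field_simp
          ring
      _ ≤ 2 + 2 := by
        refine (norm_add_le _ _).trans ?_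
        rw [norm_mul, Complex.norm_I, mul_one, Complex.norm_real, Complex.norm_real]
        exact add_le_add q₀ q₁
      _ = 4 := by norm_num
  · refine within_of_wp (hP 14 (by norm_num)) ?_
    simp only [divComplex, callMul, context, ↓wp_rules, ↓shape_rules]
    refine ⟨_, _, hS.mul (hm₀.trans hle) (hm₀.trans hle), fun t₁ ht₁ => ?_⟩
    refine ⟨_, _, hS.mul (hm₁.trans hle) (hm₁.trans hle), fun t₂ ht₂ => ?_⟩
    simp only [↓shape_rules, ← hu, ← he]
    refine ⟨N + 5 - e, by push_cast [show e ≤ N + 5 by omega]; ring, ?_⟩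
    beta_reduce
    refine ⟨_, _, hr, fun t₃ ht₃ => ?_⟩
    refine ⟨_, _, hS.mul (hy₀.trans hle) (hm₀.trans hle), fun t₄ ht₄ => ?_⟩
    refine ⟨_, _, hS.mul (hy₁.trans hle) (hm₁.trans hle), fun t₅ ht₅ => ?_⟩
    simp only [↓shape_rules, ← hz]
    refine ⟨_, _, hS.mul (hzb.trans hle') hrb', fun t₆ ht₆ => ?_⟩
    simp only [↓shape_rules]
    refine ⟨N + 5 + e - p, by push_cast [show p ≤ N + 5 + e by omega]; ring, ?_⟩
    beta_reduce
    refine ⟨_, _, hS.mul (hy₁.trans hle) (hm₀.trans hle), fun t₇ ht₇ => ?_⟩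
    refine ⟨_, _, hS.mul (hy₀.trans hle) (hm₁.trans hle), fun t₈ ht₈ => ?_⟩
    simp only [↓shape_rules, ← hz']
    refine ⟨_, _, hS.mul (hzb'.trans hle') hrb', fun t₉ ht₉ => ?_⟩
    simp only [↓shape_rules]
    refine ⟨N + 5 + e - p, by push_cast [show p ≤ N + 5 + e by omega]; ring, rfl, ?_⟩
    have hbl : ∀ {x y : ℤ}, |x| ≤ 2 ^ (2 * p) → |y| ≤ 2 ^ (2 * p) →
        bitLen (x * y) ≤ 4 * p + 1 := fun hx hy => bitLen_le_of_abs_le (habs hx hy)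
    have hzr : ∀ {x : ℤ}, |x| ≤ 2 ^ (4 * p + 1) → bitLen (x * r) ≤ 4 * p + 1 + (N + 8) + 1 := by
      intro x hx
      refine bitLen_le_of_abs_le ?_
      rw [abs_mul, pow_add]
      exact mul_le_mul hx hrb (abs_nonneg _) (by positivity)
    have c1 := hbl hm₀ hm₀
    have c2 := hbl hm₁ hm₁
    have c3 := hbl hy₀ hm₀
    have c4 := hbl hy₁ hm₁
    have c5 := hbl hy₁ hm₀
    have c6 := hbl hy₀ hm₁
    have c7 := hzr hzb
    have c8 := hzr hzb'
    have k1 : bitLen 5 ≤ 5 := by exact_mod_cast bitLen_natCast_le 5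
    have k2 := bitLen_natCast_le N
    have k3 := bitLen_natCast_le (N + 5)
    have k4 := bitLen_natCast_le e
    have k5 := bitLen_natCast_le (N + 5 + e)
    have k6 := bitLen_natCast_le p
    have k7 := bitLen_natCast_le (N + 5 + e - p)
    push_cast at k3 k5
    omega
end
end Interp

namespace Interp
open Code

/-! ### Weighted power sums -/

section
variable {α : Type*}

/-- The geometric progression `w x ^ (m - 1), …, w x, w`. -/
noncomputable def geo (m : ℕ) (w x : ℂ) : PowerSeries ℂ :=
  PowerSeries.mk fun j => w * x ^ (m - 1 - j)

/-- The weighted power sums `∑ w i x i ^ k` for `k = m - 1, …, 1, 0`. -/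
noncomputable def powerSums (x w : α → ℂ) (m : ℕ) (s : List α) : PowerSeries ℂ :=
  (s.map fun i => geo m (w i) (x i)).sum

/-- The product of the `X - x i`. -/
noncomputable def nodePoly (x : α → ℂ) (s : List α) : Polynomial ℂ :=
  lprod (fun i => Polynomial.X - Polynomial.C (x i)) s

theorem coe_nodePoly (x : α → ℂ) (s : List α) :
    (nodePoly x s : PowerSeries ℂ) = lprod (fun i => fac (x i)) s := by
  induction s with
  | nil => simp [nodePoly, lprod_nil]
  | cons a s ih =>
    rw [nodePoly, lprod_cons, Polynomial.coe_mul, ← nodePoly, ih, lprod_cons, fac]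
    simp [Polynomial.coe_sub]

theorem nodePoly_append (x : α → ℂ) (s t : List α) :
    nodePoly x (s ++ t) = nodePoly x s * nodePoly x t := lprod_append _ _ _

theorem eval_nodePoly_eq_zero {x : α → ℂ} {s : List α} {i : α} (h : i ∈ s) :
    (nodePoly x s).eval (x i) = 0 := by
  obtain ⟨s₁, s₂, rfl⟩ := List.append_of_mem h
  rw [nodePoly_append, Polynomial.eval_mul, nodePoly, nodePoly, lprod_cons]
  simp

theorem natDegree_nodePoly_le (x : α → ℂ) (s : List α) : (nodePoly x s).natDegree ≤ s.length := by
  induction s with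
  | nil => simp [nodePoly, lprod_nil]
  | cons a s ih =>
    rw [nodePoly, lprod_cons, ← nodePoly, List.length_cons, add_comm]
    exact Polynomial.natDegree_mul_le.trans
      (add_le_add (Polynomial.natDegree_X_sub_C_le _) ih)

theorem norm_eval_nodePoly_le {x : α → ℂ} {R : ℝ} (hx : ∀ i, ‖x i‖ ≤ R) (s : List α) {z : ℂ}
    (hz : ‖z‖ ≤ R) : ‖(nodePoly x s).eval z‖ ≤ (2 * R) ^ s.length := by
  induction s with
  | nil => simp [nodePoly, lprod_nil]
  | cons a s ih =>
    rw [nodePoly, lprod_cons, ← nodePoly, List.length_cons, Polynomial.eval_mul, norm_mul, pow_succ']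
    have h1 : ‖(Polynomial.X - Polynomial.C (x a)).eval z‖ ≤ 2 * R := by
      rw [Polynomial.eval_sub, Polynomial.eval_X, Polynomial.eval_C]
      exact (norm_sub_le _ _).trans (by linarith [hx a])
    exact mul_le_mul h1 ih (norm_nonneg _) ((norm_nonneg _).trans h1)

/-- In a geometric progression with descending exponents, coefficient j + h - k carries x^(k + h - 1
- j); multiplying by q therefore collects x^(h-1-j) ∑ q_k x^k, that is, it evaluates q at x. The
bounds on j and on the degree ensure that no term is cut off. -/
theorem coeff_mul_geo {h j : ℕ} {q : Polynomial ℂ} (hq : q.natDegree ≤ h) (hj : j < h) (w x : ℂ) :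
    PowerSeries.coeff (j + h) ((q : PowerSeries ℂ) * geo (2 * h) w x) =
      PowerSeries.coeff j (geo h (w * q.eval x) x) := by
  rw [PowerSeries.coeff_mul, Finset.Nat.sum_antidiagonal_eq_sum_range_succ_mk, geo, geo,
    PowerSeries.coeff_mk, Polynomial.eval_eq_sum_range' (Nat.lt_succ_of_le hq), Finset.mul_sum,
    Finset.sum_mul]
  symm
  refine Finset.sum_subset_zero_on_sdiff (Finset.range_subset_range.2 (by omega)) ?_ ?_
  · intro k hk
    rw [Finset.mem_sdiff, Finset.mem_range, Finset.mem_range] at hk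
    rw [Polynomial.coeff_coe, Polynomial.coeff_eq_zero_of_natDegree_lt (by omega), zero_mul]
  · intro k hk
    rw [Finset.mem_range] at hk
    rw [Polynomial.coeff_coe, PowerSeries.coeff_mk,
      show 2 * h - 1 - (j + h - k) = k + (h - 1 - j) by omega, pow_add]
    ring

theorem coeff_mul_powerSums {h j : ℕ} {q : Polynomial ℂ} (hq : q.natDegree ≤ h) (hj : j < h)
    (x w : α → ℂ) (s : List α) :
    PowerSeries.coeff (j + h) ((q : PowerSeries ℂ) * powerSums x w (2 * h) s) =
      PowerSeries.coeff j (powerSums x (fun i => w i * q.eval (x i)) h s) := by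
  induction s with
  | nil => simp [powerSums]
  | cons a s ih =>
    rw [powerSums, List.map_cons, List.sum_cons, mul_add, map_add, ← powerSums, ih,
      coeff_mul_geo hq hj, powerSums, powerSums, List.map_cons, List.sum_cons, map_add]

theorem powerSums_append (x w : α → ℂ) (m : ℕ) (s t : List α) :
    powerSums x w m (s ++ t) = powerSums x w m s + powerSums x w m t := by
  simp [powerSums]

theorem powerSums_eq_zero {x w : α → ℂ} {m : ℕ} {s : List α} (h : ∀ i ∈ s, w i = 0) :
    powerSums x w m s = 0 := by
  rw [powerSums, List.sum_eq_zero]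
  intro a ha
  obtain ⟨i, hi, rfl⟩ := List.mem_map.1 ha
  ext j
  simp [geo, h i hi]

theorem nrm_geo_le {R : ℝ} (hR : 1 ≤ R) (m : ℕ) (w : ℂ) {x : ℂ} (hx : ‖x‖ ≤ R) :
    nrm m (geo m w x) ≤ m * (‖w‖ * R ^ m) := by
  refine nrm_le_card_mul fun k _ => ?_
  rw [geo, PowerSeries.coeff_mk, norm_mul, norm_pow]
  gcongr
  calc ‖x‖ ^ (m - 1 - k) ≤ R ^ (m - 1 - k) := by gcongr
    _ ≤ _ := pow_le_pow_right₀ hR (by omega)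

/-- The factor 4^m = 2^m · 2^m pays for the m coefficients and for the at most m summands. -/
theorem nrm_powerSums_le {R K : ℝ} (hR : 1 ≤ R) {x w : α → ℂ} (hx : ∀ i, ‖x i‖ ≤ R) {m : ℕ}
    (hK : 0 ≤ K) {s : List α} (hs : s.length ≤ m) (hw : ∀ i ∈ s, ‖w i‖ * (4 * R) ^ m ≤ K) :
    nrm m (powerSums x w m s) ≤ K := by
  have hm : (m : ℝ) ≤ 2 ^ m := by exact_mod_cast m.lt_two_pow_self.le
  have key : nrm m (powerSums x w m s) * 2 ^ m ≤ s.length * K := by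
    clear hs
    induction s with
    | nil => simp [powerSums, nrm_zero]
    | cons a s ih =>
      rw [powerSums, List.map_cons, List.sum_cons, ← powerSums, List.length_cons]
      have h1 := nrm_add m (geo m (w a) (x a)) (powerSums x w m s)
      have h2 := ih fun i hi => hw i (by simp [hi])
      have h3 : nrm m (geo m (w a) (x a)) * 2 ^ m ≤ K := by
        refine le_trans ?_ (hw a (by simp))
        calc _ ≤ m * (‖w a‖ * R ^ m) * 2 ^ m := by gcongr; exact nrm_geo_le hR m _ (hx a)
          _ ≤ 2 ^ m * (‖w a‖ * R ^ m) * 2 ^ m := by gcongr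
          _ = ‖w a‖ * (4 * R) ^ m := by
            rw [mul_pow, show (4 : ℝ) = 2 * 2 by norm_num, mul_pow]; ring
      have h4 : (0 : ℝ) < 2 ^ m := by positivity
      push_cast
      nlinarith
  have h1 : (s.length : ℝ) ≤ m := by exact_mod_cast hs
  have h2 : (s.length : ℝ) * K ≤ K * 2 ^ m := by
    rw [mul_comm]; gcongr; linarith
  exact le_of_mul_le_mul_right (key.trans h2) (by positivity)

end
end Interp

namespace Interp
open Code

/-! ### The descent -/

section
variable {α : Type*} {P : Program} {b f N p B M : ℕ} {ε R : ℝ} {x : α → ℂ} {X : α → GaussianInt}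

/-- The values `y i`, known up to an error `ε`, and the bounds for the quotients `y i / v i`. -/
structure Target (p M : ℕ) (ε R : ℝ) (y v : α → ℂ) (Y : α → GaussianInt) (ν Ψ Θ E : ℝ) : Prop where
  pos : 0 < ν
  nonneg : 0 ≤ Ψ
  lower : ∀ i, ν ≤ ‖v i‖
  value : ∀ i, ‖y i‖ ≤ Ψ
  near : ∀ i, ‖y i - dyadic p (Y i)‖ ≤ ε
  two_mul_le : 2 * Θ ≤ ν
  le_one : Θ ≤ 1
  value_size : Ψ + 1 ≤ 2 ^ p
  err : 4 * ε + 2 * ε / ν + 2 * Ψ * Θ / ν ^ 2 ≤ E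
  coef : Ψ / ν * ε ≤ E
  size : Ψ / ν * (4 * R) ^ 2 ^ M + E * (32 * R) ^ 2 ^ M ≤ 2 ^ p

theorem abs_le_of_norm_le {r i : ℤ} {p : ℕ} (h : ‖((r : ℂ) + i * Complex.I) / 2 ^ p‖ ≤ 2 ^ p) :
    |r| ≤ 2 ^ (2 * p) ∧ |i| ≤ 2 ^ (2 * p) := by
  rw [norm_div, norm_pow, Complex.norm_two, div_le_iff₀ (by positivity), ← pow_add,
    ← two_mul] at h
  have h1 := (Complex.abs_re_le_norm _).trans h
  have h2 := (Complex.abs_im_le_norm _).trans h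
  simp at h1 h2
  exact ⟨by exact_mod_cast h1, by exact_mod_cast h2⟩

theorem div_sub_div_le {y v y' v' : ℂ} {ε Θ ν Ψ : ℝ} (hν : 0 < ν) (hv : ν ≤ ‖v‖)
    (hy : ‖y‖ ≤ Ψ) (hyy : ‖y - y'‖ ≤ ε) (hvv : ‖v' - v‖ ≤ Θ) (hΘ : 2 * Θ ≤ ν) :
    v' ≠ 0 ∧ ‖y' / v' - y / v‖ ≤ 2 * ε / ν + 2 * Ψ * Θ / ν ^ 2 := by
  have h1 : ν / 2 ≤ ‖v'‖ := by
    have := norm_sub_le v' (v' - v)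
    rw [sub_sub_cancel] at this
    linarith
  have hv0 : 0 < ‖v‖ := by linarith
  have hv0' : 0 < ‖v'‖ := by linarith
  have n1 : v ≠ 0 := norm_pos_iff.1 hv0
  have n2 : v' ≠ 0 := norm_pos_iff.1 hv0'
  refine ⟨n2, ?_⟩
  have e : y' / v' - y / v = -((y - y') / v') - y * (v' - v) / (v' * v) := by
    field_simp; ring
  rw [e]
  refine (norm_sub_le _ _).trans ?_
  rw [norm_neg, norm_div, norm_div, norm_mul, norm_mul]
  have hε : 0 ≤ ε := (norm_nonneg _).trans hyy
  have hΘ0 : 0 ≤ Θ := (norm_nonneg _).trans hvv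
  have hΨ0 : 0 ≤ Ψ := (norm_nonneg _).trans hy
  refine add_le_add ?_ ?_
  · calc ‖y - y'‖ / ‖v'‖ ≤ ε / (ν / 2) := by gcongr
      _ = _ := by field_simp
  · calc ‖y‖ * ‖v' - v‖ / (‖v'‖ * ‖v‖) ≤ Ψ * Θ / (ν / 2 * ν) := by gcongr
      _ = _ := by field_simp

/-- The error of the power sums of a child. -/
theorem Approx.descend (hA : Approx p M ε R x X) {d : ℕ} {η : ℝ}
    (hη : 4 * ε * (4 * R) ^ 2 ^ M ≤ η) {w : α → ℂ} {s s' t : List α} (hs' : s'.length ≤ 2 ^ d)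
    (hsub : powerSums x (fun i => w i * (nodePoly x s').eval (x i)) (2 ^ d) s =
      powerSums x (fun i => w i * (nodePoly x s').eval (x i)) (2 ^ d) t)
    (hK : nrm (2 ^ (d + 1)) (powerSums x w (2 ^ (d + 1)) s) ≤ (4 * R) ^ 2 ^ M)
    {c Z : CTr (d + 1)}
    (hc : nrm (2 ^ (d + 1)) (c.ps p - lprod (fun i => fac (x i)) s') ≤ ε * (32 * R) ^ 2 ^ d)
    (hZ : nrm (2 ^ (d + 1)) (Z.ps p - powerSums x w (2 ^ (d + 1)) s) ≤ η)
    {q₀ q₁ : CTr d} {q₂ : CTr (d + 1)}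
    (hq : nrm (2 ^ (d + 1)) ((CTr.node (CTr.node q₀ q₁) q₂).ps p - c.ps p * Z.ps p) ≤
      2 ^ (d + 1 + 2) / 2 ^ p) :
    nrm (2 ^ d) (q₁.ps p - powerSums x (fun i => w i * (nodePoly x s').eval (x i)) (2 ^ d) t) ≤
      η * (32 * R) ^ 2 ^ d := by
  have hR := hA.one_le
  have hε := hA.eps_nonneg
  set h := 2 ^ d with hh
  have h1 : 1 ≤ h := Nat.one_le_two_pow
  have hk : 2 ^ (d + 1) = 2 * h := by rw [hh, pow_succ']
  have hPn := hA.nrm_lprod_le (fun L z hz => nrm_fac_le L hR hz) hs' (2 ^ (d + 1))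
  have e1 := nrm_mul_sub hc hZ hPn hK
  have e2 := nrm_add (2 ^ (d + 1)) ((CTr.node (CTr.node q₀ q₁) q₂).ps p - c.ps p * Z.ps p)
    (c.ps p * Z.ps p - lprod (fun i => fac (x i)) s' * powerSums x w (2 ^ (d + 1)) s)
  rw [sub_add_sub_cancel, ← nrm_node_sub] at e2
  have e3 := nrm_shiftPs_le h h ((CTr.node q₀ q₁).ps p -
    lprod (fun i => fac (x i)) s' * powerSums x w (2 ^ (d + 1)) s)
  rw [shiftPs_sub, hh, shiftPs_node, ← hh, ← two_mul, ← hk] at e3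
  -- The middle product: the second quarter of c · Z approximates the sums whose weights are
  -- multiplied by the values of the sibling's product.
  have e4 : nrm h (q₁.ps p - shiftPs h (lprod (fun i => fac (x i)) s' *
      powerSums x w (2 ^ (d + 1)) s)) =
      nrm h (q₁.ps p - powerSums x (fun i => w i * (nodePoly x s').eval (x i)) h t) := by
    refine nrm_congr fun k hk' => ?_
    rw [map_sub, map_sub, coeff_shiftPs, ← coe_nodePoly, hk,
      coeff_mul_powerSums ((natDegree_nodePoly_le _ _).trans hs') hk', hsub]
  rw [e4] at e3
  have hη0 : 0 ≤ η := le_trans (by positivity) hη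
  have hK1 : (1 : ℝ) ≤ (4 * R) ^ 2 ^ M := one_le_pow₀ (by linarith)
  set K := (4 * R) ^ 2 ^ M
  set κ := (32 * R) ^ h with hκ
  have hκ0 : 0 ≤ κ := by positivity
  have k1 : 8 * (4 * R) ^ h ≤ κ := by
    rw [hκ, show 32 * R = 8 * (4 * R) by ring, mul_pow 8]
    have : (8 : ℝ) ^ 1 ≤ 8 ^ h := pow_le_pow_right₀ (by norm_num) h1
    rw [pow_one] at this
    gcongr
  have k2 : (2 : ℝ) ^ (d + 1 + 2) / 2 ^ p ≤ κ * ε := by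
    calc (2 : ℝ) ^ (d + 1 + 2) / 2 ^ p = 8 * (h : ℝ) * (1 / 2 ^ p) := by
          rw [hh]; push_cast; rw [pow_add, pow_succ]; ring
      _ ≤ κ * ε := by
        gcongr
        · have h2 : (h : ℝ) ≤ (4 * R) ^ h := by
            calc (h : ℝ) ≤ 2 ^ h := by exact_mod_cast h.lt_two_pow_self.le
              _ ≤ _ := by gcongr; linarith
          linarith
        · exact hA.prec
  have k3 : ε ≤ 1 / 32 := by
    have := hA.err_le (Nat.one_le_two_pow (n := M))
    rw [pow_one] at this
    nlinarith
  have k4 : 4 * ε ≤ η := by nlinarith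
  have k5 : ε * κ * (K + η) ≤ κ * (η / 4) + κ * (η / 32) := by
    have : ε * (K + η) ≤ η / 4 + η / 32 := by nlinarith
    calc ε * κ * (K + η) = κ * (ε * (K + η)) := by ring
      _ ≤ κ * (η / 4 + η / 32) := by gcongr
      _ = _ := by ring
  have k6 : (4 * R) ^ h * η ≤ κ * η / 8 := by nlinarith
  have k7 : κ * ε ≤ κ * (η / 4) := by gcongr; linarith
  nlinarith [mul_nonneg hκ0 hη0]

-- The invariant is w_i P_s'(x_i) = v_i. For i in s₁ the derivative of P_{s₁}P_{s₂} at x_i is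
-- P_{s₁}'(x_i) P_{s₂}(x_i), so it passes to the child with the weight w_i P_{s₂}(x_i); at a leaf
-- the derivative is 1 and the weight is v_i itself. The bound on the weights leaves a factor
-- (4R)^(2^d) for the levels below, and the bound on η likewise leaves (32R)^(2^d).
set_option maxHeartbeats 2000000 in
theorem solve_spec (hS : Setting P b f N p B) (hRc : HasRecip P b N B) (hA : Approx p M ε R x X)
    {y v : α → ℂ} {Y : α → GaussianInt} {ν Ψ Θ E : ℝ} (hT : Target p M ε R y v Y ν Ψ Θ E)
    (hM : 2 ^ M ∣ N) (hMp : 2 * M + 8 ≤ p) {d : ℕ} (hd : d ≤ M) {s : List α} {T : Val}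
    (ht : IsTree p ε (32 * R) x Y d s T) {w : α → ℂ}
    (hw : ∀ i ∈ s, ‖w i‖ * (4 * R) ^ 2 ^ d ≤ (4 * R) ^ 2 ^ M)
    (hv : ∀ i ∈ s, w i * (nodePoly x s).derivative.eval (x i) = v i) {η : ℝ}
    (hη : 4 * ε * (4 * R) ^ 2 ^ M ≤ η) (hηΘ : η * (32 * R) ^ 2 ^ d ≤ Θ) {Z : CTr d}
    (hZ : nrm (2 ^ d) (Z.ps p - powerSums x w (2 ^ d) s) ≤ η) :
    ∃ A : CTr (d + 1),
      Within P (b + 15) (.pair T (.pair Z.toVal (context N p))) A.toVal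
        (2 ^ d * (d + 1) ^ 2 * (310000000 * B)) ∧
      ∀ L, nrm L (A.ps p - lsum (fun i => fac (x i)) (fun i => PowerSeries.C (y i / v i)) s) ≤
        E * (32 * R) ^ 2 ^ d := by
  have hP := hS.loaded
  have hpB := hS.le_cost
  have hp1 := hS.one_le
  have hR := hA.one_le
  have hε := hA.eps_nonneg
  have hB : 1 ≤ B := by omega
  have hν := hT.pos
  have hΨν : ∀ i, ‖y i / v i‖ ≤ Ψ / ν := fun i => by
    rw [norm_div]
    exact div_le_div₀ ((norm_nonneg _).trans (hT.value i)) (hT.value i) hν (hT.lower i)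
  have hη0 : ∀ {η : ℝ}, 4 * ε * (4 * R) ^ 2 ^ M ≤ η → 0 ≤ η := fun h => le_trans (by positivity) h
  have hηle : ∀ {η : ℝ} {k : ℕ}, 4 * ε * (4 * R) ^ 2 ^ M ≤ η → η * (32 * R) ^ k ≤ Θ → η ≤ Θ :=
    fun h h' => le_trans (le_mul_of_one_le_right (hη0 h) (one_le_pow₀ (by linarith))) h'
  have hnorm : ∀ {Z' : PowerSeries ℂ} {L : ℕ} {C' : PowerSeries ℂ} {η : ℝ},
      nrm L (Z' - C') ≤ η → η ≤ Θ → nrm L C' ≤ (4 * R) ^ 2 ^ M → nrm L Z' ≤ 2 ^ p := by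
    intro Z' L C' η h1 h2 h3
    have := nrm_add L (Z' - C') C'
    rw [sub_add_cancel] at this
    linarith [hA.size, hT.le_one]
  have hΘ0 : 0 ≤ Θ := (hη0 hη).trans (hηle hη hηΘ)
  have hΨ0 := hT.nonneg
  have hEε : ε ≤ E := by
    have h1 : 0 ≤ 2 * ε / ν + 2 * Ψ * Θ / ν ^ 2 := by positivity
    linarith [hT.err]
  have hE0 : 0 ≤ E := hε.trans hEε
  have hC0 : 0 ≤ Ψ / ν := by positivity
  have hres : ∀ {k : ℕ}, k ≤ M → ∀ {A' C' : PowerSeries ℂ} {L : ℕ},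
      nrm L (A' - C') ≤ E * (32 * R) ^ 2 ^ k → nrm L C' ≤ Ψ / ν * (4 * R) ^ 2 ^ k →
      nrm L A' ≤ 2 ^ p := by
    intro k hk A' C' L h1 h2
    have h3 := nrm_add L (A' - C') C'
    rw [sub_add_cancel] at h3
    have hkM : 2 ^ k ≤ 2 ^ M := Nat.pow_le_pow_right two_pos hk
    have h4 : E * (32 * R) ^ 2 ^ k ≤ E * (32 * R) ^ 2 ^ M := by gcongr; linarith
    have h5 : Ψ / ν * (4 * R) ^ 2 ^ k ≤ Ψ / ν * (4 * R) ^ 2 ^ M := by gcongr; linarith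
    linarith [hT.size]
  induction d generalizing s T w η with
  | zero =>
    obtain ⟨c, hc, ⟨rfl, rfl⟩ | ⟨i, rfl, rfl⟩⟩ := ht
    · have h0 : CTr.ps p ⟨.node (.leaf 0) (.leaf 0), .node (.leaf 0) (.leaf 0)⟩ = 0 := by
        rw [CTr.ps_pair]; simp
      refine ⟨⟨.node (.leaf 0) (.leaf 0), .node (.leaf 0) (.leaf 0)⟩, ?_, fun L => ?_⟩
      · refine within_of_wp (hP 15 (by norm_num)) ?_
        rcases Z with ⟨⟨m₀⟩, ⟨m₁⟩⟩
        simp only [solve, context, CTr.toVal, Tr.toVal, ↓wp_rules, ↓shape_rules]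
        refine ⟨trivial, ?_⟩
        rw [bitLen_zero]
        norm_num
        omega
      · rw [h0, lsum, sub_self, nrm_zero]
        positivity
    · rcases Z with ⟨⟨m₀⟩, ⟨m₁⟩⟩
      have hwi : w i = v i := by
        have := hv i (by simp)
        simpa [nodePoly, lprod_cons, lprod_nil] using this
      have hηΘ' := hηle hη hηΘ
      have hm : ‖((m₀ : ℂ) + m₁ * Complex.I) / 2 ^ p - v i‖ ≤ Θ := by
        have h1 := (norm_coeff_le_nrm (Nat.one_le_two_pow (n := 0)) _).trans hZ
        rw [map_sub, CTr.coeff_ps] at h1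
        simp [Tr.coeff, powerSums, geo, hwi] at h1
        exact h1.trans hηΘ'
      have hm' : ‖((m₀ : ℂ) + m₁ * Complex.I) / 2 ^ p‖ ≤ 2 ^ p := by
        have h1 := norm_add_le (((m₀ : ℂ) + m₁ * Complex.I) / 2 ^ p - v i) (v i)
        rw [sub_add_cancel] at h1
        have h2 := hw i (by simp)
        rw [hwi, pow_zero, pow_one] at h2
        have h3 : ‖v i‖ ≤ ‖v i‖ * (4 * R) := le_mul_of_one_le_right (norm_nonneg _) (by linarith)
        linarith [hA.size, hT.le_one]
      have hε1 : ε ≤ 1 := by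
        have := hA.err_le (Nat.zero_le _)
        rwa [pow_zero, mul_one] at this
      have hY' : ‖dyadic p (Y i)‖ ≤ 2 ^ p := by
        have h1 := norm_sub_le (y i) (y i - dyadic p (Y i))
        rw [sub_sub_cancel] at h1
        linarith [hT.value i, hT.near i, hT.value_size]
      rw [dyadic_eq] at hY'
      obtain ⟨b1, b2⟩ := abs_le_of_norm_le hm'
      obtain ⟨b3, b4⟩ := abs_le_of_norm_le hY'
      obtain ⟨n1, n2⟩ := div_sub_div_le hν (hT.lower i) (hT.value i) (hT.near i) hm hT.two_mul_le
      have n3 : m₀ ^ 2 + m₁ ^ 2 ≠ 0 := by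
        intro h
        have q0 : m₀ = 0 := by nlinarith [sq_nonneg m₀, sq_nonneg m₁]
        have q1 : m₁ = 0 := by nlinarith [sq_nonneg m₀, sq_nonneg m₁]
        exact n1 (by simp [q0, q1])
      obtain ⟨c₀, c₁, hr, hre⟩ := divComplex_spec hS hRc (by omega) b3 b4 b1 b2 n3
      have h2p : (2 : ℂ) ^ p ≠ 0 := pow_ne_zero _ two_ne_zero
      rw [dyadic_eq, div_div_div_cancel_right₀ h2p] at n2
      refine ⟨⟨.node (.leaf c₀) (.leaf 0), .node (.leaf c₁) (.leaf 0)⟩, ?_, fun L => ?_⟩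
      · refine within_of_wp (hP 15 (by norm_num)) ?_
        simp only [solve, context, CTr.toVal, Tr.toVal, Val.ofGauss, ↓wp_rules, ↓shape_rules]
        refine ⟨_, _, hr, fun t ht => ?_⟩
        simp only [↓shape_rules]
        refine ⟨trivial, ?_⟩
        rw [bitLen_zero]
        norm_num
        omega
      · rw [CTr.ps_pair, lsum, lsum, lprod_nil, mul_one, mul_zero, add_zero]
        simp only [Int.cast_zero, zero_mul, add_zero, zero_div, map_zero]
        rw [← map_sub]
        have h4 : 4 / 2 ^ p ≤ 4 * ε := by
          have := hA.prec
          rw [div_le_iff₀ (by positivity)] at this ⊢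
          linarith
        have h5 := norm_sub_le_norm_sub_add_norm_sub (((c₀ : ℂ) + c₁ * Complex.I) / 2 ^ p)
          ((((Y i).re : ℂ) + (Y i).im * Complex.I) / (m₀ + m₁ * Complex.I)) (y i / v i)
        have h6 : ‖((c₀ : ℂ) + c₁ * Complex.I) / 2 ^ p - y i / v i‖ ≤ E := by
          linarith [hT.err]
        refine (nrm_C _ _).trans (h6.trans ?_)
        exact le_mul_of_one_le_right ((norm_nonneg _).trans h6) (one_le_pow₀ (by linarith))
  | succ d ih =>
    obtain ⟨c, hc, s₁, s₂, v₁, v₂, rfl, ht₁, ht₂, rfl⟩ := ht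
    have hl₁ := ht₁.length_le
    have hl₂ := ht₂.length_le
    have hpow : 2 ^ (d + 1) = 2 ^ d + 2 ^ d := by ring
    have hdM : d ≤ M := by omega
    have hdN : 2 ^ (d + 1) ∣ N := (pow_dvd_pow 2 hd).trans hM
    have hdp : 2 * (d + 1) + 8 ≤ p := by omega
    obtain ⟨c₁, w₁, rfl, hc₁⟩ := ht₁.exists_root
    obtain ⟨c₂, w₂, rfl, hc₂⟩ := ht₂.exists_root
    have hP₁ := hA.nrm_lprod_le (fun L z hz => nrm_fac_le L hR hz) hl₁
    have hP₂ := hA.nrm_lprod_le (fun L z hz => nrm_fac_le L hR hz) hl₂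
    have hK : nrm (2 ^ (d + 1)) (powerSums x w (2 ^ (d + 1)) (s₁ ++ s₂)) ≤ (4 * R) ^ 2 ^ M :=
      nrm_powerSums_le hR hA.knot (by positivity)
        (by rw [List.length_append, hpow]; omega) hw
    have hZp := hnorm hZ (hηle hη hηΘ) hK
    obtain ⟨Q, hQ, hQe⟩ := mulComplex_spec hS hdN hdp (hA.nrm_le hdM (hc₂ _) (hP₂ _)) hZp
    obtain ⟨Q', hQ', hQe'⟩ := mulComplex_spec hS hdN hdp (hA.nrm_le hdM (hc₁ _) (hP₁ _)) hZp
    obtain ⟨q, q₂, rfl⟩ := Q.exists_node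
    obtain ⟨q₀, q₁, rfl⟩ := q.exists_node
    obtain ⟨q', q₂', rfl⟩ := Q'.exists_node
    obtain ⟨q₀', q₁', rfl⟩ := q'.exists_node
    have z₁ : ∀ i ∈ s₁, (nodePoly x s₁).eval (x i) = 0 := fun i hi => eval_nodePoly_eq_zero hi
    have z₂ : ∀ i ∈ s₂, (nodePoly x s₂).eval (x i) = 0 := fun i hi => eval_nodePoly_eq_zero hi
    -- Multiplying by the product over s₂ makes the weights of s₂ vanish, leaving only s₁; below,
    -- the roles are exchanged.
    have hZ₁ := hA.descend hη hl₂ (t := s₁)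
      (by rw [powerSums_append, powerSums_eq_zero (s := s₂) fun i hi => by rw [z₂ i hi, mul_zero],
        add_zero]) hK (hc₂ _) hZ (hQe _)
    have hZ₂ := hA.descend hη hl₁ (t := s₂)
      (by rw [powerSums_append, powerSums_eq_zero (s := s₁) fun i hi => by rw [z₁ i hi, mul_zero],
        zero_add]) hK (hc₁ _) hZ (hQe' _)
    have hwt : ∀ {t : List α}, t.length ≤ 2 ^ d → ∀ i ∈ s₁ ++ s₂,
        ‖w i * (nodePoly x t).eval (x i)‖ * (4 * R) ^ 2 ^ d ≤ (4 * R) ^ 2 ^ M := by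
      intro t ht i hi
      refine le_trans ?_ (hw i hi)
      rw [norm_mul, hpow, pow_add, ← mul_assoc]
      gcongr
      refine (norm_eval_nodePoly_le hA.knot t (hA.knot i)).trans ?_
      calc (2 * R) ^ t.length ≤ (4 * R) ^ t.length := by gcongr; linarith
        _ ≤ _ := pow_le_pow_right₀ (by linarith) ht
    have hη' : 4 * ε * (4 * R) ^ 2 ^ M ≤ η * (32 * R) ^ 2 ^ d :=
      hη.trans (le_mul_of_one_le_right (hη0 hη) (one_le_pow₀ (by linarith)))
    -- Half of the exponent 2^(d+1) is spent at this level, the other half remains for the subtree.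
    have hηΘ' : η * (32 * R) ^ 2 ^ d * (32 * R) ^ 2 ^ d ≤ Θ := by
      rw [mul_assoc, ← pow_add, ← hpow]; exact hηΘ
    obtain ⟨A₁, hr₁, hA₁⟩ := ih hdM ht₁ (fun i hi => hwt hl₂ i (by simp [hi]))
      (fun i hi => by
        rw [← hv i (by simp [hi]), nodePoly_append, Polynomial.derivative_mul, Polynomial.eval_add,
          Polynomial.eval_mul, Polynomial.eval_mul, z₁ i hi]
        ring) hη' hηΘ' hZ₁
    obtain ⟨A₂, hr₂, hA₂⟩ := ih hdM ht₂ (fun i hi => hwt hl₁ i (by simp [hi]))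
      (fun i hi => by
        rw [← hv i (by simp [hi]), nodePoly_append, Polynomial.derivative_mul, Polynomial.eval_add,
          Polynomial.eval_mul, Polynomial.eval_mul, z₂ i hi]
        ring) hη' hηΘ' hZ₂
    have hF : ∀ {t : List α}, t.length ≤ 2 ^ d → ∀ L, nrm L (lsum (fun i => fac (x i))
        (fun i => PowerSeries.C (y i / v i)) t) ≤ Ψ / ν * (4 * R) ^ 2 ^ d := fun ht L =>
      hA.nrm_lsum_le (fun L z hz => nrm_fac_le L hR hz) ht L hC0
        fun i _ => (nrm_C L _).trans (hΨν i)
    obtain ⟨G, hG, hGe⟩ := mulComplex_spec hS hdN hdp (hres hdM (hA₁ _) (hF hl₁ _))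
      (hA.nrm_le hdM (hc₂ _) (hP₂ _))
    obtain ⟨G', hG', hGe'⟩ := mulComplex_spec hS hdN hdp (hres hdM (hA₂ _) (hF hl₂ _))
      (hA.nrm_le hdM (hc₁ _) (hP₁ _))
    have eG := fun L => hA.mul_err hd (hGe L) hT.coef hEε (hA₁ L) (hF hl₁ L) (hc₂ L) (hP₂ L)
    have eG' := fun L => hA.mul_err hd (hGe' L) hT.coef hEε (hA₂ L) (hF hl₂ L) (hc₁ L) (hP₁ L)
    have half : ∀ {L A}, 2 * nrm L A ≤ E * (32 * R) ^ 2 ^ (d + 1) →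
        nrm L A ≤ E * (32 * R) ^ 2 ^ (d + 1) := fun {L A} h => by linarith [nrm_nonneg L A]
    have hmul : ∀ {L a a'}, nrm L a ≤ Ψ / ν * (4 * R) ^ 2 ^ d → nrm L a' ≤ (4 * R) ^ 2 ^ d →
        nrm L (a * a') ≤ Ψ / ν * (4 * R) ^ 2 ^ (d + 1) := fun {L a a'} h h' => by
      rw [hpow, pow_add, ← mul_assoc]
      exact (nrm_mul _ _ _).trans (mul_le_mul h h' (nrm_nonneg _ _) (by positivity))
    obtain ⟨K, hK', hKe⟩ := addComplex_spec hS (by omega)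
      (hres hd (half (eG _)) (hmul (hF hl₁ _) (hP₂ _)))
      (hres hd (half (eG' _)) (hmul (hF hl₂ _) (hP₁ _)))
    refine ⟨K, ?_, fun L => ?_⟩
    · refine within_of_wp (hP 15 (by norm_num)) ?_
      obtain ⟨z₀, z₁, rfl⟩ := Z.exists_node
      simp only [solve, callMulComplex, callAddComplex, context, ↓wp_rules, ↓shape_rules]
      simp only [CTr.toVal, CTr.node, Tr.toVal, ↓shape_rules]
      refine ⟨_, _, hQ, fun t₁ ht₁ => ?_⟩
      simp only [CTr.toVal, CTr.node, Tr.toVal, ↓shape_rules]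
      refine ⟨_, _, hr₁, fun t₂ ht₂ => ?_⟩
      refine ⟨_, _, hQ', fun t₃ ht₃ => ?_⟩
      simp only [CTr.toVal, CTr.node, Tr.toVal, ↓shape_rules]
      refine ⟨_, _, hr₂, fun t₄ ht₄ => ?_⟩
      refine ⟨_, _, hG, fun t₅ ht₅ => ⟨_, _, hG', fun t₆ ht₆ => ⟨_, _, hK', fun t₇ ht₇ =>
        ⟨rfl, ?_⟩⟩⟩⟩
      have hBq : B ≤ 2 ^ d * B := Nat.le_mul_of_pos_left _ (by positivity)
      have e1 : 2 ^ d * (d + 1) ^ 2 * (310000000 * B) = 310000000 * (d * (d * (2 ^ d * B))) +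
        620000000 * (d * (2 ^ d * B)) + 310000000 * (2 ^ d * B) := by ring
      have e2 : 2 ^ (d + 1) * (d + 1 + 1) * (60000000 * B) =
        120000000 * (d * (2 ^ d * B)) + 240000000 * (2 ^ d * B) := by ring
      have e3 : 2 ^ (d + 1 + 1) * (20000 * B) = 80000 * (2 ^ d * B) := by ring
      have e4 : 2 ^ (d + 1) * (d + 1 + 1) ^ 2 * (310000000 * B) =
        620000000 * (d * (d * (2 ^ d * B))) +
        2480000000 * (d * (2 ^ d * B)) + 2480000000 * (2 ^ d * B) := by ring
      rw [e1] at ht₂ ht₄; rw [e2] at ht₁ ht₃ ht₅ ht₆; rw [e3] at ht₇; rw [e4]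
      omega
    · rw [lsum_append, hKe, add_sub_add_comm]
      refine (nrm_add _ _ _).trans ?_
      linarith [eG L, eG' L]
end
end Interp

namespace Interp
open Code

/-! ### The reciprocal of the product of the reversed factors -/

section
variable {α : Type*}

/-- The power series `∑ x ^ k X ^ k`. -/
noncomputable def pows (x : ℂ) : PowerSeries ℂ := PowerSeries.mk fun k => x ^ k

theorem rfac_mul_pows (x : ℂ) : rfac x * pows x = 1 := by
  ext k
  rw [rfac, sub_mul, one_mul, mul_assoc, map_sub, pows, PowerSeries.coeff_mk,
    PowerSeries.coeff_C_mul]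
  cases k with
  | zero => simp
  | succ k =>
    rw [PowerSeries.coeff_succ_X_mul, PowerSeries.coeff_mk, ← pow_succ', sub_self,
      PowerSeries.coeff_one, if_neg (by omega)]

theorem lprod_rfac_mul (x : α → ℂ) (s : List α) :
    lprod (fun i => rfac (x i)) s * lprod (fun i => pows (x i)) s = 1 := by
  induction s with
  | nil => simp [lprod_nil]
  | cons a s ih =>
    rw [lprod_cons, lprod_cons, mul_mul_mul_comm, rfac_mul_pows, ih, one_mul]

theorem coeff_zero_lprod_pows (x : α → ℂ) (s : List α) :
    PowerSeries.coeff 0 (lprod (fun i => pows (x i)) s) = 1 := by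
  induction s with
  | nil => simp [lprod_nil]
  | cons a s ih =>
    rw [PowerSeries.coeff_zero_eq_constantCoeff_apply] at ih ⊢
    rw [lprod_cons, map_mul, ih, mul_one, ← PowerSeries.coeff_zero_eq_constantCoeff_apply, pows,
      PowerSeries.coeff_mk, pow_zero]

/-- Dividing the sum of the products with one factor omitted by the whole product leaves ∑ 1/(1 -
x_i X), the generating function of the power sums. The two signs cancel; they match a G built with
-1 and the negative reciprocal. -/
theorem lsum_rfac_mul (x : α → ℂ) (s : List α) :
    lsum (fun i => rfac (x i)) (fun _ => -1) s * -lprod (fun i => pows (x i)) s =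
      (s.map fun i => pows (x i)).sum := by
  induction s with
  | nil => simp [lsum]
  | cons a s ih =>
    rw [lsum, lprod_cons, List.map_cons, List.sum_cons, ← ih]
    linear_combination pows (x a) * lprod_rfac_mul x s -
      (lsum (fun i => rfac (x i)) (fun _ => -1) s * lprod (fun i => pows (x i)) s) *
        rfac_mul_pows (x a)

theorem nrm_rescale_pows_le (L : ℕ) {x : ℂ} {R : ℝ} (hR : 1 ≤ R) (hx : ‖x‖ ≤ R) :
    nrm L (PowerSeries.rescale (((2 * R : ℝ) : ℂ)⁻¹) (pows x)) ≤ 2 := by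
  have h : ∀ k, ‖PowerSeries.coeff k (PowerSeries.rescale (((2 * R : ℝ) : ℂ)⁻¹) (pows x))‖ ≤
      (1 / 2) ^ k := by
    intro k
    rw [PowerSeries.coeff_rescale, pows, PowerSeries.coeff_mk, ← mul_pow, norm_pow]
    gcongr
    rw [norm_mul, norm_inv, Complex.norm_real, Real.norm_of_nonneg (by linarith),
      inv_mul_le_iff₀ (by linarith)]
    linarith
  refine (Finset.sum_le_sum fun k _ => h k).trans ?_
  rw [geom_sum_eq (by norm_num)]
  have : (0 : ℝ) ≤ (1 / 2) ^ L := by positivity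
  rw [div_le_iff_of_neg (by norm_num)]
  linarith

/-- The substitution of X / (2R) for X turns each geometric series into one of norm at most 2;
undoing it on L coefficients costs (2R)^L. -/
theorem nrm_lprod_pows_le {x : α → ℂ} {R : ℝ} (hR : 1 ≤ R) (hx : ∀ i, ‖x i‖ ≤ R) {s : List α}
    {L : ℕ} (hs : s.length ≤ L) : nrm L (lprod (fun i => pows (x i)) s) ≤ (4 * R) ^ L := by
  have h0 : ((2 * R : ℝ) : ℂ) ≠ 0 := by
    exact_mod_cast (by linarith : (2 * R) ≠ 0)
  have h1 : nrm L (PowerSeries.rescale (((2 * R : ℝ) : ℂ)⁻¹) (lprod (fun i => pows (x i)) s)) ≤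
      2 ^ L := by
    have h2 := nrm_lprod_le (L := L) (s := s)
      (g := fun i => PowerSeries.rescale (((2 * R : ℝ) : ℂ)⁻¹) (pows (x i))) (β := 2)
      fun i _ => nrm_rescale_pows_le L hR (hx i)
    have h3 : PowerSeries.rescale (((2 * R : ℝ) : ℂ)⁻¹) (lprod (fun i => pows (x i)) s) =
        lprod (fun i => PowerSeries.rescale (((2 * R : ℝ) : ℂ)⁻¹) (pows (x i))) s := by
      rw [lprod, lprod, map_list_prod, List.map_map]; rfl
    rw [h3]
    exact h2.trans (pow_le_pow_right₀ (by norm_num) hs)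
  rw [show 4 * R = 2 * R * 2 by ring, mul_pow]
  refine le_trans ?_ (mul_le_mul_of_nonneg_left h1 (by positivity))
  rw [nrm, nrm, Finset.mul_sum]
  refine Finset.sum_le_sum fun k hk => ?_
  rw [PowerSeries.coeff_rescale, norm_mul, norm_pow, norm_inv, Complex.norm_real,
    Real.norm_of_nonneg (by linarith), ← mul_assoc]
  refine le_mul_of_one_le_left (norm_nonneg _) ?_
  rw [inv_pow, ← div_eq_mul_inv, one_le_div (by positivity)]
  exact pow_le_pow_right₀ (by linarith) (Finset.mem_range.1 hk).le

/-! ### The interpolating polynomial -/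

theorem lsum_fac_eq (x c : α → ℂ) (s : List α) :
    lsum (fun i => fac (x i)) (fun i => PowerSeries.C (c i)) s =
      (lsum (fun i => Polynomial.X - Polynomial.C (x i)) (fun i => Polynomial.C (c i)) s :
        Polynomial ℂ) := by
  induction s with
  | nil => simp [lsum]
  | cons a s ih =>
    rw [lsum, lsum, ih, ← coe_nodePoly, Polynomial.coe_add, Polynomial.coe_mul, Polynomial.coe_mul,
      nodePoly, fac]
    simp [Polynomial.coe_sub]

theorem degree_lsum_lt (x c : α → ℂ) (s : List α) :
    (lsum (fun i => Polynomial.X - Polynomial.C (x i)) (fun i => Polynomial.C (c i)) s).degree <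
      s.length := by
  induction s with
  | nil => simp [lsum]
  | cons a s ih =>
    rw [lsum, List.length_cons]
    refine (Polynomial.degree_add_le _ _).trans_lt (max_lt ?_ ?_)
    · rw [← Polynomial.smul_eq_C_mul]
      refine (Polynomial.degree_smul_le _ _).trans_lt ?_
      refine (Polynomial.degree_le_natDegree.trans
        (Nat.cast_le.2 (natDegree_nodePoly_le x s))).trans_lt ?_
      exact_mod_cast Nat.lt_succ_self _
    · rw [Polynomial.degree_mul, Polynomial.degree_X_sub_C, add_comm]
      push_cast
      exact WithBot.add_lt_add_right (by simp) ih

theorem eval_lsum (x c : α → ℂ) {s : List α} {i : α} (hi : i ∈ s) :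
    (lsum (fun i => Polynomial.X - Polynomial.C (x i)) (fun i => Polynomial.C (c i)) s).eval (x i) =
      c i * (nodePoly x s).derivative.eval (x i) := by
  induction s with
  | nil => simp at hi
  | cons a s ih =>
    rw [lsum, nodePoly, lprod_cons, Polynomial.derivative_mul, ← nodePoly]
    simp only [Polynomial.eval_add, Polynomial.eval_mul, Polynomial.eval_sub, Polynomial.eval_X,
      Polynomial.eval_C, Polynomial.derivative_sub, Polynomial.derivative_X,
      Polynomial.derivative_C, sub_zero, one_mul]
    rcases List.mem_cons.1 hi with rfl | hi
    · ring
    · rw [ih hi, eval_nodePoly_eq_zero hi]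
      ring

/-- At x_i only the summand i survives and has the value c_i P'(x_i); the degree is below n, so
uniqueness of the interpolating polynomial applies. -/
theorem lsum_eq_interpolate {n : ℕ} {x y : Fin n → ℂ} (hx : Function.Injective x)
    (hv : ∀ i, (nodePoly x (List.finRange n)).derivative.eval (x i) ≠ 0) :
    lsum (fun i => fac (x i)) (fun i => PowerSeries.C
      (y i / (nodePoly x (List.finRange n)).derivative.eval (x i))) (List.finRange n) =
      (Lagrange.interpolate Finset.univ x y : Polynomial ℂ) := by
  rw [lsum_fac_eq]
  congr 1
  refine Lagrange.eq_interpolate_of_eval_eq y hx.injOn ?_ fun i _ => ?_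
  · have := degree_lsum_lt x
      (fun i => y i / (nodePoly x (List.finRange n)).derivative.eval (x i)) (List.finRange n)
    simpa using this
  · rw [eval_lsum x _ (List.mem_finRange i), div_mul_cancel₀ _ (hv i)]

end

/-! ### Lists -/

section
variable {P : Program} {b f : ℕ}

/-- The accumulator l avoids concatenations and keeps the cost linear in the number of leaves. -/
theorem flatten_spec (hP : Loaded P b f) {d : ℕ} (x y : Tr d) (l : List Val) :
    Within P (b + 16) (.pair x.toVal (.pair y.toVal (Val.ofList l)))
      (Val.ofList ((List.range (2 ^ d)).map
        (fun k => .pair (.int (x.coeff k)) (.int (y.coeff k))) ++ l)) (2 ^ d * 80 - 40) := by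
  induction x generalizing l with
  | leaf z =>
    cases y with | leaf z' =>
    refine within_of_wp (hP 16 (by norm_num)) ?_
    simp only [flatten, Tr.toVal, ↓wp_rules, ↓shape_rules]
    exact ⟨by simp [Val.ofList, Tr.coeff], by norm_num⟩
  | @node d x x' ih ih' =>
    cases y with | node y y' =>
    refine within_of_wp (hP 16 (by norm_num)) ?_
    simp only [flatten, Tr.toVal, ↓wp_rules, ↓shape_rules]
    refine ⟨_, _, ih' y' l, fun t ht => ⟨_, _, ih y _, fun t' ht' => ⟨?_, ?_⟩⟩⟩
    · rw [pow_succ, mul_two, List.range_add, List.map_append, List.append_assoc, List.map_map]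
      congr 2
      · refine List.map_congr_left fun k hk => ?_
        rw [List.mem_range] at hk
        rw [Tr.coeff_node_lt _ _ hk, Tr.coeff_node_lt _ _ hk]
      · congr 1
        refine List.map_congr_left fun k hk => ?_
        rw [Function.comp, add_comm (2 ^ d) k, Tr.coeff_node_add, Tr.coeff_node_add]
    · have : 1 ≤ 2 ^ d := Nat.one_le_two_pow
      rw [pow_succ]
      omega

/-- Used to cut the list of 2^(M+1) computed coefficients to n entries, with the input list as the
measure. -/
theorem takeLike_spec (hP : Loaded P b f) (l l' : List Val) (h : l.length ≤ l'.length) :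
    Within P (b + 17) (.pair (Val.ofList l) (Val.ofList l')) (Val.ofList (l'.take l.length))
      (20 * (l.length + 1)) := by
  induction l generalizing l' with
  | nil =>
    refine within_of_wp (hP 17 (by norm_num)) ?_
    simp only [takeLike, ofList_nil, ↓wp_rules, ↓shape_rules]
    exact ⟨by simp [ofList_nil], by rw [bitLen_zero]; norm_num⟩
  | cons a l ih =>
    cases l' with
    | nil => simp at h
    | cons a' l' =>
      refine within_of_wp (hP 17 (by norm_num)) ?_
      simp only [takeLike, ofList_cons, ↓wp_rules, ↓shape_rules]
      refine ⟨_, _, ih l' (by simpa using h), fun t ht => ⟨rfl, ?_⟩⟩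
      rw [List.length_cons]
      omega

theorem length_spec (hP : Loaded P b f) {p : ℕ} (l : List Val) (h : l.length < 2 ^ p) :
    Within P (b + 18) (Val.ofList l) (.int l.length) ((l.length + 1) * (p + 20)) := by
  induction l with
  | nil =>
    refine within_of_wp (hP 18 (by norm_num)) ?_
    simp only [length, ofList_nil, ↓wp_rules, ↓shape_rules]
    exact ⟨rfl, by rw [bitLen_zero]; simp⟩
  | cons a l ih =>
    rw [List.length_cons] at h ⊢
    refine within_of_wp (hP 18 (by norm_num)) ?_
    simp only [length, ofList_cons, ↓wp_rules, ↓shape_rules]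
    refine ⟨_, _, ih (by omega), fun t ht => ?_⟩
    simp only [↓shape_rules]
    refine ⟨by push_cast; rw [add_comm], ?_⟩
    have h1 : bitLen (l.length : ℤ) ≤ p := by
      rw [bitLen_le_iff, abs_of_nonneg (by positivity)]
      exact_mod_cast (by omega : l.length < 2 ^ p)
    rw [bitLen_one]
    have : (l.length + 1 + 1) * (p + 20) = (l.length + 1) * (p + 20) + p + 20 := by ring
    omega

end
end Interp

namespace Interp
open Code

/-! ### The interpolation program -/

section
variable {P : Program} {b f N p B M n : ℕ} {ε R : ℝ}

/-- The leaves in the reverse order. -/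
def CTr.mirror {d : ℕ} (x : CTr d) : CTr d := ⟨x.re.mirror, x.im.mirror⟩

theorem nrm_mirror_sub (p : ℕ) {α : Type*} (x : α → ℂ) (s : List α) {d : ℕ} (S : CTr d) :
    nrm (2 ^ d) (S.mirror.ps p - powerSums x (fun _ => 1) (2 ^ d) s) =
      nrm (2 ^ d) (S.ps p - (s.map fun i => pows (x i)).sum) := by
  rw [nrm, nrm, ← Finset.sum_range_reflect]
  refine Finset.sum_congr rfl fun k hk => ?_
  rw [Finset.mem_range] at hk
  rw [map_sub, map_sub]
  congr 2
  · rw [CTr.coeff_ps, CTr.coeff_ps, CTr.mirror,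
      Tr.coeff_mirror (l := k) _ (by omega), Tr.coeff_mirror (l := k) _ (by omega)]
  · rw [powerSums, map_list_sum, map_list_sum, List.map_map, List.map_map]
    congr 1
    refine List.map_congr_left fun i _ => ?_
    simp only [Function.comp, geo, pows, PowerSeries.coeff_mk, one_mul]
    congr 1
    omega

/-- The accuracy of the denominators. -/
noncomputable def denomErr (M : ℕ) (ε R : ℝ) : ℝ :=
  26 * ((4 * R) ^ 2 ^ M) ^ 3 * ((32 * R) ^ 2 ^ M) ^ 2 * (5 * ((4 * R) ^ 2 ^ M) ^ 2) ^ M * ε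

-- The error passes through four stages: δ = εκ for D and G, γ for the negative reciprocal, 2θγ for
-- the power sums, and 2θγκ = `denomErr` for the denominators at the leaves. After the division it
-- is E, and the recombination multiplies it by κ.
set_option maxHeartbeats 2000000 in
set_option maxRecDepth 4000 in
theorem interpolation_spec (hS : Setting P b f N p B) (hRc : HasRecip P b N B)
    (hN : N = 2 ^ (bitLen p + 3)) (hM : bitLen n = M) (hM1 : 1 ≤ M) (hMN : 2 ^ M ∣ N)
    (hMp : 2 * M + 8 ≤ p) {x y : Fin n → ℂ} {X Y : Fin n → GaussianInt}
    (hA : Approx p M ε R x X) {ν Ψ E : ℝ}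
    (hT : Target p M ε R y (fun i => (nodePoly x (List.finRange n)).derivative.eval (x i)) Y
      ν Ψ (denomErr M ε R) E) (hx : Function.Injective x) (ℓ : ℕ) :
    ∃ A : Fin n → GaussianInt,
      Within P (b + 19) (interpInput ℓ p X Y)
        (Val.ofList (List.ofFn fun j => Val.ofGauss (A j)))
        (2 ^ M * (M + 1) ^ 2 * (1000000000 * B)) ∧
      ∀ j : Fin n, ‖(Lagrange.interpolate Finset.univ x y).coeff j - dyadic p (A j)‖ ≤
        E * (32 * R) ^ 2 ^ M := by
  have hP := hS.loaded
  have hpB := hS.le_cost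
  have hp1 := hS.one_le
  have hR := hA.one_le
  have hε := hA.eps_nonneg
  have hB : 1 ≤ B := by omega
  have hn : n ≤ 2 ^ M := by
    have := abs_le_of_bitLen_le hM.le
    rw [abs_of_nonneg (by positivity)] at this
    exact_mod_cast this
  set l := List.finRange n with hl
  have hll : l.length = n := List.length_finRange
  have htake : l.take (2 ^ M) = l := List.take_of_length_le (by omega)
  obtain ⟨T, D, G, hr, ht, hD, hG⟩ := products_spec (Y := Y) hS hA hMN hMp le_rfl l
  rw [htake] at ht hD hG
  obtain ⟨D₀, D₁, rfl⟩ := D.exists_node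
  obtain ⟨G₀, G₁, rfl⟩ := G.exists_node
  have hD₀ := hD (2 ^ M)
  rw [← nrm_node_sub] at hD₀
  have hG₀ := hG (2 ^ M)
  rw [← nrm_node_sub] at hG₀
  have bD := hA.nrm_lprod_le (fun L z hz => nrm_rfac_le L hR hz) (by omega : l.length ≤ 2 ^ M)
    (2 ^ M)
  have bG : nrm (2 ^ M) (lsum (fun i => rfac (x i)) (fun _ => -1) l) ≤ (4 * R) ^ 2 ^ M := by
    have := hA.nrm_lsum_le (fun L z hz => nrm_rfac_le L hR hz) (by omega : l.length ≤ 2 ^ M)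
      (2 ^ M) zero_le_one (c := fun _ => -1) (fun i _ => by simpa [nrm_neg] using nrm_one (2 ^ M))
    rwa [one_mul] at this
  have bh := nrm_lprod_pows_le hR hA.knot (by omega : l.length ≤ 2 ^ M)
  set θ := (4 * R) ^ 2 ^ M with hθ
  set κ := (32 * R) ^ 2 ^ M with hκ
  set h := lprod (fun i => pows (x i)) l with hh
  have hθ1 : 1 ≤ θ := one_le_pow₀ (by linarith)
  have hκ1 : 1 ≤ κ := one_le_pow₀ (by linarith)
  have hδ1 : ε * κ ≤ 1 := hA.err
  have hMκ : (2 : ℝ) ^ M ≤ κ := by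
    calc (2 : ℝ) ^ M ≤ 2 ^ 2 ^ M := pow_le_pow_right₀ (by norm_num) M.lt_two_pow_self.le
      _ ≤ _ := by rw [hκ]; gcongr; linarith
  set q := (5 * θ ^ 2) ^ M with hq
  have hθ2 : 1 ≤ θ ^ 2 := one_le_pow₀ hθ1
  have hq1 : 5 * θ ^ 2 ≤ q := le_self_pow₀ (by linarith) (by omega)
  have hΘ : denomErr M ε R = 26 * θ ^ 3 * κ ^ 2 * q * ε := rfl
  have hΘ1 := hT.le_one
  rw [hΘ] at hΘ1
  set γ := 13 * θ ^ 2 * (ε * κ) * q with hγ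
  have hγ0 : 0 ≤ γ := by positivity
  have hγΘ : 2 * θ * γ * κ = denomErr M ε R := by rw [hΘ, hγ]; ring
  have hγ1 : γ ≤ 1 := by
    rw [← hγΘ] at hT
    have h1 := hT.le_one
    have h2 : γ ≤ 2 * θ * γ * κ := by
      calc γ = 1 * γ * 1 := by ring
        _ ≤ 2 * θ * γ * κ := by gcongr; linarith
    linarith
  have hround : (2 : ℝ) ^ (M + 2) / 2 ^ p ≤ 4 * (ε * κ) := by
    calc (2 : ℝ) ^ (M + 2) / 2 ^ p = 4 * ((1 / 2 ^ p) * 2 ^ M) := by rw [pow_add]; ring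
      _ ≤ 4 * (ε * κ) := by gcongr; exact hA.prec
  have hδ0 : 0 ≤ ε * κ := by positivity
  -- 13 = 5 + 8: the error of D contributes 5θ²εκ, the rounding at most 2θ · 4εκ.
  obtain ⟨g, hg, hge⟩ := negInv_spec (θ := θ) (δ := ε * κ) (Λ := 13 * θ ^ 2 * (ε * κ)) hS
    (lprod_rfac_mul x l) (coeff_zero_lprod_pows x l) hMN hMp hθ1 bD bh hδ1
    (by
      have : 2 * θ * (2 ^ (M + 2) / 2 ^ p) ≤ 8 * θ ^ 2 * (ε * κ) := by
        calc 2 * θ * (2 ^ (M + 2) / 2 ^ p) ≤ 2 * θ * (4 * (ε * κ)) := by gcongr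
          _ = 8 * θ * (ε * κ) := by ring
          _ ≤ 8 * θ ^ 2 * (ε * κ) := by gcongr; exact le_self_pow₀ hθ1 two_ne_zero
      linarith)
    hγ1
    (by
      have h1 : 5 * θ ^ 2 * ε ≤ 1 := by
        calc 5 * θ ^ 2 * ε ≤ q * ε := by gcongr
          _ = 1 * 1 * q * ε := by ring
          _ ≤ 26 * θ ^ 3 * κ ^ 2 * q * ε := by
            gcongr
            · nlinarith [one_le_pow₀ hθ1 (n := 3)]
            · exact one_le_pow₀ hκ1
          _ ≤ 1 := hΘ1
      have h2 := hA.prec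
      have h3 : 5 * θ ^ 2 * (1 / 2 ^ p) ≤ 1 := le_trans (by gcongr) h1
      rwa [mul_one_div, div_le_one (by positivity)] at h3)
    le_rfl D₀ hD₀
  rw [← hh] at hge
  have bg : nrm (2 ^ M) (g.ps p) ≤ 2 ^ p := by
    have h1 := nrm_sub (2 ^ M) (g.ps p + h) h
    rw [add_sub_cancel_right] at h1
    linarith [hA.size]
  have bG₀ : nrm (2 ^ M) (G₀.ps p) ≤ 2 ^ p := hA.nrm_le le_rfl hG₀ bG
  obtain ⟨S, hSr, hSe⟩ := mulComplex_spec hS hMN hMp bG₀ bg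
  obtain ⟨S₀, S₁, rfl⟩ := S.exists_node
  have hZ : nrm (2 ^ M) (S₀.mirror.ps p - powerSums x (fun _ => 1) (2 ^ M) l) ≤ 2 * θ * γ := by
    rw [nrm_mirror_sub, ← lsum_rfac_mul, ← hh, nrm_node_sub p S₀ S₁]
    have h1 := nrm_mul_sub hG₀ (by rw [sub_neg_eq_add]; exact hge : nrm (2 ^ M) (g.ps p - -h) ≤ γ)
      bG (by rw [nrm_neg]; exact bh : nrm (2 ^ M) (-h) ≤ θ)
    have h2 := nrm_add (2 ^ M) ((CTr.node S₀ S₁).ps p - G₀.ps p * g.ps p)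
      (G₀.ps p * g.ps p - lsum (fun i => rfac (x i)) (fun _ => -1) l * -h)
    rw [sub_add_sub_cancel] at h2
    have h3 := hSe (2 ^ M)
    have h4 : 13 * (ε * κ) ≤ γ := by
      have : 1 ≤ θ ^ 2 * q := by nlinarith
      rw [hγ]
      nlinarith
    have h5 : ε * κ * (θ + γ) ≤ ε * κ * (2 * θ) := by gcongr; linarith
    have h6 : 13 * (ε * κ) * θ ≤ γ * θ := by gcongr
    have h7 : γ ≤ γ * θ := le_mul_of_one_le_right hγ0 hθ1
    linarith
  -- All weights are 1 at the root, so the invariant of `solve_spec` says that v_i is P'(x_i).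
  obtain ⟨A, hAr, hAe⟩ := solve_spec hS hRc hA hT hMN hMp le_rfl ht (w := fun _ => 1)
    (fun i _ => by rw [norm_one, one_mul]) (fun i _ => by rw [one_mul]) (η := 2 * θ * γ)
    (by
      have h4 : 4 * ε ≤ 2 * γ := by
        have : 1 ≤ θ ^ 2 * q := by nlinarith
        have : 1 ≤ κ * (θ ^ 2 * q) := by nlinarith
        rw [hγ]
        nlinarith
      calc 4 * ε * θ ≤ 2 * γ * θ := by gcongr
        _ = _ := by ring) hγΘ.le hZ
  refine ⟨fun j => ⟨A.re.coeff j, A.im.coeff j⟩, ?_, fun j => ?_⟩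
  · have hbp : ((2 : ℤ) ^ (bitLen p + 3)) = (N : ℤ) := by rw [hN]; push_cast; ring
    have hin : interpInput ℓ p X Y = .pair (.int ℓ) (.pair (.int p) (encode X Y l)) := by
      rw [interpInput, encode, hl, List.ofFn_eq_map]
    have hlen : (l.map fun i => Val.pair (Val.ofGauss (X i)) (Val.ofGauss (Y i))).length = n := by
      rw [List.length_map, hll]
    have hnp : n < 2 ^ p := lt_of_le_of_lt hn (Nat.pow_lt_pow_right (by norm_num) (by omega))
    have r1 := length_spec hP (p := p)
      (l.map fun i => Val.pair (Val.ofGauss (X i)) (Val.ofGauss (Y i))) (by rw [hlen]; exact hnp)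
    rw [hlen, ← encode] at r1
    rw [hin]
    refine within_of_wp (hP 19 (by norm_num)) ?_
    simp only [interpolation, callMulComplex, ↓wp_rules, ↓shape_rules]
    refine ⟨bitLen p + 3, by push_cast; ring, ?_⟩
    beta_reduce
    rw [one_mul, hbp]
    refine ⟨_, _, r1, fun t₁ ht₁ => ?_⟩
    simp only [↓shape_rules]
    rw [hM]
    refine ⟨_, _, hr, fun t₂ ht₂ => ?_⟩
    simp only [CTr.toVal, CTr.node, Tr.toVal, ↓shape_rules]
    refine ⟨_, _, hg, fun t₃ ht₃ => ?_⟩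
    refine ⟨_, _, hSr, fun t₄ ht₄ => ?_⟩
    simp only [CTr.toVal, CTr.node, Tr.toVal, ↓shape_rules]
    refine ⟨_, _, mirror_spec hP S₀.re, fun t₅ ht₅ => ?_⟩
    refine ⟨_, _, mirror_spec hP S₀.im, fun t₆ ht₆ => ?_⟩
    refine ⟨_, _, hAr, fun t₇ ht₇ => ?_⟩
    simp only [CTr.toVal, ↓shape_rules]
    refine ⟨_, _, flatten_spec hP A.re A.im [], fun t₈ ht₈ => ?_⟩
    refine ⟨_, _, takeLike_spec hP (l.map fun i => Val.pair (Val.ofGauss (X i)) (Val.ofGauss (Y i)))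
      _ (by
        rw [hlen, List.append_nil, List.length_map, List.length_range, pow_succ]
        omega), fun t₉ ht₉ => ⟨?_, ?_⟩⟩
    · rw [hlen, List.append_nil, ← List.map_take, List.take_range,
        min_eq_left (hn.trans (Nat.pow_le_pow_right two_pos (by omega)))]
      congr 1
      refine List.ext_getElem (by simp) fun k _ _ => ?_
      simp [Val.ofGauss]
    · rw [hlen] at ht₉
      have w1 : 1 ≤ 2 ^ M := Nat.one_le_two_pow
      have w2 : 2 ^ M * B ≤ 2 ^ M * (M + 1) * B :=
        Nat.mul_le_mul_right _ (Nat.le_mul_of_pos_right _ (by omega))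
      have w3 : 2 ^ M * (M + 1) * B ≤ 2 ^ M * (M + 1) ^ 2 * B := by
        gcongr; exact Nat.le_self_pow two_ne_zero _
      have w4 : (n + 1) * (p + 20) ≤ 2 ^ M * 2 * (3 * B) := Nat.mul_le_mul (by omega) (by omega)
      have w5 : B ≤ 2 ^ M * B := Nat.le_mul_of_pos_left _ w1
      have w6 : 2 ^ M ≤ 2 ^ M * B := Nat.le_mul_of_pos_right _ hB
      have e1 : 2 ^ M * 2 * (3 * B) = 6 * (2 ^ M * B) := by ring
      have e2 : 2 ^ M * (M + 1) ^ 2 * (250000000 * B) =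
        250000000 * (2 ^ M * (M + 1) ^ 2 * B) := by ring
      have e3 : 2 ^ M * (M + 1) * (200000000 * B) = 200000000 * (2 ^ M * (M + 1) * B) := by ring
      have e4 : 2 ^ M * (M + 1) * (60000000 * B) = 60000000 * (2 ^ M * (M + 1) * B) := by ring
      have e5 : 2 ^ M * (M + 1) ^ 2 * (310000000 * B) =
        310000000 * (2 ^ M * (M + 1) ^ 2 * B) := by ring
      have e6 : 2 ^ M * (M + 1) ^ 2 * (1000000000 * B) =
        1000000000 * (2 ^ M * (M + 1) ^ 2 * B) := by ring
      have e7 : 2 ^ (M + 1) = 2 * 2 ^ M := by ring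
      rw [e2] at ht₂; rw [e3] at ht₃; rw [e4] at ht₄; rw [e5] at ht₇; rw [e6]; rw [e7] at ht₈
      have b1 := bitLen_natCast_le p
      have b2 := bitLen_natCast_le (bitLen p)
      have b3 : bitLen (3 : ℤ) ≤ 3 := by exact_mod_cast bitLen_natCast_le 3
      rw [bitLen_zero, bitLen_one]
      generalize 2 ^ M * (M + 1) ^ 2 * B = q₃ at *
      generalize 2 ^ M * (M + 1) * B = q₂ at *
      generalize 2 ^ M * B = q₁ at *
      omega
  · have hv : ∀ i, (nodePoly x l).derivative.eval (x i) ≠ 0 := fun i =>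
      norm_pos_iff.1 (lt_of_lt_of_le hT.pos (hT.lower i))
    have h1 := (norm_coeff_le_nrm (Nat.lt_succ_self (j : ℕ)) _).trans (hAe (j + 1))
    rw [lsum_eq_interpolate hx hv, map_sub, Polynomial.coeff_coe, CTr.coeff_ps, norm_sub_rev] at h1
    rw [dyadic_eq]
    exact h1
end
end Interp

namespace Interp

/-! ### Separations -/

section
variable {n : ℕ} {x y : Fin n → ℂ} {τ₁ τ₂ : ℝ}

theorem localSep_le (i : Fin n) {j : Fin n} (h : j ≠ i) : localSep x i ≤ ‖x i - x j‖ :=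
  ciInf_le (f := fun j : {j : Fin n // j ≠ i} => ‖x i - x j‖) (Set.finite_range _).bddBelow ⟨j, h⟩

theorem exists_ne (hn : 2 ≤ n) (i : Fin n) : ∃ j : Fin n, j ≠ i := by
  have : Nontrivial (Fin n) := Fin.nontrivial_iff_two_le.2 hn
  exact _root_.exists_ne i

theorem localSep_pos (hn : 2 ≤ n) (hx : Function.Injective x) (i : Fin n) : 0 < localSep x i := by
  obtain ⟨j, hj⟩ := exists_ne hn i
  have : Nonempty {j : Fin n // j ≠ i} := ⟨⟨j, hj⟩⟩
  obtain ⟨k, hk⟩ := exists_eq_ciInf_of_finite (f := fun j : {j : Fin n // j ≠ i} => ‖x i - x j‖)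
  rw [localSep, ← hk, norm_pos_iff, sub_ne_zero]
  exact fun h => k.2 (hx h).symm

theorem localSep_le_two_mul (hn : 2 ≤ n) {R : ℝ} (hR : ∀ i, ‖x i‖ ≤ R) (i : Fin n) :
    localSep x i ≤ 2 * R := by
  obtain ⟨j, hj⟩ := exists_ne hn i
  exact (localSep_le i hj).trans ((norm_sub_le _ _).trans (by linarith [hR i, hR j]))

theorem nodePoly_eq_nodal (x : Fin n → ℂ) :
    nodePoly x (List.finRange n) = Lagrange.nodal Finset.univ x := by
  rw [nodePoly, lprod, Lagrange.nodal_eq, ← List.prod_ofFn, List.ofFn_eq_map]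

/-- |P'(x_i)| is the product of |x_i - x_j| over j ≠ i. Bounding each factor by the separation of
x_j, not of x_i, leads to the product over all knots up to the missing factor Δ_i ≤ 2R. -/
theorem prod_localSep_le (hn : 2 ≤ n) (hx : Function.Injective x) {R : ℝ} (hR : ∀ i, ‖x i‖ ≤ R)
    (i : Fin n) : (∏ j, localSep x j) / (2 * R) ≤
      ‖(nodePoly x (List.finRange n)).derivative.eval (x i)‖ := by
  have h0 := localSep_pos hn hx i
  have h1 := localSep_le_two_mul hn hR i
  rw [nodePoly_eq_nodal, Lagrange.eval_nodal_derivative_eval_node_eq (Finset.mem_univ i),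
    Lagrange.eval_nodal, norm_prod, div_le_iff₀ (by linarith),
    ← Finset.prod_erase_mul _ _ (Finset.mem_univ i)]
  refine mul_le_mul (Finset.prod_le_prod (fun j _ => (localSep_pos hn hx j).le) fun j hj => ?_) h1
    h0.le (Finset.prod_nonneg fun _ _ => norm_nonneg _)
  rw [norm_sub_rev]
  exact localSep_le j (Finset.ne_of_mem_erase hj).symm

theorem prod_localSep_pos (h : IsInterpInstance τ₁ τ₂ x y) : 0 < ∏ j, localSep x j :=
  Finset.prod_pos fun j _ => localSep_pos h.two_le h.distinct j

theorem lgProdSep_le (h : IsInterpInstance τ₁ τ₂ x y) : lgProdSep x ≤ n * (τ₁ + 1) := by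
  rw [lgProdSep, Real.logb_le_iff_le_rpow (by norm_num) (prod_localSep_pos h)]
  refine (Finset.prod_le_prod (fun j _ => (localSep_pos h.two_le h.distinct j).le)
    fun j _ => localSep_le_two_mul h.two_le h.norm_knot_le j).trans ?_
  rw [Finset.prod_const, Finset.card_univ, Fintype.card_fin, mul_comm (n : ℝ),
    Real.rpow_mul (by norm_num), Real.rpow_natCast, Real.rpow_add (by norm_num), Real.rpow_one,
    mul_comm (2 : ℝ)]

theorem rpow_lgProdSep (h : IsInterpInstance τ₁ τ₂ x y) :
    (2 : ℝ) ^ lgProdSep x = ∏ j, localSep x j := by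
  rw [lgProdSep, Real.rpow_logb (by norm_num) (by norm_num) (prod_localSep_pos h)]

theorem one_le_logb (h : IsInterpInstance τ₁ τ₂ x y) : 1 ≤ Real.logb 2 n := by
  have hn : (2 : ℝ) ≤ n := by exact_mod_cast h.two_le
  rw [Real.le_logb_iff_rpow_le (by norm_num) (by linarith), Real.rpow_one]
  exact hn

theorem logb_le_self {t : ℝ} (ht : 0 < t) : Real.logb 2 t ≤ t := by
  rw [Real.logb_le_iff_le_rpow (by norm_num) ht]
  rw [Real.rpow_def_of_pos two_pos]
  -- From e^(s-1) ≥ s at s = t log 2, together with e log 2 ≥ 1.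
  have h1 := Real.add_one_le_exp (Real.log 2 * t - 1)
  rw [sub_add_cancel, Real.exp_sub, le_div_iff₀ (Real.exp_pos 1)] at h1
  have h2 := Real.log_two_gt_d9
  have h3 := Real.exp_one_gt_d9
  have h4 : 1 ≤ Real.log 2 * Real.exp 1 := by nlinarith
  nlinarith

/-- The size of `λ`. -/
theorem interpPrecision_le (h : IsInterpInstance τ₁ τ₂ x y) (ℓ : ℕ) :
    interpPrecision ℓ τ₁ τ₂ x ≤ ℓ + 300 * (n * (τ₁ + 1) * Real.logb 2 n + n * τ₂
      + max 0 (-lgProdSep x) + Real.logb 2 n ^ 3) := by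
  have hn : (2 : ℝ) ≤ n := by exact_mod_cast h.two_le
  have ha := one_le_logb h
  have h1 := h.tau₁_nonneg
  have h2 := h.tau₂_nonneg
  rw [interpPrecision]
  set a := Real.logb 2 n
  have k1 : (n : ℝ) * a ≥ n := by nlinarith
  have k2 : 0 ≤ n * τ₁ * a := by positivity
  have k3 : 0 ≤ n * τ₂ := by positivity
  have k4 := le_max_right 0 (-lgProdSep x)
  have k5 := le_max_left 0 (-lgProdSep x)
  have k6 : 0 ≤ a ^ 3 := by positivity
  nlinarith

end
end Interp

/-! ### The slack in `λ` and the soft-`O` form of the cost -/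

namespace Interp

section
variable {n : ℕ} {x y : Fin n → ℂ} {τ₁ τ₂ : ℝ}

/-- Lower bound for `λ`, with the slack needed below. -/
theorem le_interpPrecision (h : IsInterpInstance τ₁ τ₂ x y) (ℓ : ℕ) :
    ℓ + 62 * (n * (τ₁ + 3) * Real.logb 2 n) + 4 * τ₂ + 50 * n + 20 +
      6 * (n * (τ₁ + 3) * Real.logb 2 n - lgProdSep x) ≤ interpPrecision ℓ τ₁ τ₂ x ∧
    lgProdSep x ≤ n * (τ₁ + 3) * Real.logb 2 n ∧ n * (τ₁ + 3) ≤ n * (τ₁ + 3) * Real.logb 2 n ∧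
    6 + τ₁ ≤ n * (τ₁ + 3) * Real.logb 2 n := by
  have hn : (2 : ℝ) ≤ n := by exact_mod_cast h.two_le
  have ha := one_le_logb h
  have h1 := h.tau₁_nonneg
  have h2 := h.tau₂_nonneg
  have h3 := lgProdSep_le h
  rw [interpPrecision]
  set a := Real.logb 2 n
  have k1 : n * (τ₁ + 3) ≤ n * (τ₁ + 3) * a := le_mul_of_one_le_right (by positivity) ha
  have k2 : 6 + τ₁ ≤ n * (τ₁ + 3) := by nlinarith
  have k3 : 0 ≤ a ^ 3 := by positivity
  have k4 : τ₂ ≤ n * τ₂ := by nlinarith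
  exact ⟨by linarith, by linarith, k1, by linarith⟩

theorem interpPrecision_pos (h : IsInterpInstance τ₁ τ₂ x y) (ℓ : ℕ) :
    0 < interpPrecision ℓ τ₁ τ₂ x := by
  obtain ⟨h1, h2, h3, h4⟩ := le_interpPrecision h ℓ
  have := h.tau₁_nonneg
  have := h.tau₂_nonneg
  have : (0 : ℝ) ≤ ℓ := by positivity
  have : (0 : ℝ) ≤ n := by positivity
  linarith

/-- The cost in soft-`O` form. -/
theorem cost_le {μ : ℕ → ℝ} {K : ℝ} {k : ℕ} (hK : 0 ≤ K)
    (hμ : ∀ m : ℕ, 1 ≤ m → μ m ≤ K * m * (1 + Real.logb 2 m) ^ k)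
    (h : IsInterpInstance τ₁ τ₂ x y) (ℓ : ℕ) {S : ℝ}
    (hS : S = n * ℓ + n ^ 2 * (τ₁ + 1) + n ^ 2 * τ₂ + n * max 0 (-lgProdSep x)) :
    n * Real.logb 2 n ^ 2 * μ ⌈interpPrecision ℓ τ₁ τ₂ x⌉₊ ≤
      K * 2000 * 20 ^ k * (S * (1 + Real.logb 2 S) ^ (k + 5)) := by
  have hn : (2 : ℝ) ≤ n := by exact_mod_cast h.two_le
  have ha := one_le_logb h
  have h1 := h.tau₁_nonneg
  have h2 := h.tau₂_nonneg
  have hpos := interpPrecision_pos h ℓ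
  have hle := interpPrecision_le h ℓ
  set m := ⌈interpPrecision ℓ τ₁ τ₂ x⌉₊ with hm
  have hm1 : 1 ≤ m := Nat.one_le_iff_ne_zero.2 (Nat.ceil_pos.2 hpos).ne'
  have hmle : (m : ℝ) ≤ interpPrecision ℓ τ₁ τ₂ x + 1 := (Nat.ceil_lt_add_one hpos.le).le
  have hm1' : (1 : ℝ) ≤ m := by exact_mod_cast hm1
  set a := Real.logb 2 n with hadef
  set mx := max 0 (-lgProdSep x)
  have hmx : 0 ≤ mx := le_max_left _ _
  have hℓ : (0 : ℝ) ≤ ℓ := by positivity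
  have s1 : (n : ℝ) ^ 2 ≤ n ^ 2 * (τ₁ + 1) := le_mul_of_one_le_right (by positivity) (by linarith)
  have p0 : 0 ≤ (n : ℝ) ^ 2 := by positivity
  have p1 : 0 ≤ (n : ℝ) * ℓ := by positivity
  have p2 : 0 ≤ (n : ℝ) ^ 2 * τ₂ := by positivity
  have p3 : 0 ≤ n * mx := by positivity
  have p4 : 0 ≤ (n : ℝ) ^ 2 * τ₁ := by positivity
  have hnS : (n : ℝ) ≤ S := by nlinarith
  have hS0 : 0 < S := by linarith
  set T := 1 + Real.logb 2 S with hT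
  have haT : a ≤ T := by
    have : a ≤ Real.logb 2 S := Real.logb_le_logb_of_le (by norm_num) (by linarith) hnS
    linarith
  have hT1 : 1 ≤ T := ha.trans haT
  have ha3 : 1 ≤ a ^ 3 := one_le_pow₀ ha
  have haa : a ≤ a ^ 3 := le_self_pow₀ ha (by norm_num)
  -- Multiplied by n, every term of the bound for λ is at most a multiple of S a³; the number 2000
  -- leaves room to spare.
  have key : n * (m : ℝ) ≤ 2000 * (S * a ^ 3) := by
    have e1 : n * (m : ℝ) ≤ n * (ℓ + 300 * (n * (τ₁ + 1) * a + n * τ₂ + mx + a ^ 3) + 1) := by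
      gcongr; linarith
    have e2 : (n : ℝ) * (ℓ + 300 * (n * (τ₁ + 1) * a + n * τ₂ + mx + a ^ 3) + 1) =
      n * ℓ + 300 * (n ^ 2 * (τ₁ + 1) * a + n ^ 2 * τ₂ + n * mx + n * a ^ 3) + n := by ring
    have e3 : (n : ℝ) ^ 2 * (τ₁ + 1) * a ≤ S * a ^ 3 := by gcongr; linarith
    have e4 : (n : ℝ) * a ^ 3 ≤ S * a ^ 3 := by gcongr
    have e5 : S ≤ S * a ^ 3 := le_mul_of_one_le_right hS0.le ha3
    have e6 : (n : ℝ) * ℓ ≤ S := by linarith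
    have e7 : (n : ℝ) ^ 2 * τ₂ ≤ S := by linarith
    have e8 : (n : ℝ) * mx ≤ S := by linarith
    linarith
  have key' : n * (m : ℝ) ≤ 2000 * (S * T ^ 3) := key.trans (by gcongr)
  have hlog : 1 + Real.logb 2 m ≤ 20 * T := by
    -- 2^11 = 2048 is the first power of two above 2000.
    have e1 : (m : ℝ) ≤ 2 ^ (11 : ℝ) * (S * T ^ 3) := by
      have : (m : ℝ) ≤ n * m := by nlinarith
      have q : (0 : ℝ) ≤ S * T ^ 3 := by positivity
      norm_num
      linarith
    have e2 := Real.logb_le_logb_of_le (b := 2) (by norm_num) (by linarith) e1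
    rw [Real.logb_mul (by positivity) (by positivity), Real.logb_rpow (by norm_num) (by norm_num),
      Real.logb_mul (by positivity) (by positivity), Real.logb_pow] at e2
    have e3 := logb_le_self (t := T) (by linarith)
    push_cast at e2
    linarith
  have hlog0 : 0 ≤ 1 + Real.logb 2 m := by
    have := Real.logb_nonneg (b := 2) (by norm_num) hm1'
    linarith
  calc n * a ^ 2 * μ m ≤ n * a ^ 2 * (K * m * (1 + Real.logb 2 m) ^ k) := by
        gcongr; exact hμ m hm1
    _ = K * (n * m) * a ^ 2 * (1 + Real.logb 2 m) ^ k := by ring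
    _ ≤ K * (2000 * (S * T ^ 3)) * T ^ 2 * (20 * T) ^ k := by gcongr
    _ = _ := by rw [mul_pow, pow_add]; ring

end
end Interp

namespace Interp

/-! ### The bounds for an instance -/

section
variable {n : ℕ} {x y : Fin n → ℂ} {τ₁ τ₂ : ℝ}

theorem lt_two_pow_bitLen (k : ℕ) : k < 2 ^ bitLen k := by
  have := Nat.lt_size_self k
  rwa [bitLen, Int.natAbs_natCast]

theorem two_pow_bitLen_le {k : ℕ} (hk : 1 ≤ k) : 2 ^ bitLen k ≤ 2 * k := by
  have h0 : 0 < k.size := Nat.size_pos.2 hk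
  have h1 : 2 ^ (k.size - 1) ≤ k := Nat.lt_size.1 (by omega)
  rw [bitLen, Int.natAbs_natCast, ← Nat.sub_add_cancel h0, pow_succ]
  simp only [Nat.succ_eq_add_one, zero_add] at *
  omega

theorem bitLen_le_logb {k : ℕ} (hk : 1 ≤ k) : (bitLen k : ℝ) ≤ Real.logb 2 k + 1 := by
  have hk0 : (0 : ℝ) < k := by exact_mod_cast hk
  have h1 : (2 : ℝ) ^ (bitLen k : ℝ) ≤ 2 * k := by
    rw [Real.rpow_natCast]; exact_mod_cast two_pow_bitLen_le hk
  rw [← Real.le_logb_iff_rpow_le (by norm_num) (by positivity),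
    Real.logb_mul (by norm_num) hk0.ne', Real.logb_self_eq_one (by norm_num)] at h1
  linarith

theorem pow_le_rpow {c t u : ℝ} (hc : c = 2 ^ t) (ht : 0 ≤ t) {k : ℕ} {r : ℝ} (hk : (k : ℝ) ≤ r)
    (hu : t * r ≤ u) : c ^ k ≤ (2 : ℝ) ^ u := by
  rw [hc, ← Real.rpow_natCast, ← Real.rpow_mul (by norm_num)]
  exact Real.rpow_le_rpow_of_exponent_le (by norm_num)
    ((mul_le_mul_of_nonneg_left hk ht).trans hu)

/-- Everything is measured in U = n(τ₁ + 3) lg n, using 2^M ≤ 2n and M ≤ lg n + 1 for the bit length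
M of n. Only the last quantity, the loss of Newton's iteration, needs the factor lg n in U. -/
theorem bounds (h : IsInterpInstance τ₁ τ₂ x y) :
    (4 * (2 : ℝ) ^ τ₁) ^ 2 ^ bitLen n ≤ 2 ^ (2 * (n * (τ₁ + 3) * Real.logb 2 n)) ∧
    (32 * (2 : ℝ) ^ τ₁) ^ 2 ^ bitLen n ≤ 2 ^ (4 * (n * (τ₁ + 3) * Real.logb 2 n)) ∧
    (5 * ((4 * (2 : ℝ) ^ τ₁) ^ 2 ^ bitLen n) ^ 2) ^ bitLen n ≤
      2 ^ (8 * (n * (τ₁ + 3) * Real.logb 2 n)) := by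
  have hn : (2 : ℝ) ≤ n := by exact_mod_cast h.two_le
  have ha := one_le_logb h
  have h1 := h.tau₁_nonneg
  have hn1 : 1 ≤ n := by have := h.two_le; omega
  have hM := bitLen_le_logb hn1
  have hpow : ((2 ^ bitLen n : ℕ) : ℝ) ≤ 2 * n := by exact_mod_cast two_pow_bitLen_le hn1
  set a := Real.logb 2 n
  have k1 : n * (τ₁ + 3) ≤ n * (τ₁ + 3) * a := le_mul_of_one_le_right (by positivity) ha
  have k2 : 0 ≤ n * τ₁ := by positivity
  have e4 : 4 * (2 : ℝ) ^ τ₁ = 2 ^ (τ₁ + 2) := by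
    rw [Real.rpow_add (by norm_num)]; norm_num; ring
  have e32 : 32 * (2 : ℝ) ^ τ₁ = 2 ^ (τ₁ + 5) := by
    rw [Real.rpow_add (by norm_num)]; norm_num; ring
  refine ⟨pow_le_rpow e4 (by linarith) hpow (by linarith),
    pow_le_rpow e32 (by linarith) hpow (by linarith), ?_⟩
  have q1 : (4 * (2 : ℝ) ^ τ₁) ^ 2 ^ bitLen n ≤ 2 ^ (2 * n * (τ₁ + 2)) :=
    pow_le_rpow e4 (by linarith) hpow (by linarith)
  have q2 : 5 * ((4 * (2 : ℝ) ^ τ₁) ^ 2 ^ bitLen n) ^ 2 ≤ 2 ^ (4 * n * (τ₁ + 2) + 3) := by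
    have : ((4 * (2 : ℝ) ^ τ₁) ^ 2 ^ bitLen n) ^ 2 ≤ 2 ^ (4 * n * (τ₁ + 2)) := by
      calc _ ≤ ((2 : ℝ) ^ (2 * n * (τ₁ + 2))) ^ 2 := by gcongr
        _ = _ := by
          rw [← Real.rpow_natCast, ← Real.rpow_mul (by norm_num)]; congr 1; push_cast; ring
    rw [Real.rpow_add (by norm_num)]
    norm_num
    have : (0 : ℝ) < 2 ^ (4 * n * (τ₁ + 2)) := by positivity
    linarith
  refine (pow_le_pow_left₀ (by positivity) q2 _).trans ?_
  refine pow_le_rpow rfl (by positivity) hM ?_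
  have k3 : 0 ≤ n * τ₁ * (a - 1) := mul_nonneg k2 (by linarith)
  have k4 : 0 ≤ n * (a - 1) := mul_nonneg (by linarith) (by linarith)
  have k5 : 0 ≤ (n - 2) * a := mul_nonneg (by linarith) (by linarith)
  nlinarith

theorem approx (h : IsInterpInstance τ₁ τ₂ x y) {ℓ p : ℕ}
    (hp : interpPrecision ℓ τ₁ τ₂ x ≤ p) {X : Fin n → GaussianInt}
    (hX : ∀ i, IsApprox (interpPrecision ℓ τ₁ τ₂ x) (x i) (dyadic p (X i))) :
    Approx p (bitLen n) (2 ^ (-interpPrecision ℓ τ₁ τ₂ x)) (2 ^ τ₁) x X := by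
  obtain ⟨h1, h2, h3, h4⟩ := le_interpPrecision h ℓ
  obtain ⟨b1, b2, -⟩ := bounds h
  have hτ₁ := h.tau₁_nonneg
  have hτ₂ := h.tau₂_nonneg
  have hℓ : (0 : ℝ) ≤ ℓ := by positivity
  have hn0 : (0 : ℝ) ≤ n := by positivity
  set lam := interpPrecision ℓ τ₁ τ₂ x
  set U := n * (τ₁ + 3) * Real.logb 2 n
  have hmono : ∀ {s t : ℝ}, s ≤ t → (2 : ℝ) ^ s ≤ 2 ^ t := fun hst =>
    Real.rpow_le_rpow_of_exponent_le (by norm_num) hst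
  have hpp : (2 : ℝ) ^ lam ≤ 2 ^ p := by rw [← Real.rpow_natCast]; exact hmono hp
  refine ⟨Real.one_le_rpow (by norm_num) hτ₁, h.norm_knot_le, hX, ?_, ?_, ?_⟩
  · rw [Real.rpow_neg (by norm_num), one_div]
    exact inv_anti₀ (by positivity) hpp
  · calc _ ≤ (2 : ℝ) ^ (-lam) * 2 ^ (4 * U) := by gcongr
      _ = 2 ^ (-lam + 4 * U) := by rw [Real.rpow_add (by norm_num)]
      _ ≤ 2 ^ (0 : ℝ) := hmono (by linarith)
      _ = 1 := Real.rpow_zero _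
  · have e1 : (1 : ℝ) ≤ 2 ^ (2 * U) := Real.one_le_rpow (by norm_num) (by linarith)
    have e2 : (2 : ℝ) ^ (2 * U + 1) = 2 ^ (2 * U) * 2 := by
      rw [Real.rpow_add (by norm_num), Real.rpow_one]
    have e3 : (2 : ℝ) ^ (2 * U + 1) ≤ 2 ^ lam := hmono (by linarith)
    linarith

/-- All conditions become linear inequalities between exponents of 2, in terms of U, τ₁, τ₂, lg ∏Δ
and λ. -/
theorem target (h : IsInterpInstance τ₁ τ₂ x y) {ℓ p : ℕ}
    (hp : interpPrecision ℓ τ₁ τ₂ x ≤ p) {Y : Fin n → GaussianInt}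
    (hY : ∀ i, IsApprox (interpPrecision ℓ τ₁ τ₂ x) (y i) (dyadic p (Y i))) :
    ∃ ν Ψ E : ℝ, Target p (bitLen n) (2 ^ (-interpPrecision ℓ τ₁ τ₂ x)) (2 ^ τ₁) y
      (fun i => (nodePoly x (List.finRange n)).derivative.eval (x i)) Y ν Ψ
      (denomErr (bitLen n) (2 ^ (-interpPrecision ℓ τ₁ τ₂ x)) (2 ^ τ₁)) E ∧
      E * (32 * 2 ^ τ₁) ^ 2 ^ bitLen n ≤ 2 ^ (-(ℓ : ℝ)) := by
  obtain ⟨h1, h2, h3, h4⟩ := le_interpPrecision h ℓ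
  obtain ⟨b1, b2, b3⟩ := bounds h
  have hτ₁ := h.tau₁_nonneg
  have hτ₂ := h.tau₂_nonneg
  have hℓ : (0 : ℝ) ≤ ℓ := by positivity
  have hn0 : (0 : ℝ) ≤ n := by positivity
  have hsep := rpow_lgProdSep h
  have hlow := prod_localSep_le h.two_le h.distinct h.norm_knot_le
  rw [← hsep] at hlow
  set lam := interpPrecision ℓ τ₁ τ₂ x
  set U := n * (τ₁ + 3) * Real.logb 2 n
  set Lg := lgProdSep x
  have hmono : ∀ {s t : ℝ}, s ≤ t → (2 : ℝ) ^ s ≤ 2 ^ t := fun hst =>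
    Real.rpow_le_rpow_of_exponent_le (by norm_num) hst
  have hadd : ∀ s t : ℝ, (2 : ℝ) ^ s * 2 ^ t = 2 ^ (s + t) := fun s t =>
    (Real.rpow_add (by norm_num) s t).symm
  have hsub : ∀ s t : ℝ, (2 : ℝ) ^ s / 2 ^ t = 2 ^ (s - t) := fun s t =>
    (Real.rpow_sub (by norm_num) s t).symm
  have hpp : (2 : ℝ) ^ lam ≤ 2 ^ p := by rw [← Real.rpow_natCast]; exact hmono hp
  have two_eq : (2 : ℝ) = 2 ^ (1 : ℝ) := (Real.rpow_one 2).symm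
  -- 22U = 3 · 2U + 2 · 4U + 8U by `bounds`, and 26 ≤ 2^5.
  have hΘ : denomErr (bitLen n) (2 ^ (-lam)) (2 ^ τ₁) ≤ 2 ^ (22 * U + 5 - lam) := by
    rw [denomErr]
    calc _ ≤ 2 ^ (5 : ℝ) * ((2 : ℝ) ^ (2 * U)) ^ 3 * (2 ^ (4 * U)) ^ 2 * 2 ^ (8 * U) *
          2 ^ (-lam) := by gcongr; norm_num
      _ = _ := by
        rw [← Real.rpow_natCast, ← Real.rpow_natCast, ← Real.rpow_mul (by norm_num),
          ← Real.rpow_mul (by norm_num), hadd, hadd, hadd, hadd]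
        congr 1; push_cast; ring
  set Θ := denomErr (bitLen n) (2 ^ (-lam)) (2 ^ τ₁)
  have hν : (2 : ℝ) ^ Lg / (2 * 2 ^ τ₁) = 2 ^ (Lg - 1 - τ₁) := by
    rw [sub_sub, ← hsub, ← hadd, Real.rpow_one]
  simp only [hν] at hlow
  have hquad : ∀ t : ℝ, (2 : ℝ) ^ t = 4 * 2 ^ (t - 2) := fun t => by
    rw [← hsub]; norm_num; ring
  -- The exponent of E has to dominate that of 2ΨΘ/ν², where ν² contributes -2 lg ∏Δ; each of the
  -- three terms of the error stays below a quarter of E.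
  refine ⟨2 ^ (Lg - 1 - τ₁), 2 ^ τ₂, 2 ^ (30 * U + τ₂ - 2 * Lg + 14 - lam), ⟨by positivity,
    by positivity, hlow, h.norm_value_le, hY, ?_, ?_, ?_, ?_, ?_, ?_⟩, ?_⟩
  · calc 2 * Θ ≤ 2 ^ (1 : ℝ) * 2 ^ (22 * U + 5 - lam) := by rw [← two_eq]; gcongr
      _ = 2 ^ (1 + (22 * U + 5 - lam)) := hadd _ _
      _ ≤ _ := hmono (by linarith)
  · calc Θ ≤ _ := hΘ
      _ ≤ 2 ^ (0 : ℝ) := hmono (by linarith)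
      _ = 1 := Real.rpow_zero _
  · have e1 : (1 : ℝ) ≤ 2 ^ τ₂ := Real.one_le_rpow (by norm_num) hτ₂
    have e2 : (2 : ℝ) ^ (τ₂ + 1) ≤ 2 ^ lam := hmono (by linarith)
    rw [← hadd, Real.rpow_one] at e2
    linarith
  · set e := 30 * U + τ₂ - 2 * Lg + 14 - lam with he
    have t1 : 4 * (2 : ℝ) ^ (-lam) ≤ 2 ^ (e - 2) := by
      calc 4 * (2 : ℝ) ^ (-lam) = 2 ^ (2 : ℝ) * 2 ^ (-lam) := by norm_num
        _ = 2 ^ (2 + -lam) := hadd _ _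
        _ ≤ _ := hmono (by linarith)
    have t2 : 2 * (2 : ℝ) ^ (-lam) / 2 ^ (Lg - 1 - τ₁) ≤ 2 ^ (e - 2) := by
      calc 2 * (2 : ℝ) ^ (-lam) / 2 ^ (Lg - 1 - τ₁) = 2 ^ (1 + -lam - (Lg - 1 - τ₁)) := by
            rw [← hsub (1 + -lam), ← hadd 1, Real.rpow_one]
        _ ≤ _ := hmono (by linarith)
    have t3 : 2 * (2 : ℝ) ^ τ₂ * Θ / (2 ^ (Lg - 1 - τ₁)) ^ 2 ≤ 2 ^ (e - 2) := by
      calc 2 * (2 : ℝ) ^ τ₂ * Θ / (2 ^ (Lg - 1 - τ₁)) ^ 2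
          ≤ 2 * (2 : ℝ) ^ τ₂ * 2 ^ (22 * U + 5 - lam) / (2 ^ (Lg - 1 - τ₁)) ^ 2 := by gcongr
        _ = 2 ^ (1 + τ₂ + (22 * U + 5 - lam) - (Lg - 1 - τ₁ + (Lg - 1 - τ₁))) := by
            rw [← hsub (1 + τ₂ + (22 * U + 5 - lam)), ← hadd (1 + τ₂), ← hadd 1,
              ← hadd (Lg - 1 - τ₁), Real.rpow_one, sq]
        _ ≤ _ := hmono (by linarith)
    rw [hquad e]
    have : (0 : ℝ) < 2 ^ (e - 2) := by positivity
    linarith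
  · rw [hsub, hadd]
    exact hmono (by linarith)
  · have t1 : (2 : ℝ) ^ τ₂ / 2 ^ (Lg - 1 - τ₁) * (4 * 2 ^ τ₁) ^ 2 ^ bitLen n ≤ 2 ^ (lam - 2) := by
      calc _ ≤ (2 : ℝ) ^ τ₂ / 2 ^ (Lg - 1 - τ₁) * 2 ^ (2 * U) := by gcongr
        _ = 2 ^ (τ₂ - (Lg - 1 - τ₁) + 2 * U) := by rw [hsub, hadd]
        _ ≤ _ := hmono (by linarith)
    have t2 : (2 : ℝ) ^ (30 * U + τ₂ - 2 * Lg + 14 - lam) * (32 * 2 ^ τ₁) ^ 2 ^ bitLen n ≤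
        2 ^ (lam - 2) := by
      calc _ ≤ (2 : ℝ) ^ (30 * U + τ₂ - 2 * Lg + 14 - lam) * 2 ^ (4 * U) := by gcongr
        _ = 2 ^ (30 * U + τ₂ - 2 * Lg + 14 - lam + 4 * U) := hadd _ _
        _ ≤ _ := hmono (by linarith)
    have := hquad lam
    have : (0 : ℝ) < 2 ^ (lam - 2) := by positivity
    linarith
  · calc _ ≤ (2 : ℝ) ^ (30 * U + τ₂ - 2 * Lg + 14 - lam) * 2 ^ (4 * U) := by gcongr
      _ = 2 ^ (30 * U + τ₂ - 2 * Lg + 14 - lam + 4 * U) := hadd _ _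
      _ ≤ _ := hmono (by linarith)

end
end Interp

namespace Interp

/-! ### Assembling the program -/

/-- Calls refer to positions in the table, which do not change when functions are added at the end;
so the given multiplication program can be put in front. -/
theorem Run.append {P : Program} (Q : Program) {c : Code} {v w : Val} {t : ℕ}
    (h : Run P c v w t) : Run (P ++ Q) c v w t := by
  induction h with
  | arg v => exact .arg v
  | const z v => exact .const z v
  | pair _ _ h₁ h₂ => exact .pair h₁ h₂
  | fst _ h => exact .fst h
  | snd _ h => exact .snd h
  | letIn _ _ h₁ h₂ => exact .letIn h₁ h₂
  | add _ _ h₁ h₂ => exact .add h₁ h₂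
  | sub _ _ h₁ h₂ => exact .sub h₁ h₂
  | shl _ _ h₁ h₂ => exact .shl h₁ h₂
  | shr _ _ h₁ h₂ => exact .shr h₁ h₂
  | size _ h => exact .size h
  | ifNeg_neg _ hx _ h₁ h₂ => exact .ifNeg_neg h₁ hx h₂
  | ifNeg_nonneg _ hx _ h₁ h₂ => exact .ifNeg_nonneg h₁ hx h₂
  | ifLeaf_int _ _ h₁ h₂ => exact .ifLeaf_int h₁ h₂
  | ifLeaf_pair _ _ h₁ h₂ => exact .ifLeaf_pair h₁ h₂
  | call _ hf _ h₁ h₂ =>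
    refine .call h₁ ?_ h₂
    rw [List.getElem?_append_left (List.getElem?_eq_some_iff.1 hf).1, hf]

theorem Run.pos {P : Program} {c : Code} {v w : Val} {t : ℕ} (h : Run P c v w t) : 1 ≤ t := by
  cases h <;> omega

theorem loaded_append (P : Program) (f : ℕ) :
    Loaded (P ++ functions P.length f) P.length f := fun i _ => by
  rw [List.getElem?_append_right (Nat.le_add_right _ _), Nat.add_sub_cancel_left]

section
variable {μ : ℕ → ℝ}

/-- This absorbs all linear work on s-bit numbers into the cost of multiplication. -/
theorem Superadditive.le (hμ : Superadditive μ) (h1 : 1 ≤ μ 1) {s : ℕ} (hs : 1 ≤ s) : s ≤ μ s := by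
  induction s, hs using Nat.le_induction with
  | base => exact_mod_cast h1
  | succ s hs ih =>
    have := hμ s 1 hs le_rfl
    push_cast
    linarith

theorem Superadditive.mono (hμ : Superadditive μ) (h1 : 1 ≤ μ 1) {s t : ℕ} (hs : 1 ≤ s)
    (hst : s ≤ t) : μ s ≤ μ t := by
  rcases hst.eq_or_lt with rfl | hlt
  · exact le_rfl
  · have h2 := hμ s (t - s) hs (by omega)
    have h3 := Superadditive.le hμ h1 (s := t - s) (by omega)
    rw [show s + (t - s) = t by omega] at h2
    have : (0 : ℝ) ≤ ((t - s : ℕ) : ℝ) := by positivity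
    linarith

end

section
variable {P : Program} {b f : ℕ} {m : ℕ → ℕ}

/-- The largest piece has N/32 bits, or 1 bit when N < 32, and this is at most p; so the whole
Newton iteration costs a multiple of m(p). -/
theorem hasRecip (hP : Loaded P b f) (hm : MulBound P f m) {p : ℕ} (hp : 1 ≤ p)
    (hmono : ∀ s, 1 ≤ s → s ≤ p → m s ≤ m p) :
    HasRecip P b (2 ^ (bitLen p + 3)) (m p) := by
  intro a ha ha'
  obtain ⟨r, hr, hre⟩ := recip_spec hP hm (bitLen p + 3) a ha ha'
  refine ⟨r, hr.mono ?_, hre⟩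
  have h1 := hmono 1 le_rfl hp
  have h2 : 2 ^ (bitLen p + 3 - 5) ≤ p := by
    have h3 := two_pow_bitLen_le hp
    by_cases h : bitLen p + 3 ≤ 5
    · rw [Nat.sub_eq_zero_of_le h, pow_zero]; exact hp
    · have : 2 ^ bitLen p = 4 * 2 ^ (bitLen p + 3 - 5) := by
        rw [show 4 = 2 ^ 2 by norm_num, ← pow_add]; congr 1; omega
      omega
  have h4 := hmono _ Nat.one_le_two_pow h2
  have h5 : min (bitLen p + 3) 5 * m 1 ≤ 5 * m p := Nat.mul_le_mul (min_le_right _ _) h1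
  omega

/-- p < 2^(bitLen p) ≤ 2p puts this power of two between 8p and 16p, and the program computes it
with one shift. -/
theorem setting (hP : Loaded P b f) (hm : MulBound P f m) {p : ℕ} (hp : 1 ≤ p) :
    Setting P b f (2 ^ (bitLen p + 3)) p (m p) := by
  have h1 := lt_two_pow_bitLen p
  have h2 := two_pow_bitLen_le hp
  have h3 : 2 ^ (bitLen p + 3) = 8 * 2 ^ bitLen p := by ring
  exact ⟨hP, hm.mulCost p hp, hp, hm.le_cost p hp, by omega, by omega⟩

theorem computes_interpolation (hP : Loaded P b f) (hm : MulBound P f m) {n ℓ p : ℕ} {τ₁ τ₂ : ℝ}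
    {x y : Fin n → ℂ} (h : IsInterpInstance τ₁ τ₂ x y)
    (hmono : ∀ s, 1 ≤ s → s ≤ p → m s ≤ m p) (hp : interpPrecision ℓ τ₁ τ₂ x ≤ p)
    {X Y : Fin n → GaussianInt}
    (hX : ∀ i, IsApprox (interpPrecision ℓ τ₁ τ₂ x) (x i) (dyadic p (X i)))
    (hY : ∀ i, IsApprox (interpPrecision ℓ τ₁ τ₂ x) (y i) (dyadic p (Y i))) :
    ∃ A : Fin n → GaussianInt,
      Within P (b + 19) (interpInput ℓ p X Y)
        (Val.ofList (List.ofFn fun j => Val.ofGauss (A j)))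
        (2 ^ bitLen n * (bitLen n + 1) ^ 2 * (1000000000 * m p)) ∧
      ∀ j : Fin n, IsApprox ℓ ((Lagrange.interpolate Finset.univ x y).coeff j) (dyadic p (A j)) := by
  obtain ⟨h1, h2, h3, h4⟩ := le_interpPrecision h ℓ
  have hn := h.two_le
  have hnR : (2 : ℝ) ≤ n := by exact_mod_cast hn
  have hτ₁ := h.tau₁_nonneg
  have hτ₂ := h.tau₂_nonneg
  have hℓ : (0 : ℝ) ≤ ℓ := by positivity
  have hpn : 50 * (n : ℝ) ≤ p := by linarith
  have hpn' : 50 * n ≤ p := by exact_mod_cast hpn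
  have hp1 : 1 ≤ p := by omega
  have hle : bitLen n ≤ n := bitLen_natCast_le n
  have hMp : bitLen n ≤ bitLen p := by
    rw [bitLen, bitLen, Int.natAbs_natCast, Int.natAbs_natCast]
    exact Nat.size_le_size (by omega)
  have hM1 : 1 ≤ bitLen n := by
    rw [bitLen, Int.natAbs_natCast]
    exact Nat.size_pos.2 (by omega)
  obtain ⟨ν, Ψ, E, hT, hE⟩ := target h hp hY
  obtain ⟨A, hA, hAe⟩ := interpolation_spec (setting hP hm hp1) (hasRecip hP hm hp1 hmono) rfl rfl
    hM1 (pow_dvd_pow 2 (by omega)) (by omega) (approx h hp hX) hT h.distinct ℓ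
  exact ⟨A, hA, fun j => (hAe j).trans hE⟩

end

theorem exists_program {μ : ℕ → ℝ} (hμ : MultipliesInTime μ) (hs : Superadditive μ) :
    ∃ (P : Program) (f : ℕ),
      ∀ (n ℓ : ℕ) (τ₁ τ₂ : ℝ) (x y : Fin n → ℂ), IsInterpInstance τ₁ τ₂ x y →
      ∀ p : ℕ, interpPrecision ℓ τ₁ τ₂ x ≤ p →
      ∀ X Y : Fin n → GaussianInt,
        (∀ i, IsApprox (interpPrecision ℓ τ₁ τ₂ x) (x i) (dyadic p (X i))) →
        (∀ i, IsApprox (interpPrecision ℓ τ₁ τ₂ x) (y i) (dyadic p (Y i))) →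
        ∃ (A : Fin n → GaussianInt) (t : ℕ),
          P.Computes f (interpInput ℓ p X Y)
            (Val.ofList (List.ofFn fun j => Val.ofGauss (A j))) t ∧
          (∀ j : Fin n,
            IsApprox ℓ ((Lagrange.interpolate Finset.univ x y).coeff j) (dyadic p (A j))) ∧
          (t : ℝ) ≤ 18000000000 * (n * Real.logb 2 n ^ 2 * μ p) := by
  obtain ⟨M, f, hM⟩ := hμ
  -- No run takes zero operations, so the product 0 · 0 already gives this.
  have h1 : 1 ≤ μ 1 := by
    obtain ⟨t, ⟨body, _, hr⟩, ht⟩ := hM 1 le_rfl 0 0 (by simp [bitLen]) (by simp [bitLen])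
    have : (1 : ℝ) ≤ t := by exact_mod_cast Run.pos hr
    linarith
  have hle := fun {s : ℕ} (h : 1 ≤ s) => Superadditive.le hs h1 h
  -- Running times are natural numbers, so μ may be replaced by its floor, which still satisfies the
  -- doubling inequality.
  have hm : MulBound (M ++ functions M.length f) f fun s => ⌊μ s⌋₊ := by
    refine ⟨fun s h a b ha hb => ?_, fun s h => Nat.le_floor (hle h), fun s h => ?_⟩
    · obtain ⟨t, ⟨body, hb, hr⟩, ht⟩ := hM s h a b ha hb
      refine ⟨t, ⟨body, ?_, Run.append _ hr⟩, Nat.le_floor ht⟩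
      rw [List.getElem?_append_left (List.getElem?_eq_some_iff.1 hb).1, hb]
    · refine Nat.le_floor ?_
      have h2 := hs s s h h
      rw [← two_mul s] at h2
      have h3 := Nat.floor_le (a := μ s) (le_trans (by positivity) (hle h))
      push_cast
      linarith
  refine ⟨M ++ functions M.length f, M.length + 19, ?_⟩
  intro n ℓ τ₁ τ₂ x y h p hp X Y hX hY
  obtain ⟨A, ⟨t, ht, htB⟩, hA⟩ := computes_interpolation (loaded_append M f) hm h
    (fun s h' hsp => Nat.floor_mono (Superadditive.mono hs h1 h' hsp)) hp hX hY
  refine ⟨A, t, ht, hA, ?_⟩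
  have hp1 : 1 ≤ p := by
    have := (interpPrecision_pos h ℓ).trans_le hp
    exact_mod_cast this
  have hn1 : 1 ≤ n := by have := h.two_le; omega
  have ha := one_le_logb h
  have hμp : (⌊μ p⌋₊ : ℝ) ≤ μ p := Nat.floor_le (le_trans (by positivity) (hle hp1))
  have b1 := bitLen_le_logb hn1
  have b2 : (2 : ℝ) ^ bitLen n ≤ 2 * n := by exact_mod_cast two_pow_bitLen_le hn1
  have b3 : (bitLen n : ℝ) + 1 ≤ 3 * Real.logb 2 n := by linarith
  -- 2^(bitLen n) ≤ 2n and bitLen n + 1 ≤ 3 lg n, the latter because lg n ≥ 1; hence the constant 2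
  -- · 9 · 10^9.
  calc (t : ℝ) ≤ 2 ^ bitLen n * (bitLen n + 1) ^ 2 * (1000000000 * ⌊μ p⌋₊) := by exact_mod_cast htB
    _ ≤ 2 * n * (3 * Real.logb 2 n) ^ 2 * (1000000000 * μ p) := by gcongr
    _ = _ := by ring

end Interp

/-! ### The main theorem -/

theorem mainTheorem3 :
    -- inputs of precision `λ` suffice, at cost `O(n lg² n μ(λ))`
    (∃ C : ℝ, ∀ μ : ℕ → ℝ, MultipliesInTime μ → Superadditive μ →
      ∃ (P : Program) (f : ℕ),
        ∀ (n ℓ : ℕ) (τ₁ τ₂ : ℝ) (x y : Fin n → ℂ), IsInterpInstance τ₁ τ₂ x y →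
        ∀ p : ℕ, interpPrecision ℓ τ₁ τ₂ x ≤ p →
        ∀ X Y : Fin n → GaussianInt,
          (∀ i, IsApprox (interpPrecision ℓ τ₁ τ₂ x) (x i) (dyadic p (X i))) →
          (∀ i, IsApprox (interpPrecision ℓ τ₁ τ₂ x) (y i) (dyadic p (Y i))) →
          ∃ (A : Fin n → GaussianInt) (t : ℕ),
            P.Computes f (interpInput ℓ p X Y)
              (Val.ofList (List.ofFn fun j => Val.ofGauss (A j))) t ∧
            (∀ j : Fin n,
              IsApprox ℓ ((Lagrange.interpolate Finset.univ x y).coeff j) (dyadic p (A j))) ∧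
            (t : ℝ) ≤ C * (n * Real.logb 2 n ^ 2 * μ p)) ∧
    -- the size of `λ`
    (∃ C : ℝ, ∀ (n ℓ : ℕ) (τ₁ τ₂ : ℝ) (x y : Fin n → ℂ), IsInterpInstance τ₁ τ₂ x y →
      interpPrecision ℓ τ₁ τ₂ x ≤ ℓ + C * (n * (τ₁ + 1) * Real.logb 2 n + n * τ₂
        + max 0 (-lgProdSep x) + Real.logb 2 n ^ 3)) ∧
    -- the soft-`O` form of the cost, for `μ(m) = Õ(m)`
    (∀ μ : ℕ → ℝ, SoftLinear μ → ∃ (C : ℝ) (k : ℕ),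
      ∀ (n ℓ : ℕ) (τ₁ τ₂ : ℝ) (x y : Fin n → ℂ), IsInterpInstance τ₁ τ₂ x y →
      ∀ S : ℝ, S = n * ℓ + n ^ 2 * (τ₁ + 1) + n ^ 2 * τ₂ + n * max 0 (-lgProdSep x) →
        n * Real.logb 2 n ^ 2 * μ ⌈interpPrecision ℓ τ₁ τ₂ x⌉₊
          ≤ C * (S * (1 + Real.logb 2 S) ^ k)) := by
  refine ⟨⟨_, fun μ hμ hs => Interp.exists_program hμ hs⟩,
    ⟨_, fun n ℓ τ₁ τ₂ x y h => Interp.interpPrecision_le h ℓ⟩, ?_⟩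
  rintro μ ⟨K, k, hK⟩
  -- The constant K may be negative a priori; `cost_le` needs a nonnegative one.
  refine ⟨_, _, fun n ℓ τ₁ τ₂ x y h S hS =>
    Interp.cost_le (K := max K 0) (k := k) (le_max_right _ _) (fun m hm => ?_) h ℓ hS⟩
  have h0 : 0 ≤ 1 + Real.logb 2 (m : ℝ) := by
    have := Real.logb_nonneg (b := 2) (by norm_num) (by exact_mod_cast hm : (1 : ℝ) ≤ m)
    linarith
  exact (hK m hm).trans (by gcongr; exact le_max_left _ _)
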